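/- Let $n\ge 2$, let $(M^n,g)$ be a smooth Riemannian manifold without boundary, and let $\Omega\subset M$ be a connected open set with compact closure and smooth boundary $\Sigma=\partial\Omega$ (so $\Omega=\{\rho<0\}$ and $\Sigma=\{\rho=0\}$ for some smooth $\rho$ on $M$ with $d\rho\ne0$ on $\Sigma$). Let $\nu$ be the outward unit normal of $\Sigma$, $\hat g$ the induced metric, $h(X,Y)=-\langle\nu,D_XY\rangle$ the second fundamental form ($X,Y$ tangent to $\Sigma$), $H=\operatorname{tr}_{\hat g}h$ the mean curvature, and $R$ the scalar curvature of $g$. Suppose that $(\Omega,\Sigma)$ is non-generic, that is, there is a function $u\in C^\infty(\overline\Omega)$ (the restriction of a smooth function on $M$), not identically zero, with $$-(\Delta u)\,g+\operatorname{Hess}u-u\operatorname{Ric}=0\ \text{ in }\Omega,\qquad u_\nu\,\hat g=u\,h\ \text{ on }\Sigma .$$ (a) If $R<0$ on $\Omega$, then there is a connected component of $\Sigma$ on which $H>0$ everywhere. In particular $\Sigma\neq\emptyset$; and if $\Sigma$ is connected, or if $H$ takes the same value at all points of $\Sigma$, then $H>0$ on all of $\Sigma$. (b) If $\Sigma\ne\emptyset$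 and $H<0$ on $\Sigma$, then $R>0$ on all of $\Omega$. -/

import Mathlib

open Bundle
open scoped Manifold ContDiff

noncomputable section

namespace StaticBoundary

/-! ### Tensor calculus in a coordinate domain of `ℝⁿ`

`G : ℝⁿ → Matrix` is the matrix `(g_ij)` of a Riemannian metric in coordinates.
A vector field is a map `Y : ℝⁿ → (Fin n → ℝ)`, given by its components. -/

section Coordinates

variable {n : ℕ}

/-- The partial derivative `∂_i f`. -/
def partialDeriv (i : Fin n) (f : EuclideanSpace ℝ (Fin n) → ℝ)
    (x : EuclideanSpace ℝ (Fin n)) : ℝ :=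
  fderiv ℝ f x (EuclideanSpace.single i 1)

variable (G : EuclideanSpace ℝ (Fin n) → Matrix (Fin n) (Fin n) ℝ)

/-- The Christoffel symbols `Γ^k_ij = ½ ∑_l g^kl (∂_i g_jl + ∂_j g_il - ∂_l g_ij)` of the
Levi-Civita connection. -/
def christoffel (k i j : Fin n) (x : EuclideanSpace ℝ (Fin n)) : ℝ :=
  (1 / 2) * ∑ l, (G x)⁻¹ k l *
    (partialDeriv i (fun y => G y j l) x + partialDeriv j (fun y => G y i l) x
      - partialDeriv l (fun y => G y i j) x)

/-- The Ricci tensor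
`R_ij = ∑_k (∂_k Γ^k_ij - ∂_j Γ^k_ik) + ∑_{k,l} (Γ^k_kl Γ^l_ij - Γ^k_jl Γ^l_ik)`
(positive on round spheres). -/
def coordRicci (i j : Fin n) (x : EuclideanSpace ℝ (Fin n)) : ℝ :=
  (∑ k, (partialDeriv k (christoffel G k i j) x - partialDeriv j (christoffel G k i k) x))
    + ∑ k, ∑ l, (christoffel G k k l x * christoffel G l i j x
      - christoffel G k j l x * christoffel G l i k x)

/-- The scalar curvature `R = ∑ g^ij R_ij`. -/
def coordScalar (x : EuclideanSpace ℝ (Fin n)) : ℝ :=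
  ∑ i, ∑ j, (G x)⁻¹ i j * coordRicci G i j x

/-- The Hessian `(Hess f)_ij = ∂_i ∂_j f - ∑_k Γ^k_ij ∂_k f`. -/
def coordHess (f : EuclideanSpace ℝ (Fin n) → ℝ) (i j : Fin n)
    (x : EuclideanSpace ℝ (Fin n)) : ℝ :=
  partialDeriv i (partialDeriv j f) x - ∑ k, christoffel G k i j x * partialDeriv k f x

/-- The Laplace-Beltrami operator `Δ f = tr_g Hess f`. -/
def coordLaplacian (f : EuclideanSpace ℝ (Fin n) → ℝ) (x : EuclideanSpace ℝ (Fin n)) : ℝ :=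
  ∑ i, ∑ j, (G x)⁻¹ i j * coordHess G f i j x

/-- The metric pairing `⟨v, w⟩ = ∑ g_ij vⁱ wʲ` at `x`. -/
def coordInner (x : EuclideanSpace ℝ (Fin n)) (v w : Fin n → ℝ) : ℝ :=
  ∑ i, ∑ j, G x i j * v i * w j

/-- The gradient `(∇ f)^k = ∑_l g^kl ∂_l f`. -/
def coordGrad (f : EuclideanSpace ℝ (Fin n) → ℝ) (x : EuclideanSpace ℝ (Fin n)) : Fin n → ℝ :=
  fun k => ∑ l, (G x)⁻¹ k l * partialDeriv l f x

/-- The covariant derivative `(D_v Y)^k = ∑_i vⁱ ∂_i Y^k + ∑_{i,j} Γ^k_ij vⁱ Yʲ` of a vector field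
`Y` in the direction of the vector `v` at `x`. -/
def coordCovDeriv (v : Fin n → ℝ) (Y : EuclideanSpace ℝ (Fin n) → Fin n → ℝ)
    (x : EuclideanSpace ℝ (Fin n)) : Fin n → ℝ :=
  fun k => (∑ i, v i * partialDeriv i (fun y => Y y k) x)
    + ∑ i, ∑ j, christoffel G k i j x * v i * Y x j

/-- The unit normal field `ν = ∇ r / |∇ r|` of the level sets of `r`; on `{r = 0}` it is the
unit normal pointing out of `{r < 0}`. -/
def coordNormal (r : EuclideanSpace ℝ (Fin n) → ℝ) (x : EuclideanSpace ℝ (Fin n)) : Fin n → ℝ :=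
  fun k => coordGrad G r x k / Real.sqrt (coordInner G x (coordGrad G r x) (coordGrad G r x))

/-- The vector field `Y - ⟨Y, ν⟩ ν` for a constant vector `Y`: it is tangent to the level sets of
`r`, and it extends `Y` from a point at which `Y` is tangent to the level set. -/
def tangentExt (r : EuclideanSpace ℝ (Fin n) → ℝ) (Y : Fin n → ℝ)
    (x : EuclideanSpace ℝ (Fin n)) : Fin n → ℝ :=
  fun k => Y k - coordInner G x Y (coordNormal G r x) * coordNormal G r x k

/-- The second fundamental form `h(X, Y) = -⟨ν, D_X Y⟩` of the level set of `r` through `x`, for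
vectors `X`, `Y` tangent to it at `x`; under the covariant derivative, `Y` is extended to
a vector field tangent to the level sets. -/
def coordSecondFF (r : EuclideanSpace ℝ (Fin n) → ℝ) (X Y : Fin n → ℝ)
    (x : EuclideanSpace ℝ (Fin n)) : ℝ :=
  -coordInner G x (coordNormal G r x) (coordCovDeriv G X (tangentExt G r Y) x)

/-- The mean curvature `H = tr_ĝ h` of the level set of `r` through `x`. The inverse of the induced
metric `ĝ`, as a bivector `∑_a E_a ⊗ E_a` (with `E_a` an orthonormal basis of the tangent space of
the level set), has the components `g^ij - νⁱ νʲ`. -/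
def coordMeanCurv (r : EuclideanSpace ℝ (Fin n) → ℝ) (x : EuclideanSpace ℝ (Fin n)) : ℝ :=
  ∑ i, ∑ j, ((G x)⁻¹ i j - coordNormal G r x i * coordNormal G r x j)
    * coordSecondFF G r (Pi.single i 1) (Pi.single j 1) x

/-- The derivative `u_ν` of `f` along the unit normal of the level sets of `r`. -/
def coordNormalDeriv (r f : EuclideanSpace ℝ (Fin n) → ℝ) (x : EuclideanSpace ℝ (Fin n)) : ℝ :=
  ∑ k, coordNormal G r x k * partialDeriv k f x

end Coordinates

/-! ### Riemannian manifolds and smooth domains -/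

section Manifold

variable {n : ℕ} {M : Type*} [TopologicalSpace M] [ChartedSpace (EuclideanSpace ℝ (Fin n)) M]

/-- A smooth Riemannian metric on the `n`-dimensional manifold `M`. -/
abbrev SmoothMetric (n : ℕ) (M : Type*) [TopologicalSpace M]
    [ChartedSpace (EuclideanSpace ℝ (Fin n)) M] [IsManifold (𝓡 n) ∞ M] :=
  ContMDiffRiemannianMetric (𝓡 n) ∞ (EuclideanSpace ℝ (Fin n))
    (fun p : M => TangentSpace (𝓡 n) p)

/-- The coordinate vector field `∂_i` of the chart `e`, at the point with coordinates `x`. -/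
def coordVec (e : OpenPartialHomeomorph M (EuclideanSpace ℝ (Fin n))) (i : Fin n)
    (x : EuclideanSpace ℝ (Fin n)) : TangentSpace (𝓡 n) (e.symm x) :=
  mfderiv (𝓡 n) (𝓡 n) e.symm x (EuclideanSpace.single i 1 : EuclideanSpace ℝ (Fin n))

variable [IsManifold (𝓡 n) ∞ M]

/-- The components `g_ij = g(∂_i, ∂_j)` of the metric in the chart `e`. -/
def metricInChart (g : SmoothMetric n M) (e : OpenPartialHomeomorph M (EuclideanSpace ℝ (Fin n)))
    (x : EuclideanSpace ℝ (Fin n)) : Matrix (Fin n) (Fin n) ℝ :=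
  Matrix.of fun i j => g.inner (e.symm x) (coordVec e i x) (coordVec e j x)

/-- The scalar curvature `R` of `(M, g)` at `p`, computed in the preferred chart at `p`. -/
def scalarCurvature (g : SmoothMetric n M) (p : M) : ℝ :=
  coordScalar (metricInChart g (chartAt (EuclideanSpace ℝ (Fin n)) p))
    (chartAt (EuclideanSpace ℝ (Fin n)) p p)

/-- The mean curvature `H` at `p ∈ {ρ = 0}` of the boundary of `{ρ < 0}`, with respect to the
outward unit normal, computed in the preferred chart at `p`. -/
def meanCurvature (g : SmoothMetric n M) (ρ : M → ℝ) (p : M) : ℝ :=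
  coordMeanCurv (metricInChart g (chartAt (EuclideanSpace ℝ (Fin n)) p))
    (ρ ∘ (chartAt (EuclideanSpace ℝ (Fin n)) p).symm) (chartAt (EuclideanSpace ℝ (Fin n)) p p)

/-- `ρ` is a defining function of the smooth domain `Ω`. -/
structure IsDefiningFunction (n : ℕ) {M : Type*} [TopologicalSpace M]
    [ChartedSpace (EuclideanSpace ℝ (Fin n)) M] (Ω : Set M) (ρ : M → ℝ) : Prop where
  smooth : ContMDiff (𝓡 n) 𝓘(ℝ) ∞ ρ
  mem_iff : ∀ p, p ∈ Ω ↔ ρ p < 0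
  mem_frontier_iff : ∀ p, p ∈ frontier Ω ↔ ρ p = 0
  regular : ∀ p ∈ frontier Ω, mfderiv (𝓡 n) 𝓘(ℝ) ρ p ≠ 0

/-- `u` is a static potential on `(Ω, Σ)`, `Σ = ∂Ω`, where `Ω = {ρ < 0}`: a function that is smooth
up to the boundary (that is, it is the restriction to the closure of `Ω` of a smooth function on
`M`), not identically zero on `Ω`, and such that, in all local coordinates,
`-(Δ u) g + Hess u - u Ric = 0` in `Ω` and `u_ν ĝ(X, Y) = u h(X, Y)` on `Σ` for all `X`, `Y` tangent
to `Σ`. -/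
structure IsStaticPotential (g : SmoothMetric n M) (Ω : Set M) (ρ : M → ℝ) (u : M → ℝ) : Prop where
  smooth : ContMDiff (𝓡 n) 𝓘(ℝ) ∞ u
  nontrivial : ∃ p ∈ Ω, u p ≠ 0
  interior_eq : ∀ e ∈ IsManifold.maximalAtlas (𝓡 n) ∞ M, ∀ p ∈ Ω, p ∈ e.source → ∀ i j : Fin n,
    -coordLaplacian (metricInChart g e) (u ∘ e.symm) (e p) * metricInChart g e (e p) i j
      + coordHess (metricInChart g e) (u ∘ e.symm) i j (e p)
      - u p * coordRicci (metricInChart g e) i j (e p) = 0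
  boundary_eq : ∀ e ∈ IsManifold.maximalAtlas (𝓡 n) ∞ M, ∀ p ∈ frontier Ω, p ∈ e.source →
    ∀ X Y : Fin n → ℝ,
    ∑ k, X k * partialDeriv k (ρ ∘ e.symm) (e p) = 0 →
    ∑ k, Y k * partialDeriv k (ρ ∘ e.symm) (e p) = 0 →
    coordNormalDeriv (metricInChart g e) (ρ ∘ e.symm) (u ∘ e.symm) (e p)
        * coordInner (metricInChart g e) (e p) X Y
      = u p * coordSecondFF (metricInChart g e) (ρ ∘ e.symm) X Y (e p)

/-- `(Ω, ∂Ω)` is a non-generic domain of `(M, g)` (a static manifold with boundary): a connected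
smooth domain, given by the defining function `ρ`, that admits a static potential. -/
structure IsNonGenericDomain (g : SmoothMetric n M) (Ω : Set M) (ρ : M → ℝ) : Prop where
  defining : IsDefiningFunction n Ω ρ
  connected : IsConnected Ω
  exists_potential : ∃ u : M → ℝ, IsStaticPotential g Ω ρ u

end Manifold

end StaticBoundary

end

/-!
Neither the constancy of the scalar curvature nor the sign statements need integration: everything
is derived from the static equation by tensor calculus in coordinates and the maximum principle.

*The scalar curvature is constant on `Ω`.* The divergence of `-(Δu) g + Hess u - u Ric = 0` is
`-½ u dR = 0`, by the Bochner formula and the contracted Bianchi identity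
(`IsNormalAt.mul_deriv_scalar_eq_zero`). The computation is done at the centre of coordinates in
which the metric is Euclidean to first order (`exists_normal_chart`). Along a segment the 1-jet of
`u` solves a linear system of ordinary differential equations, so it vanishes nowhere in the closed
domain (`IsStaticPotential.not_jet_zero`); hence `u ≠ 0` on a dense set, and `dR = 0` everywhere.
That `R` does not depend on the chart follows, in the same way, from `(n - 1) Δu = -u R` and the
invariance of the Laplacian.

*The mean curvature is locally constant on `Σ`.* The boundary condition says that `Σ` is umbilic,
and its trace is `u H = (n - 1) u_ν`; it implies that `u ≠ 0` on a dense subset of `Σ`. In normal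
coordinates the Codazzi equation computes `Ric(ν, X)`, for `X` tangent to `Σ`, from the tangential
derivatives of `u_ν / u`, and the static equation gives a second expression for it; comparing the two
yields `X(u_ν / u) = 0` (`wedge_normalDeriv_div_eq_zero`). The statement that a function has no
tangential derivative is written as `dF ∧ dρ = 0`: this is a closed condition, so it passes from the
dense set to all of `Σ`.

*The signs.* Up to replacing `u` by `-u`, the maximum of `u` over the closed domain is positive. At an
interior maximum `Δu ≤ 0`; at a boundary maximum `u_ν ≥ 0`, and `u_ν = 0` also forces `Δu ≤ 0`
(`normalDeriv_nonneg_and_laplacian_nonpos`). If `R < 0`, then `(n - 1) Δu = -u R > 0` at the maximum,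
which therefore lies on `Σ` and has `u_ν > 0`, that is, `H > 0` on its component. If `H < 0` on `Σ`,
then `u_ν < 0` wherever `u > 0` on `Σ`, so there is no positive maximum on `Σ`; this excludes `R < 0`,
and it excludes `R = 0` because then `u` is harmonic with an interior maximum, hence constant by
Hopf's strong maximum principle (`eventually_eq_of_isMaxOn`).
-/

namespace StaticBoundary

noncomputable section

/-! ### Calculus with partial derivatives on an open set -/

section Calculus

variable {n : ℕ} {U : Set (EuclideanSpace ℝ (Fin n))} {f g : EuclideanSpace ℝ (Fin n) → ℝ}
  {x : EuclideanSpace ℝ (Fin n)}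

lemma contDiffOn_diff (hU : IsOpen U) (hf : ContDiffOn ℝ ∞ f U) (hx : x ∈ U) :
    DifferentiableAt ℝ f x :=
  ((hf x hx).contDiffAt (hU.mem_nhds hx)).differentiableAt (by simp)

lemma contDiffOn_partialDeriv (hU : IsOpen U) (hf : ContDiffOn ℝ ∞ f U) (i : Fin n) :
    ContDiffOn ℝ ∞ (partialDeriv i f) U := by
  have h : ContDiffOn ℝ ∞ (fderiv ℝ f) U := hf.fderiv_of_isOpen hU (by simp)
  exact h.clm_apply contDiffOn_const

lemma partialDeriv_congr (hU : IsOpen U) (h : Set.EqOn f g U) (i : Fin n) :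
    Set.EqOn (partialDeriv i f) (partialDeriv i g) U := by
  intro x hx
  have : f =ᶠ[nhds x] g := h.eventuallyEq_of_mem (hU.mem_nhds hx)
  simp only [partialDeriv, this.fderiv_eq]

lemma partialDeriv_add (hU : IsOpen U) (hf : ContDiffOn ℝ ∞ f U) (hg : ContDiffOn ℝ ∞ g U)
    (hx : x ∈ U) (i : Fin n) :
    partialDeriv i (fun y => f y + g y) x = partialDeriv i f x + partialDeriv i g x := by
  simp only [partialDeriv]
  rw [fderiv_fun_add (contDiffOn_diff hU hf hx) (contDiffOn_diff hU hg hx)]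
  simp

lemma partialDeriv_sub (hU : IsOpen U) (hf : ContDiffOn ℝ ∞ f U) (hg : ContDiffOn ℝ ∞ g U)
    (hx : x ∈ U) (i : Fin n) :
    partialDeriv i (fun y => f y - g y) x = partialDeriv i f x - partialDeriv i g x := by
  simp only [partialDeriv]
  rw [fderiv_fun_sub (contDiffOn_diff hU hf hx) (contDiffOn_diff hU hg hx)]
  simp

lemma partialDeriv_mul (hU : IsOpen U) (hf : ContDiffOn ℝ ∞ f U) (hg : ContDiffOn ℝ ∞ g U)
    (hx : x ∈ U) (i : Fin n) :
    partialDeriv i (fun y => f y * g y) x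
      = partialDeriv i f x * g x + f x * partialDeriv i g x := by
  simp only [partialDeriv]
  rw [fderiv_fun_mul (contDiffOn_diff hU hf hx) (contDiffOn_diff hU hg hx)]
  simp; ring

lemma partialDeriv_const_mul (hU : IsOpen U) (hf : ContDiffOn ℝ ∞ f U) (c : ℝ)
    (hx : x ∈ U) (i : Fin n) :
    partialDeriv i (fun y => c * f y) x = c * partialDeriv i f x := by
  simp only [partialDeriv]
  rw [fderiv_const_mul (contDiffOn_diff hU hf hx)]
  simp

lemma partialDeriv_const (c : ℝ) (i : Fin n) :
    partialDeriv i (fun _ : EuclideanSpace ℝ (Fin n) => c) x = 0 := by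
  simp [partialDeriv]

lemma partialDeriv_neg (i : Fin n) :
    partialDeriv i (fun y => -f y) x = -partialDeriv i f x := by
  simp [partialDeriv, fderiv_fun_neg]

lemma partialDeriv_sum {ι : Type*} (s : Finset ι) {F : ι → EuclideanSpace ℝ (Fin n) → ℝ}
    (hU : IsOpen U) (hF : ∀ a, ContDiffOn ℝ ∞ (F a) U) (hx : x ∈ U) (i : Fin n) :
    partialDeriv i (fun y => ∑ a ∈ s, F a y) x = ∑ a ∈ s, partialDeriv i (F a) x := by
  simp only [partialDeriv]
  rw [fderiv_fun_sum (fun a _ => contDiffOn_diff hU (hF a) hx)]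
  simp

lemma partialDeriv_comm (hU : IsOpen U) (hf : ContDiffOn ℝ ∞ f U) (hx : x ∈ U) (i j : Fin n) :
    partialDeriv i (partialDeriv j f) x = partialDeriv j (partialDeriv i f) x := by
  have hf' : ContDiffAt ℝ ∞ f x := (hf x hx).contDiffAt (hU.mem_nhds hx)
  have hd : DifferentiableAt ℝ (fderiv ℝ f) x :=
    (hf'.fderiv_right (m := 1) (by norm_cast)).differentiableAt (by simp)
  have hs : IsSymmSndFDerivAt ℝ f x := hf'.isSymmSndFDerivAt (by simp; norm_cast)
  have key : ∀ a b : Fin n, partialDeriv a (partialDeriv b f) x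
      = fderiv ℝ (fderiv ℝ f) x (EuclideanSpace.single a 1) (EuclideanSpace.single b 1) := by
    intro a b
    unfold partialDeriv
    rw [fderiv_clm_apply hd (differentiableAt_const _)]
    simp
  rw [key, key, hs.eq]

lemma fderiv_apply_eq_sum (f : EuclideanSpace ℝ (Fin n) → ℝ) (x v : EuclideanSpace ℝ (Fin n)) :
    fderiv ℝ f x v = ∑ i, v i * partialDeriv i f x := by
  have : v = ∑ i, v i • EuclideanSpace.single i (1 : ℝ) := by
    ext j; simp [Finset.sum_apply, Pi.single_apply]
  conv_lhs => rw [this]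
  simp [partialDeriv]

lemma partialDeriv_partialDeriv_mul (hU : IsOpen U) (hf : ContDiffOn ℝ ∞ f U)
    (hg : ContDiffOn ℝ ∞ g U) (hx : x ∈ U) (i j : Fin n) :
    partialDeriv i (partialDeriv j (fun y => f y * g y)) x
      = partialDeriv i (partialDeriv j f) x * g x + partialDeriv j f x * partialDeriv i g x
        + (partialDeriv i f x * partialDeriv j g x
          + f x * partialDeriv i (partialDeriv j g) x) := by
  have h1 : Set.EqOn (partialDeriv j (fun y => f y * g y))
      (fun y => partialDeriv j f y * g y + f y * partialDeriv j g y) U :=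
    fun y hy => partialDeriv_mul hU hf hg hy j
  have hfj := contDiffOn_partialDeriv hU hf j
  have hgj := contDiffOn_partialDeriv hU hg j
  rw [partialDeriv_congr hU h1 i hx, partialDeriv_add hU (hfj.mul hg) (hf.mul hgj) hx,
    partialDeriv_mul hU hfj hg hx, partialDeriv_mul hU hf hgj hx]

end Calculus

/-! ### Riemannian metrics on an open set -/

section Metric

variable {n : ℕ}

/-- `G` is the component matrix of a smooth Riemannian metric on the open set `U`. -/
structure IsMetricOn (G : EuclideanSpace ℝ (Fin n) → Matrix (Fin n) (Fin n) ℝ)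
    (U : Set (EuclideanSpace ℝ (Fin n))) : Prop where
  isOpen : IsOpen U
  smooth : ∀ i j, ContDiffOn ℝ ∞ (fun y => G y i j) U
  posDef : ∀ x ∈ U, (G x).PosDef

variable {G : EuclideanSpace ℝ (Fin n) → Matrix (Fin n) (Fin n) ℝ}
  {U : Set (EuclideanSpace ℝ (Fin n))} {x : EuclideanSpace ℝ (Fin n)}

namespace IsMetricOn

lemma symm (hG : IsMetricOn G U) (hx : x ∈ U) (i j : Fin n) : G x i j = G x j i := by
  simpa using (hG.posDef x hx).isHermitian.apply j i

lemma isUnit_det (hG : IsMetricOn G U) (hx : x ∈ U) : IsUnit (G x).det :=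
  (hG.posDef x hx).det_pos.ne'.isUnit

lemma inv_symm (hG : IsMetricOn G U) (hx : x ∈ U) (i j : Fin n) : (G x)⁻¹ i j = (G x)⁻¹ j i := by
  simpa using (hG.posDef x hx).inv.isHermitian.apply j i

lemma sum_mul_inv (hG : IsMetricOn G U) (hx : x ∈ U) (i j : Fin n) :
    ∑ k, G x i k * (G x)⁻¹ k j = if i = j then 1 else 0 := by
  rw [← Matrix.mul_apply, Matrix.mul_nonsing_inv _ (hG.isUnit_det hx), Matrix.one_apply]

lemma sum_inv_mul (hG : IsMetricOn G U) (hx : x ∈ U) (i j : Fin n) :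
    ∑ k, (G x)⁻¹ i k * G x k j = if i = j then 1 else 0 := by
  rw [← Matrix.mul_apply, Matrix.nonsing_inv_mul _ (hG.isUnit_det hx), Matrix.one_apply]

lemma contDiffOn_det {A : EuclideanSpace ℝ (Fin n) → Matrix (Fin n) (Fin n) ℝ}
    (hA : ∀ i j, ContDiffOn ℝ ∞ (fun y => A y i j) U) :
    ContDiffOn ℝ ∞ (fun y => (A y).det) U := by
  simp only [Matrix.det_apply]
  refine ContDiffOn.sum fun σ _ => ContDiffOn.const_smul _ ?_
  exact contDiffOn_prod fun i _ => hA _ _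

lemma smooth_inv (hG : IsMetricOn G U) (i j : Fin n) :
    ContDiffOn ℝ ∞ (fun y => (G y)⁻¹ i j) U := by
  have h : Set.EqOn (fun y => (G y)⁻¹ i j) (fun y => ((G y).det)⁻¹ * (G y).adjugate i j) U := by
    intro y _
    simp [Matrix.inv_def]
  refine ContDiffOn.congr ?_ h
  refine ((contDiffOn_det hG.smooth).inv fun y hy => (hG.isUnit_det hy).ne_zero).mul ?_
  simp only [Matrix.adjugate_apply]
  refine contDiffOn_det fun a b => ?_
  by_cases hab : a = j
  · subst hab
    simp only [Matrix.updateRow_self]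
    exact contDiffOn_const
  · simp only [Matrix.updateRow_ne hab]
    exact hG.smooth a b

lemma smooth_christoffel (hG : IsMetricOn G U) (k i j : Fin n) :
    ContDiffOn ℝ ∞ (christoffel G k i j) U := by
  unfold christoffel
  refine contDiffOn_const.mul (ContDiffOn.sum fun l _ => (hG.smooth_inv k l).mul ?_)
  exact ((contDiffOn_partialDeriv hG.isOpen (hG.smooth j l) i).add
    (contDiffOn_partialDeriv hG.isOpen (hG.smooth i l) j)).sub
    (contDiffOn_partialDeriv hG.isOpen (hG.smooth i j) l)

lemma smooth_ricci (hG : IsMetricOn G U) (i j : Fin n) :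
    ContDiffOn ℝ ∞ (coordRicci G i j) U := by
  unfold coordRicci
  have hc := hG.smooth_christoffel
  refine ContDiffOn.add (ContDiffOn.sum fun k _ => ?_) (ContDiffOn.sum fun k _ =>
    ContDiffOn.sum fun l _ => ?_)
  · exact (contDiffOn_partialDeriv hG.isOpen (hc k i j) k).sub
      (contDiffOn_partialDeriv hG.isOpen (hc k i k) j)
  · exact ((hc k k l).mul (hc l i j)).sub ((hc k j l).mul (hc l i k))

lemma smooth_scalar (hG : IsMetricOn G U) : ContDiffOn ℝ ∞ (coordScalar G) U := by
  unfold coordScalar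
  exact ContDiffOn.sum fun i _ => ContDiffOn.sum fun j _ =>
    (hG.smooth_inv i j).mul (hG.smooth_ricci i j)

lemma smooth_hess (hG : IsMetricOn G U) {f : EuclideanSpace ℝ (Fin n) → ℝ}
    (hf : ContDiffOn ℝ ∞ f U) (i j : Fin n) : ContDiffOn ℝ ∞ (coordHess G f i j) U := by
  unfold coordHess
  exact (contDiffOn_partialDeriv hG.isOpen (contDiffOn_partialDeriv hG.isOpen hf j) i).sub
    (ContDiffOn.sum fun k _ => (hG.smooth_christoffel k i j).mul
      (contDiffOn_partialDeriv hG.isOpen hf k))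

lemma smooth_laplacian (hG : IsMetricOn G U) {f : EuclideanSpace ℝ (Fin n) → ℝ}
    (hf : ContDiffOn ℝ ∞ f U) : ContDiffOn ℝ ∞ (coordLaplacian G f) U := by
  unfold coordLaplacian
  exact ContDiffOn.sum fun i _ => ContDiffOn.sum fun j _ =>
    (hG.smooth_inv i j).mul (hG.smooth_hess hf i j)

end IsMetricOn

lemma christoffel_symm (hG : IsMetricOn G U) (hx : x ∈ U) (k i j : Fin n) :
    christoffel G k i j x = christoffel G k j i x := by
  unfold christoffel
  congr 1
  refine Finset.sum_congr rfl fun l _ => ?_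
  have := partialDeriv_congr hG.isOpen (f := fun y => G y i j) (g := fun y => G y j i)
    (fun y hy => hG.symm hy i j) l hx
  rw [this]; ring

end Metric

/-! ### Curvature in coordinates that are normal to first order at a point -/

section Normal

variable {n : ℕ} {G : EuclideanSpace ℝ (Fin n) → Matrix (Fin n) (Fin n) ℝ}
  {U : Set (EuclideanSpace ℝ (Fin n))} {x : EuclideanSpace ℝ (Fin n)}

/-- The Christoffel symbols of the first kind `½ (∂_i g_jl + ∂_j g_il - ∂_l g_ij)`. -/
def christoffelFirst (G : EuclideanSpace ℝ (Fin n) → Matrix (Fin n) (Fin n) ℝ) (i j l : Fin n)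
    (x : EuclideanSpace ℝ (Fin n)) : ℝ :=
  (1 / 2) * (partialDeriv i (fun y => G y j l) x + partialDeriv j (fun y => G y i l) x
    - partialDeriv l (fun y => G y i j) x)

lemma christoffel_eq_sum (k i j : Fin n) (y : EuclideanSpace ℝ (Fin n)) :
    christoffel G k i j y = ∑ l, (G y)⁻¹ k l * christoffelFirst G i j l y := by
  unfold christoffel christoffelFirst
  rw [Finset.mul_sum]
  exact Finset.sum_congr rfl fun l _ => by ring

lemma IsMetricOn.smooth_christoffelFirst (hG : IsMetricOn G U) (i j l : Fin n) :
    ContDiffOn ℝ ∞ (christoffelFirst G i j l) U := by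
  unfold christoffelFirst
  exact contDiffOn_const.mul (((contDiffOn_partialDeriv hG.isOpen (hG.smooth j l) i).add
    (contDiffOn_partialDeriv hG.isOpen (hG.smooth i l) j)).sub
    (contDiffOn_partialDeriv hG.isOpen (hG.smooth i j) l))

/-- The metric `G` on `U` is Euclidean to first order at `x ∈ U`: there `g_ij = δ_ij`, and all
`∂_k g_ij` vanish. -/
structure IsNormalAt (G : EuclideanSpace ℝ (Fin n) → Matrix (Fin n) (Fin n) ℝ)
    (U : Set (EuclideanSpace ℝ (Fin n))) (x : EuclideanSpace ℝ (Fin n)) : Prop where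
  metric : IsMetricOn G U
  mem : x ∈ U
  eq_one : G x = 1
  deriv_eq_zero : ∀ k i j, partialDeriv k (fun y => G y i j) x = 0

/-- Derivatives of a sum `∑ a_l b_l` at a point where `a = e_k` to first order and `b = 0`. -/
lemma partialDeriv_sum_mul_of_normal (hU : IsOpen U) (hx : x ∈ U)
    {a b : Fin n → EuclideanSpace ℝ (Fin n) → ℝ} (ha : ∀ l, ContDiffOn ℝ ∞ (a l) U)
    (hb : ∀ l, ContDiffOn ℝ ∞ (b l) U) {k : Fin n} (ha0 : ∀ l, a l x = if k = l then 1 else 0)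
    (ha1 : ∀ m l, partialDeriv m (a l) x = 0) (hb0 : ∀ l, b l x = 0) :
    (∀ m, partialDeriv m (fun y => ∑ l, a l y * b l y) x = partialDeriv m (b k) x) ∧
    (∀ p m, partialDeriv p (partialDeriv m (fun y => ∑ l, a l y * b l y)) x
      = partialDeriv p (partialDeriv m (b k)) x) := by
  have hab : ∀ l, ContDiffOn ℝ ∞ (fun y => a l y * b l y) U := fun l => (ha l).mul (hb l)
  constructor
  · intro m
    rw [partialDeriv_sum _ hU hab hx]
    simp [partialDeriv_mul hU (ha _) (hb _) hx, ha0, ha1, hb0]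
  · intro p m
    have h1 : Set.EqOn (partialDeriv m (fun y => ∑ l, a l y * b l y))
        (fun y => ∑ l, partialDeriv m (fun y => a l y * b l y) y) U :=
      fun y hy => partialDeriv_sum _ hU hab hy m
    rw [partialDeriv_congr hU h1 p hx,
      partialDeriv_sum _ hU (fun l => contDiffOn_partialDeriv hU (hab l) m) hx]
    simp [partialDeriv_partialDeriv_mul hU (ha _) (hb _) hx, ha0, ha1, hb0]

namespace IsNormalAt

lemma inv_eq_one (h : IsNormalAt G U x) : (G x)⁻¹ = 1 := by rw [h.eq_one, inv_one]

lemma inv_apply (h : IsNormalAt G U x) (i j : Fin n) : (G x)⁻¹ i j = if i = j then 1 else 0 := by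
  rw [h.inv_eq_one, Matrix.one_apply]

lemma deriv_inv_eq_zero (h : IsNormalAt G U x) (m i j : Fin n) :
    partialDeriv m (fun y => (G y)⁻¹ i j) x = 0 := by
  have hU := h.metric.isOpen
  have h1 : Set.EqOn (fun y => ∑ k, G y i k * (G y)⁻¹ k j)
      (fun _ => if i = j then (1 : ℝ) else 0) U := fun y hy => h.metric.sum_mul_inv hy i j
  have h2 := partialDeriv_congr hU h1 m h.mem
  rw [partialDeriv_const, partialDeriv_sum _ hU
    (fun k => (h.metric.smooth i k).mul (h.metric.smooth_inv k j)) h.mem] at h2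
  simpa [partialDeriv_mul hU (h.metric.smooth _ _) (h.metric.smooth_inv _ _) h.mem,
    h.deriv_eq_zero, h.eq_one, Matrix.one_apply] using h2

lemma christoffelFirst_eq_zero (h : IsNormalAt G U x) (i j l : Fin n) :
    christoffelFirst G i j l x = 0 := by
  simp [christoffelFirst, h.deriv_eq_zero]

lemma christoffel_eq_zero (h : IsNormalAt G U x) (k i j : Fin n) : christoffel G k i j x = 0 := by
  simp [christoffel_eq_sum, h.christoffelFirst_eq_zero]

lemma deriv_christoffel (h : IsNormalAt G U x) (k i j : Fin n) :
    (∀ m, partialDeriv m (christoffel G k i j) x = partialDeriv m (christoffelFirst G i j k) x) ∧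
    (∀ p m, partialDeriv p (partialDeriv m (christoffel G k i j)) x
      = partialDeriv p (partialDeriv m (christoffelFirst G i j k)) x) := by
  have h0 : christoffel G k i j = fun y => ∑ l, (G y)⁻¹ k l * christoffelFirst G i j l y :=
    funext fun y => christoffel_eq_sum k i j y
  rw [h0]
  exact partialDeriv_sum_mul_of_normal (a := fun l y => (G y)⁻¹ k l) h.metric.isOpen h.mem
    (fun l => h.metric.smooth_inv k l) (fun l => h.metric.smooth_christoffelFirst i j l)
    (fun l => h.inv_apply k l) (fun m l => h.deriv_inv_eq_zero m k l)
    (fun l => h.christoffelFirst_eq_zero i j l)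

lemma _root_.StaticBoundary.IsMetricOn.deriv_christoffelFirst (h : IsMetricOn G U)
    {y : EuclideanSpace ℝ (Fin n)} (hy : y ∈ U) (m i j l : Fin n) :
    partialDeriv m (christoffelFirst G i j l) y
      = (1 / 2) * (partialDeriv m (partialDeriv i (fun y => G y j l)) y
        + partialDeriv m (partialDeriv j (fun y => G y i l)) y
        - partialDeriv m (partialDeriv l (fun y => G y i j)) y) := by
  have hs := fun i a b => contDiffOn_partialDeriv h.isOpen (h.smooth a b) i
  unfold christoffelFirst
  rw [partialDeriv_const_mul h.isOpen (((hs _ _ _).add (hs _ _ _)).sub (hs _ _ _)) _ hy,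
    partialDeriv_sub h.isOpen ((hs _ _ _).add (hs _ _ _)) (hs _ _ _) hy,
    partialDeriv_add h.isOpen (hs _ _ _) (hs _ _ _) hy]

lemma _root_.StaticBoundary.IsMetricOn.deriv_deriv_christoffelFirst (h : IsMetricOn G U)
    {y : EuclideanSpace ℝ (Fin n)} (hy : y ∈ U) (p m i j l : Fin n) :
    partialDeriv p (partialDeriv m (christoffelFirst G i j l)) y
      = (1 / 2) * (partialDeriv p (partialDeriv m (partialDeriv i (fun y => G y j l))) y
        + partialDeriv p (partialDeriv m (partialDeriv j (fun y => G y i l))) y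
        - partialDeriv p (partialDeriv m (partialDeriv l (fun y => G y i j))) y) := by
  have hs := fun m i a b => contDiffOn_partialDeriv h.isOpen
    (contDiffOn_partialDeriv h.isOpen (h.smooth a b) i) m
  have h1 : Set.EqOn (partialDeriv m (christoffelFirst G i j l)) _ U :=
    fun z hz => h.deriv_christoffelFirst hz m i j l
  rw [partialDeriv_congr h.isOpen h1 p hy,
    partialDeriv_const_mul h.isOpen (((hs _ _ _ _).add (hs _ _ _ _)).sub (hs _ _ _ _)) _ hy,
    partialDeriv_sub h.isOpen ((hs _ _ _ _).add (hs _ _ _ _)) (hs _ _ _ _) hy,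
    partialDeriv_add h.isOpen (hs _ _ _ _) (hs _ _ _ _) hy]

lemma ricci_eq (h : IsNormalAt G U x) (i j : Fin n) :
    coordRicci G i j x = ∑ k, (partialDeriv k (christoffelFirst G i j k) x
      - partialDeriv j (christoffelFirst G i k k) x) := by
  simp only [coordRicci, h.christoffel_eq_zero, (h.deriv_christoffel _ _ _).1]
  simp

lemma deriv_ricci (h : IsNormalAt G U x) (m i j : Fin n) :
    partialDeriv m (coordRicci G i j) x
      = ∑ k, (partialDeriv m (partialDeriv k (christoffelFirst G i j k)) x
        - partialDeriv m (partialDeriv j (christoffelFirst G i k k)) x) := by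
  have hU := h.metric.isOpen
  have hc := h.metric.smooth_christoffel
  have hd := fun m k i j => contDiffOn_partialDeriv hU (hc k i j) m
  have h1 : ∀ k, ContDiffOn ℝ ∞ (fun y => partialDeriv k (christoffel G k i j) y
      - partialDeriv j (christoffel G k i k) y) U := fun k => (hd _ _ _ _).sub (hd _ _ _ _)
  have h2 : ∀ k l, ContDiffOn ℝ ∞ (fun y => christoffel G k k l y * christoffel G l i j y
      - christoffel G k j l y * christoffel G l i k y) U :=
    fun k l => ((hc _ _ _).mul (hc _ _ _)).sub ((hc _ _ _).mul (hc _ _ _))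
  have h3 : ∀ k, ContDiffOn ℝ ∞ (fun y => ∑ l, (christoffel G k k l y * christoffel G l i j y
      - christoffel G k j l y * christoffel G l i k y)) U := fun k => ContDiffOn.sum fun l _ => h2 k l
  unfold coordRicci
  rw [partialDeriv_add hU (ContDiffOn.sum fun k _ => h1 k) (ContDiffOn.sum fun k _ => h3 k) h.mem,
    partialDeriv_sum _ hU h1 h.mem, partialDeriv_sum _ hU h3 h.mem]
  have h4 : ∀ k, partialDeriv m (fun y => ∑ l, (christoffel G k k l y * christoffel G l i j y
      - christoffel G k j l y * christoffel G l i k y)) x = 0 := by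
    intro k
    rw [partialDeriv_sum _ hU (h2 k) h.mem]
    refine Finset.sum_eq_zero fun l _ => ?_
    rw [partialDeriv_sub hU ((hc _ _ _).mul (hc _ _ _)) ((hc _ _ _).mul (hc _ _ _)) h.mem,
      partialDeriv_mul hU (hc _ _ _) (hc _ _ _) h.mem,
      partialDeriv_mul hU (hc _ _ _) (hc _ _ _) h.mem]
    simp [h.christoffel_eq_zero]
  simp only [h4, Finset.sum_const_zero, add_zero]
  refine Finset.sum_congr rfl fun k _ => ?_
  rw [partialDeriv_sub hU (hd _ _ _ _) (hd _ _ _ _) h.mem, (h.deriv_christoffel _ _ _).2,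
    (h.deriv_christoffel _ _ _).2]

/-- Differentiation commutes with the metric trace at the centre of normal coordinates. -/
lemma deriv_trace (h : IsNormalAt G U x) {T : Fin n → Fin n → EuclideanSpace ℝ (Fin n) → ℝ}
    (hT : ∀ i j, ContDiffOn ℝ ∞ (T i j) U) (m : Fin n) :
    partialDeriv m (fun y => ∑ i, ∑ j, (G y)⁻¹ i j * T i j y) x
      = ∑ i, partialDeriv m (T i i) x := by
  have hU := h.metric.isOpen
  have hs := fun i j => (h.metric.smooth_inv i j).mul (hT i j)
  rw [partialDeriv_sum _ hU (fun i => ContDiffOn.sum fun j _ => hs i j) h.mem]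
  refine Finset.sum_congr rfl fun i _ => ?_
  rw [partialDeriv_sum _ hU (fun j => hs i j) h.mem]
  simp [partialDeriv_mul hU (h.metric.smooth_inv i _) (hT i _) h.mem, h.deriv_inv_eq_zero,
    h.inv_apply]

lemma trace_eq (h : IsNormalAt G U x) (T : Fin n → Fin n → ℝ) :
    ∑ i, ∑ j, (G x)⁻¹ i j * T i j = ∑ i, T i i := by
  simp [h.inv_apply]

/-- The second derivatives of the metric components are symmetric in both pairs of indices. -/
lemma _root_.StaticBoundary.IsMetricOn.deriv_deriv_symm (h : IsMetricOn G U)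
    {y : EuclideanSpace ℝ (Fin n)} (hy : y ∈ U) (i j a b : Fin n) :
    partialDeriv i (partialDeriv j (fun y => G y a b)) y
      = partialDeriv i (partialDeriv j (fun y => G y b a)) y :=
  partialDeriv_congr h.isOpen (partialDeriv_congr h.isOpen (fun _ hz => h.symm hz a b) j) i hy

lemma _root_.StaticBoundary.IsMetricOn.deriv_deriv_deriv_symm (h : IsMetricOn G U)
    {y : EuclideanSpace ℝ (Fin n)} (hy : y ∈ U) (k i j a b : Fin n) :
    partialDeriv k (partialDeriv i (partialDeriv j (fun y => G y a b))) y
      = partialDeriv k (partialDeriv i (partialDeriv j (fun y => G y b a))) y :=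
  partialDeriv_congr h.isOpen (fun _ hz => h.deriv_deriv_symm hz i j a b) k hy

/-- The contracted second Bianchi identity `div Ric = ½ dR`, at the centre of normal coordinates. -/
lemma sum_deriv_ricci (h : IsNormalAt G U x) (i : Fin n) :
    ∑ j, partialDeriv j (coordRicci G i j) x = (1 / 2) * partialDeriv i (coordScalar G) x := by
  have hU := h.metric.isOpen
  have e1 : partialDeriv i (coordScalar G) x = ∑ j, partialDeriv i (coordRicci G j j) x :=
    h.deriv_trace h.metric.smooth_ricci i
  rw [e1]
  simp only [h.deriv_ricci, h.metric.deriv_deriv_christoffelFirst h.mem]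
  -- only third derivatives of the metric survive, and these are symmetric in the derivatives and
  -- in the components
  set D : Fin n → Fin n → Fin n → Fin n → Fin n → ℝ := fun p m i a b =>
    partialDeriv p (partialDeriv m (partialDeriv i (fun y => G y a b))) x with hD
  have s12 : ∀ p m i a b, D p m i a b = D m p i a b := fun p m i a b =>
    partialDeriv_comm hU (contDiffOn_partialDeriv hU (h.metric.smooth a b) i) h.mem p m
  have s23 : ∀ p m i a b, D p m i a b = D p i m a b := fun p m i a b =>
    partialDeriv_congr hU (fun y hy => partialDeriv_comm hU (h.metric.smooth a b) hy m i) p h.mem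
  have sab : ∀ p m i a b, D p m i a b = D p m i b a := fun p m i a b =>
    h.metric.deriv_deriv_deriv_symm h.mem p m i a b
  change ∑ j, ∑ k, ((1 / 2) * (D j k i j k + D j k j i k - D j k k i j)
      - (1 / 2) * (D j j i k k + D j j k i k - D j j k i k))
    = (1 / 2) * ∑ j, ∑ k, ((1 / 2) * (D i k j j k + D i k j j k - D i k k j j)
      - (1 / 2) * (D i j j k k + D i j k j k - D i j k j k))
  have r1 : ∀ j k, D j k i j k = D i j k j k := fun j k => by rw [s23, s12]
  have r2 : ∀ j k, D j j i k k = D i j j k k := fun j k => by rw [s23, s12]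
  have r3 : ∀ j k, D i k j j k = D i j k j k := fun j k => by rw [s23]
  have c1 : ∑ j, ∑ k, D j k j i k = ∑ j, ∑ k, D j k k i j := by
    rw [Finset.sum_comm]
    exact Finset.sum_congr rfl fun j _ => Finset.sum_congr rfl fun k _ => s12 _ _ _ _ _
  have c2 : ∑ j, ∑ k, D i k k j j = ∑ j, ∑ k, D i j j k k := Finset.sum_comm
  simp only [r1, r2, r3, mul_sub, mul_add, Finset.sum_add_distrib, Finset.sum_sub_distrib,
    ← Finset.mul_sum, c1, c2]
  ring

/-- The static equation `-(Δu) g + Hess u - u Ric = 0` forces `u dR = 0`: its divergence is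
`-u div Ric`, because the Bochner formula `div Hess u = d(Δu) + Ric(∇u)` cancels the rest. -/
lemma mul_deriv_scalar_eq_zero (h : IsNormalAt G U x) {f : EuclideanSpace ℝ (Fin n) → ℝ}
    (hf : ContDiffOn ℝ ∞ f U) {V : Set (EuclideanSpace ℝ (Fin n))} (hV : IsOpen V)
    (hx : x ∈ V)
    (hstat : ∀ y ∈ V, ∀ i j, -coordLaplacian G f y * G y i j + coordHess G f i j y
      - f y * coordRicci G i j y = 0) (i : Fin n) :
    f x * partialDeriv i (coordScalar G) x = 0 := by
  have hU := h.metric.isOpen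
  have hL := h.metric.smooth_laplacian hf
  have hH := h.metric.smooth_hess hf
  have hR := h.metric.smooth_ricci
  have hfd := fun k => contDiffOn_partialDeriv hU hf k
  -- the derivative of the static equation
  have e1 : ∀ m i j, -partialDeriv m (coordLaplacian G f) x * (if i = j then 1 else 0)
      + partialDeriv m (coordHess G f i j) x
      = partialDeriv m f x * coordRicci G i j x + f x * partialDeriv m (coordRicci G i j) x := by
    intro m i j
    have h1 : Set.EqOn (fun y => -coordLaplacian G f y * G y i j + coordHess G f i j y)
        (fun y => f y * coordRicci G i j y) V := fun y hy => by
      have := hstat y hy i j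
      simp only
      linarith
    have h2 := partialDeriv_congr hV h1 m hx
    rw [partialDeriv_add hU (hL.neg.mul (h.metric.smooth i j)) (hH i j) h.mem,
      partialDeriv_mul hU hL.neg (h.metric.smooth i j) h.mem,
      partialDeriv_mul hU hf (hR i j) h.mem, partialDeriv_neg, h.deriv_eq_zero, h.eq_one,
      Matrix.one_apply] at h2
    linarith
  have e2 : partialDeriv i (coordLaplacian G f) x
      = ∑ j, partialDeriv i (coordHess G f j j) x := h.deriv_trace hH i
  have e3 : ∀ m i j, partialDeriv m (coordHess G f i j) x
      = partialDeriv m (partialDeriv i (partialDeriv j f)) x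
        - ∑ k, partialDeriv m (christoffelFirst G i j k) x * partialDeriv k f x := by
    intro m i j
    have hc := h.metric.smooth_christoffel
    unfold coordHess
    rw [partialDeriv_sub hU (contDiffOn_partialDeriv hU (hfd j) i)
      (ContDiffOn.sum fun k _ => (hc k i j).mul (hfd k)) h.mem,
      partialDeriv_sum _ hU (fun k => (hc k i j).mul (hfd k)) h.mem]
    congr 1
    refine Finset.sum_congr rfl fun k _ => ?_
    rw [partialDeriv_mul hU (hc k i j) (hfd k) h.mem, h.christoffel_eq_zero, zero_mul, add_zero,
      (h.deriv_christoffel _ _ _).1]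
  have e4 : -partialDeriv i (coordLaplacian G f) x + ∑ j, partialDeriv j (coordHess G f i j) x
      = ∑ j, partialDeriv j f x * coordRicci G i j x
        + f x * ((1 / 2) * partialDeriv i (coordScalar G) x) := by
    rw [← h.sum_deriv_ricci, Finset.mul_sum, ← Finset.sum_add_distrib]
    rw [← Finset.sum_congr rfl fun j _ => e1 j i j]
    simp [Finset.sum_add_distrib]
  -- the Bochner formula
  have e5 : ∑ j, partialDeriv j (coordHess G f i j) x - ∑ j, partialDeriv i (coordHess G f j j) x
      = ∑ j, partialDeriv j f x * coordRicci G i j x := by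
    simp only [e3, h.ricci_eq, Finset.mul_sum]
    have t : ∀ j, partialDeriv j (partialDeriv i (partialDeriv j f)) x
        = partialDeriv i (partialDeriv j (partialDeriv j f)) x :=
      fun j => partialDeriv_comm hU (hfd j) h.mem j i
    have s : ∀ i j a b, partialDeriv i (partialDeriv j (fun y => G y a b)) x
        = partialDeriv j (partialDeriv i (fun y => G y a b)) x :=
      fun i j a b => partialDeriv_comm hU (h.metric.smooth a b) h.mem i j
    simp only [Finset.sum_sub_distrib, t]
    rw [sub_sub_sub_cancel_left, ← Finset.sum_sub_distrib]
    simp only [← Finset.sum_sub_distrib]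
    rw [Finset.sum_comm]
    refine Finset.sum_congr rfl fun k _ => Finset.sum_congr rfl fun j _ => ?_
    simp only [h.metric.deriv_christoffelFirst h.mem]
    rw [h.metric.deriv_deriv_symm h.mem j i k j, s j i j k, s k i j j, s k j i j]
    ring
  rw [e2] at e4
  have : f x * ((1 / 2) * partialDeriv i (coordScalar G) x) = 0 := by linarith
  linarith

end IsNormalAt

end Normal

/-! ### The geometry of level sets in coordinates -/

section LevelSet

variable {n : ℕ} {G : EuclideanSpace ℝ (Fin n) → Matrix (Fin n) (Fin n) ℝ}
  {U : Set (EuclideanSpace ℝ (Fin n))} {x : EuclideanSpace ℝ (Fin n)}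
  {r f : EuclideanSpace ℝ (Fin n) → ℝ}

/-- The pairing `⟨∇a, ∇b⟩` of two gradients. -/
def coordPairing (G : EuclideanSpace ℝ (Fin n) → Matrix (Fin n) (Fin n) ℝ)
    (a b : EuclideanSpace ℝ (Fin n) → ℝ) (x : EuclideanSpace ℝ (Fin n)) : ℝ :=
  ∑ i, ∑ j, (G x)⁻¹ i j * (partialDeriv i a x * partialDeriv j b x)

lemma IsMetricOn.smooth_pairing (hG : IsMetricOn G U) (hr : ContDiffOn ℝ ∞ r U)
    (hf : ContDiffOn ℝ ∞ f U) : ContDiffOn ℝ ∞ (coordPairing G r f) U := by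
  unfold coordPairing
  exact ContDiffOn.sum fun i _ => ContDiffOn.sum fun j _ => (hG.smooth_inv i j).mul
    ((contDiffOn_partialDeriv hG.isOpen hr i).mul (contDiffOn_partialDeriv hG.isOpen hf j))

lemma IsMetricOn.smooth_grad (hG : IsMetricOn G U) (hr : ContDiffOn ℝ ∞ r U) (k : Fin n) :
    ContDiffOn ℝ ∞ (fun y => coordGrad G r y k) U := by
  unfold coordGrad
  exact ContDiffOn.sum fun l _ => (hG.smooth_inv k l).mul (contDiffOn_partialDeriv hG.isOpen hr l)

lemma coordInner_eq_dotProduct (v w : Fin n → ℝ) :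
    coordInner G x v w = v ⬝ᵥ (G x).mulVec w := by
  simp only [coordInner, dotProduct, Matrix.mulVec, Finset.mul_sum]
  exact Finset.sum_congr rfl fun i _ => Finset.sum_congr rfl fun j _ => by ring

lemma coordGrad_eq_mulVec :
    coordGrad G r x = (G x)⁻¹.mulVec (fun l => partialDeriv l r x) := rfl

lemma IsMetricOn.inner_comm (hG : IsMetricOn G U) (hx : x ∈ U) (v w : Fin n → ℝ) :
    coordInner G x v w = coordInner G x w v := by
  unfold coordInner
  rw [Finset.sum_comm]
  refine Finset.sum_congr rfl fun i _ => Finset.sum_congr rfl fun j _ => ?_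
  rw [hG.symm hx j i]; ring

lemma IsMetricOn.inner_grad (hG : IsMetricOn G U) (hx : x ∈ U) (v : Fin n → ℝ) :
    coordInner G x v (coordGrad G r x) = ∑ k, v k * partialDeriv k r x := by
  rw [coordInner_eq_dotProduct, coordGrad_eq_mulVec, Matrix.mulVec_mulVec,
    Matrix.mul_nonsing_inv _ (hG.isUnit_det hx), Matrix.one_mulVec]
  rfl

lemma coordPairing_eq_sum_grad (hG : IsMetricOn G U) (hx : x ∈ U) :
    coordPairing G r f x = ∑ k, coordGrad G r x k * partialDeriv k f x := by
  simp only [coordPairing, coordGrad, Finset.sum_mul]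
  rw [Finset.sum_comm]
  refine Finset.sum_congr rfl fun i _ => Finset.sum_congr rfl fun j _ => ?_
  rw [hG.inv_symm hx]; ring

lemma IsMetricOn.inner_grad_grad (hG : IsMetricOn G U) (hx : x ∈ U) :
    coordInner G x (coordGrad G r x) (coordGrad G r x) = coordPairing G r r x := by
  rw [hG.inner_grad hx, coordPairing_eq_sum_grad hG hx]

lemma IsMetricOn.pairing_self_pos (hG : IsMetricOn G U) (hx : x ∈ U)
    (h : ∃ k, partialDeriv k r x ≠ 0) : 0 < coordPairing G r r x := by
  have h0 : (fun l => partialDeriv l r x) ≠ 0 := fun h0 => by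
    obtain ⟨k, hk⟩ := h
    exact hk (congrFun h0 k)
  have := (hG.posDef x hx).inv.dotProduct_mulVec_pos h0
  have e : coordPairing G r r x = (fun l => partialDeriv l r x) ⬝ᵥ
      (G x)⁻¹.mulVec (fun l => partialDeriv l r x) := by
    simp only [coordPairing, dotProduct, Matrix.mulVec, Finset.mul_sum]
    exact Finset.sum_congr rfl fun i _ => Finset.sum_congr rfl fun j _ => by ring
  rw [e]
  exact this

lemma coordNormal_eq (hG : IsMetricOn G U) (hx : x ∈ U) (k : Fin n) :
    coordNormal G r x k = coordGrad G r x k / Real.sqrt (coordPairing G r r x) := by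
  rw [coordNormal, hG.inner_grad_grad hx]

lemma coordNormalDeriv_eq (hG : IsMetricOn G U) (hx : x ∈ U) :
    coordNormalDeriv G r f x = coordPairing G r f x / Real.sqrt (coordPairing G r r x) := by
  rw [coordPairing_eq_sum_grad hG hx, Finset.sum_div]
  simp only [coordNormalDeriv, coordNormal_eq hG hx]
  exact Finset.sum_congr rfl fun k _ => by ring

lemma inner_normal (hG : IsMetricOn G U) (hx : x ∈ U) (v : Fin n → ℝ) :
    coordInner G x v (coordNormal G r x)
      = (∑ k, v k * partialDeriv k r x) / Real.sqrt (coordPairing G r r x) := by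
  rw [← hG.inner_grad hx]
  simp only [coordInner, Finset.sum_div, coordNormal_eq hG hx]
  exact Finset.sum_congr rfl fun i _ => Finset.sum_congr rfl fun j _ => by ring

lemma sum_normal_mul_deriv (hG : IsMetricOn G U) (hx : x ∈ U) :
    ∑ k, coordNormal G r x k * partialDeriv k r x = Real.sqrt (coordPairing G r r x) := by
  have h := coordNormalDeriv_eq (r := r) (f := r) hG hx
  rw [Real.div_sqrt] at h
  exact h

lemma sum_tangentExt_mul_deriv (hG : IsMetricOn G U) (hx : x ∈ U)
    (h : ∃ k, partialDeriv k r x ≠ 0) (Y : Fin n → ℝ) :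
    ∑ k, tangentExt G r Y x k * partialDeriv k r x = 0 := by
  have hN := Real.sqrt_pos.2 (hG.pairing_self_pos hx h)
  simp only [tangentExt, sub_mul, Finset.sum_sub_distrib, mul_assoc, ← Finset.mul_sum]
  rw [sum_normal_mul_deriv hG hx, inner_normal hG hx, div_mul_cancel₀ _ hN.ne', sub_self]

lemma tangentExt_eq_self (hG : IsMetricOn G U) (hx : x ∈ U) {Y : Fin n → ℝ}
    (hY : ∑ k, Y k * partialDeriv k r x = 0) : tangentExt G r Y x = Y := by
  funext k
  rw [tangentExt, inner_normal hG hx, hY]; simp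

section Regular

variable (hG : IsMetricOn G U) (hr : ContDiffOn ℝ ∞ r U)
  (hreg : ∀ y ∈ U, ∃ k, partialDeriv k r y ≠ 0)

include hG hr hreg

lemma smooth_sqrt_pairing :
    ContDiffOn ℝ ∞ (fun y => Real.sqrt (coordPairing G r r y)) U :=
  (hG.smooth_pairing hr hr).sqrt fun y hy => (hG.pairing_self_pos hy (hreg y hy)).ne'

lemma smooth_normal (k : Fin n) : ContDiffOn ℝ ∞ (fun y => coordNormal G r y k) U := by
  refine ContDiffOn.congr ?_ (fun y hy => coordNormal_eq hG hy k)
  exact (hG.smooth_grad hr k).div (smooth_sqrt_pairing hG hr hreg)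
    fun y hy => (Real.sqrt_pos.2 (hG.pairing_self_pos hy (hreg y hy))).ne'

lemma smooth_tangentExt (Y : Fin n → ℝ) (k : Fin n) :
    ContDiffOn ℝ ∞ (fun y => tangentExt G r Y y k) U := by
  unfold tangentExt coordInner
  have := smooth_normal hG hr hreg
  exact contDiffOn_const.sub ((ContDiffOn.sum fun i _ => ContDiffOn.sum fun j _ =>
    ((hG.smooth i j).mul contDiffOn_const).mul (this j)).mul (this k))

/-- The second fundamental form of a level set is `Hess r / |∇r|`. -/
lemma coordSecondFF_eq (hx : x ∈ U) (X Y : Fin n → ℝ) :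
    coordSecondFF G r X Y x
      = (∑ i, ∑ j, coordHess G r i j x * X i * tangentExt G r Y x j)
        / Real.sqrt (coordPairing G r r x) := by
  have hU := hG.isOpen
  have hY := smooth_tangentExt hG hr hreg Y
  have hdr := contDiffOn_partialDeriv hU hr
  -- `Y` is extended tangentially, so differentiating `dr(Y) = 0` moves the derivative to `r`
  have h1 : ∀ i, ∑ k, (partialDeriv i (fun y => tangentExt G r Y y k) x * partialDeriv k r x
      + tangentExt G r Y x k * partialDeriv i (partialDeriv k r) x) = 0 := by
    intro i
    have h2 : Set.EqOn (fun y => ∑ k, tangentExt G r Y y k * partialDeriv k r y)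
        (fun _ => (0 : ℝ)) U := fun y hy => sum_tangentExt_mul_deriv hG hy (hreg y hy) Y
    have h3 := partialDeriv_congr hU h2 i hx
    rw [partialDeriv_const, partialDeriv_sum _ hU (fun k => (hY k).mul (hdr k)) hx] at h3
    rw [← h3]
    exact Finset.sum_congr rfl fun k _ => (partialDeriv_mul hU (hY k) (hdr k) hx i).symm
  rw [coordSecondFF, hG.inner_comm hx, inner_normal hG hx, ← neg_div]
  congr 1
  simp only [coordCovDeriv, coordHess, add_mul, Finset.sum_add_distrib]
  have h4 : ∑ k, (∑ i, X i * partialDeriv i (fun y => tangentExt G r Y y k) x)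
        * partialDeriv k r x
      = -∑ i, ∑ k, X i * (tangentExt G r Y x k * partialDeriv i (partialDeriv k r) x) := by
    simp only [Finset.sum_mul]
    rw [Finset.sum_comm, ← Finset.sum_neg_distrib]
    refine Finset.sum_congr rfl fun i _ => ?_
    have := h1 i
    rw [Finset.sum_add_distrib] at this
    simp only [mul_assoc, ← Finset.mul_sum]
    rw [eq_neg_of_add_eq_zero_left this]; ring
  rw [h4]
  have h5 : ∑ k, (∑ i, ∑ j, christoffel G k i j x * X i * tangentExt G r Y x j)
        * partialDeriv k r x
      = ∑ i, ∑ j, (∑ k, christoffel G k i j x * partialDeriv k r x)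
        * X i * tangentExt G r Y x j := by
    simp only [Finset.sum_mul]
    rw [Finset.sum_comm]
    refine Finset.sum_congr rfl fun i _ => ?_
    rw [Finset.sum_comm]
    exact Finset.sum_congr rfl fun j _ => Finset.sum_congr rfl fun k _ => by ring
  rw [h5, neg_add, neg_neg, ← sub_eq_add_neg, ← Finset.sum_sub_distrib]
  refine Finset.sum_congr rfl fun i _ => ?_
  rw [← Finset.sum_sub_distrib]
  exact Finset.sum_congr rfl fun j _ => by ring

lemma coordSecondFF_of_tangent (hx : x ∈ U) (X : Fin n → ℝ) {Y : Fin n → ℝ}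
    (hY : ∑ k, Y k * partialDeriv k r x = 0) :
    coordSecondFF G r X Y x
      = (∑ i, ∑ j, coordHess G r i j x * X i * Y j) / Real.sqrt (coordPairing G r r x) := by
  rw [coordSecondFF_eq hG hr hreg hx, tangentExt_eq_self hG hx hY]

lemma smooth_meanCurv : ContDiffOn ℝ ∞ (coordMeanCurv G r) U := by
  unfold coordMeanCurv
  have hn := smooth_normal hG hr hreg
  refine ContDiffOn.sum fun i _ => ContDiffOn.sum fun j _ =>
    ((hG.smooth_inv i j).sub ((hn i).mul (hn j))).mul ?_
  refine ContDiffOn.congr ?_ (fun y hy => coordSecondFF_eq hG hr hreg hy _ _)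
  refine ContDiffOn.div ?_ (smooth_sqrt_pairing hG hr hreg)
    fun y hy => (Real.sqrt_pos.2 (hG.pairing_self_pos hy (hreg y hy))).ne'
  exact ContDiffOn.sum fun a _ => ContDiffOn.sum fun b _ =>
    ((hG.smooth_hess hr a b).mul contDiffOn_const).mul (smooth_tangentExt hG hr hreg _ b)

/-- The trace of the boundary condition `u_ν ĝ = u h` is `(n - 1) u_ν = u H`. -/
lemma mul_meanCurv_eq (hx : x ∈ U) {κ c : ℝ}
    (h : ∀ X Y : Fin n → ℝ, ∑ k, X k * partialDeriv k r x = 0 →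
      ∑ k, Y k * partialDeriv k r x = 0 →
      κ * coordInner G x X Y = c * coordSecondFF G r X Y x) :
    c * coordMeanCurv G r x = (n - 1) * κ := by
  -- `P` is the inverse of the induced metric as a bivector: its columns are tangent to the level
  -- set, and `P G P = P`, `tr (G P) = n - 1`
  set ν := coordNormal G r x with hν
  have hN := Real.sqrt_pos.2 (hG.pairing_self_pos hx (hreg x hx))
  set P : Matrix (Fin n) (Fin n) ℝ := (G x)⁻¹ - Matrix.vecMulVec ν ν with hP
  have hdet := hG.isUnit_det hx
  have hGs : (G x).transpose = G x := Matrix.ext fun i j => hG.symm hx j i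
  have hPs : P.transpose = P := by
    ext i j; simp [hP, Matrix.vecMulVec_apply, hG.inv_symm hx i j, mul_comm]
  have hνν : ν ⬝ᵥ (G x).mulVec ν = 1 := by
    rw [← coordInner_eq_dotProduct, inner_normal hG hx, hν, sum_normal_mul_deriv hG hx,
      div_self hN.ne']
  have hPG : P * G x * P = P := by
    have e1 : Matrix.vecMulVec ν ν * G x * Matrix.vecMulVec ν ν = Matrix.vecMulVec ν ν := by
      rw [mul_assoc, Matrix.mul_vecMulVec, Matrix.vecMulVec_mul_vecMulVec, hνν, one_smul]
    rw [hP, sub_mul, Matrix.nonsing_inv_mul _ hdet, sub_mul, one_mul, mul_sub, e1,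
      mul_assoc, Matrix.mul_nonsing_inv _ hdet, mul_one, sub_self, sub_zero]
  have hPt : ∀ l, ∑ k, P k l * partialDeriv k r x = 0 := by
    intro l
    have e1 : ∑ k, (G x)⁻¹ k l * partialDeriv k r x = coordGrad G r x l := by
      unfold coordGrad
      exact Finset.sum_congr rfl fun k _ => by rw [hG.inv_symm hx]
    have e2 := sum_normal_mul_deriv (r := r) hG hx
    have e3 : ∑ k, P k l * partialDeriv k r x
        = ∑ k, (G x)⁻¹ k l * partialDeriv k r x
          - (∑ k, ν k * partialDeriv k r x) * ν l := by
      rw [Finset.sum_mul, ← Finset.sum_sub_distrib]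
      refine Finset.sum_congr rfl fun k _ => ?_
      simp only [hP, Matrix.sub_apply, Matrix.vecMulVec_apply]; ring
    rw [e3, e1, hν, e2, coordNormal_eq hG hx, mul_div_cancel₀ _ hN.ne', sub_self]
  set B : Matrix (Fin n) (Fin n) ℝ :=
    Matrix.of fun i j => coordSecondFF G r (Pi.single i 1) (Pi.single j 1) x with hB
  have hlinT : ∀ Y k, tangentExt G r Y x k
      = ∑ b, Y b * tangentExt G r (Pi.single b 1) x k := by
    intro Y k
    have e1 : ∀ Z : Fin n → ℝ, coordInner G x Z (coordNormal G r x)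
        = ∑ b, Z b * coordInner G x (Pi.single b 1) (coordNormal G r x) := by
      intro Z
      simp only [inner_normal hG hx]
      simp [Pi.single_apply, Finset.sum_div, mul_div_assoc]
    simp only [tangentExt, mul_sub, Finset.sum_sub_distrib]
    rw [e1 Y, Finset.sum_mul]
    simp [Pi.single_apply, mul_assoc]
  have hlin : ∀ X Y : Fin n → ℝ, coordSecondFF G r X Y x = X ⬝ᵥ B.mulVec Y := by
    intro X Y
    simp only [hB, dotProduct, Matrix.mulVec, Matrix.of_apply, coordSecondFF_eq hG hr hreg hx]
    rw [Finset.sum_div]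
    refine Finset.sum_congr rfl fun i _ => ?_
    have e1 : ∀ b, ∑ i', ∑ j, coordHess G r i' j x * (Pi.single i 1 : Fin n → ℝ) i'
          * tangentExt G r (Pi.single b 1) x j
        = ∑ j, coordHess G r i j x * tangentExt G r (Pi.single b 1) x j := by
      intro b
      rw [Finset.sum_eq_single i]
      · simp
      · intro c _ hc
        simp [hc]
      · simp
    simp only [e1, hlinT Y]
    simp only [Finset.sum_div, Finset.mul_sum, Finset.sum_mul]
    rw [Finset.sum_comm]
    exact Finset.sum_congr rfl fun b _ => Finset.sum_congr rfl fun j _ => by ring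
  have hPBP : c • (P * B * P) = κ • P := by
    rw [← hPG]
    conv_lhs => rw [hPG]
    ext k l
    have e := h (fun i => P i k) (fun i => P i l) (hPt k) (hPt l)
    rw [hlin, coordInner_eq_dotProduct] at e
    have e2 : ∀ A : Matrix (Fin n) (Fin n) ℝ,
        (P * A * P) k l = (fun i => P i k) ⬝ᵥ A.mulVec (fun i => P i l) := by
      intro A
      rw [mul_assoc, Matrix.mul_apply]
      refine Finset.sum_congr rfl fun i _ => ?_
      have : P k i = P i k := congrFun (congrFun hPs i) k
      rw [this]; rfl
    rw [Matrix.smul_apply, Matrix.smul_apply, e2, e2]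
    exact e.symm
  have hH : coordMeanCurv G r x = (P * B.transpose).trace := by
    simp only [coordMeanCurv, Matrix.trace, Matrix.diag, Matrix.mul_apply, hP, hB]
    rfl
  have htr : (P * B.transpose).trace = (G x * (P * B * P)).trace := by
    calc (P * B.transpose).trace = (P * G x * P * B.transpose).trace := by rw [hPG]
      _ = ((P * G x * P * B.transpose).transpose).trace := (Matrix.trace_transpose _).symm
      _ = (B * P * G x * P).trace := by
        simp only [Matrix.transpose_mul, Matrix.transpose_transpose, hPs, hGs, mul_assoc]
      _ = (G x * (P * B * P)).trace := by
        rw [mul_assoc, Matrix.trace_mul_comm]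
        simp only [mul_assoc]
  have hGP : (G x * P).trace = n - 1 := by
    rw [hP, mul_sub, Matrix.mul_nonsing_inv _ hdet, Matrix.trace_sub, Matrix.trace_one,
      Matrix.mul_vecMulVec, Matrix.trace_vecMulVec, Fintype.card_fin, dotProduct_comm, hνν]
  have : c * coordMeanCurv G r x = (G x * (c • (P * B * P))).trace := by
    rw [hH, htr, Matrix.mul_smul, Matrix.trace_smul, smul_eq_mul]
  rw [this, hPBP, Matrix.mul_smul, Matrix.trace_smul, hGP, smul_eq_mul, mul_comm]

end Regular

end LevelSet

/-! ### Umbilic boundaries and the Codazzi equation -/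

section Codazzi

variable {n : ℕ} {G : EuclideanSpace ℝ (Fin n) → Matrix (Fin n) (Fin n) ℝ}
  {U V : Set (EuclideanSpace ℝ (Fin n))} {x : EuclideanSpace ℝ (Fin n)}
  {r f F : EuclideanSpace ℝ (Fin n) → ℝ}

lemma contDiffOn_hasStrictFDerivAt (hV : IsOpen V) (hF : ContDiffOn ℝ ∞ F V) (hx : x ∈ V) :
    HasStrictFDerivAt F (fderiv ℝ F x) x :=
  ((hF x hx).contDiffAt (hV.mem_nhds hx)).hasStrictFDerivAt (by simp)

/-- A function that vanishes on `{r = 0}` has differential proportional to `dr` there. The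
proportionality is expressed as `dF ∧ dr = 0`, which is a closed condition. -/
lemma wedge_eq_zero_of_vanishing (hV : IsOpen V) (hF : ContDiffOn ℝ ∞ F V)
    (hr : ContDiffOn ℝ ∞ r V) (hx : x ∈ V) (hrx : r x = 0)
    (hFr : ∀ y ∈ V, r y = 0 → F y = 0) (v w : EuclideanSpace ℝ (Fin n)) :
    fderiv ℝ F x v * fderiv ℝ r x w = fderiv ℝ F x w * fderiv ℝ r x v := by
  have hext : IsLocalExtrOn F {y | r y = r x} x := by
    left
    filter_upwards [mem_nhdsWithin_of_mem_nhds (hV.mem_nhds hx), self_mem_nhdsWithin] with y hy hy'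
    rw [hFr y hy (Eq.trans hy' hrx), hFr x hx hrx]
  obtain ⟨a, b, hab, h⟩ := hext.exists_multipliers_of_hasStrictFDerivAt_1d
    (contDiffOn_hasStrictFDerivAt hV hr hx) (contDiffOn_hasStrictFDerivAt hV hF hx)
  have e : ∀ v, a * fderiv ℝ r x v + b * fderiv ℝ F x v = 0 := fun v => by
    simpa using DFunLike.congr_fun h v
  by_cases hb : b = 0
  · have ha : a ≠ 0 := fun ha => hab (by simp [ha, hb])
    have e2 : ∀ v, fderiv ℝ r x v = 0 := fun v => by
      have := e v
      rw [hb, zero_mul, add_zero] at this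
      exact (mul_eq_zero.1 this).resolve_left ha
    simp [e2]
  · apply mul_left_cancel₀ hb
    linear_combination fderiv ℝ r x w * e v - fderiv ℝ r x v * e w

lemma partialDeriv_mul₃ {a b c : EuclideanSpace ℝ (Fin n) → ℝ} (hU : IsOpen U)
    (ha : ContDiffOn ℝ ∞ a U) (hb : ContDiffOn ℝ ∞ b U) (hc : ContDiffOn ℝ ∞ c U) (hx : x ∈ U)
    (i : Fin n) :
    partialDeriv i (fun y => a y * b y * c y) x
      = partialDeriv i a x * b x * c x + a x * partialDeriv i b x * c x
        + a x * b x * partialDeriv i c x := by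
  rw [partialDeriv_mul hU (ha.mul hb) hc hx, partialDeriv_mul hU ha hb hx]
  ring

/-- The Codazzi equation of an umbilic boundary. In coordinates that are normal at `x` and in which
`dr` is a multiple of `dx_o` there, suppose that `Hess r = μ g` on vectors tangent to `{r = 0}`.
Then `Ric(∂_o, ∂_a)` is determined by `θ_a = s ∂_a μ - μ ∂_a∂_o r`, where `s = ∂_o r(x)`. -/
lemma codazzi_umbilic (h : IsNormalAt G U x) (hr : ContDiffOn ℝ ∞ r U) (hV : IsOpen V)
    (hVU : V ⊆ U) (hxV : x ∈ V) (hrx : r x = 0) {o : Fin n}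
    (hro : partialDeriv o r x ≠ 0) (hra : ∀ a, a ≠ o → partialDeriv a r x = 0)
    {μ : EuclideanSpace ℝ (Fin n) → ℝ} (hμ : ContDiffOn ℝ ∞ μ V)
    (humb : ∀ y ∈ V, r y = 0 → ∀ X Y : Fin n → ℝ, ∑ k, X k * partialDeriv k r y = 0 →
      ∑ k, Y k * partialDeriv k r y = 0 →
      μ y * coordInner G y X Y = ∑ i, ∑ j, coordHess G r i j y * X i * Y j) :
    (∀ a b, a ≠ o → b ≠ o →
      partialDeriv a (partialDeriv b r) x = if a = b then μ x else 0) ∧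
    ∀ a, a ≠ o → partialDeriv o r x ^ 2 * coordRicci G o a x
      = -((n : ℝ) - 2)
        * (partialDeriv o r x * partialDeriv a μ x - μ x * partialDeriv a (partialDeriv o r) x) := by
  have hU := h.metric.isOpen
  have hdr : ∀ i, ContDiffOn ℝ ∞ (partialDeriv i r) V :=
    fun i => (contDiffOn_partialDeriv hU hr i).mono hVU
  set s := partialDeriv o r x with hs
  set K : Fin n → Fin n → EuclideanSpace ℝ (Fin n) → ℝ :=
    fun i j y => coordHess G r i j y - μ y * G y i j with hK
  have hKs : ∀ i j, ContDiffOn ℝ ∞ (K i j) V := fun i j =>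
    ((h.metric.smooth_hess hr i j).mono hVU).sub (hμ.mul ((h.metric.smooth i j).mono hVU))
  -- `F a b` is `(Hess r - μ g)(X_a, X_b)` for the tangent fields `X_a = (∂_o r) ∂_a - (∂_a r) ∂_o`
  set F : Fin n → Fin n → EuclideanSpace ℝ (Fin n) → ℝ := fun a b y =>
    (partialDeriv o r y * partialDeriv o r y * K a b y
      - partialDeriv o r y * partialDeriv b r y * K a o y)
    - (partialDeriv a r y * partialDeriv o r y * K o b y
      - partialDeriv a r y * partialDeriv b r y * K o o y) with hF
  have hm : ∀ i j k l, ContDiffOn ℝ ∞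
      (fun y => partialDeriv i r y * partialDeriv j r y * K k l y) V :=
    fun i j k l => ((hdr i).mul (hdr j)).mul (hKs k l)
  have hFs : ∀ a b, ContDiffOn ℝ ∞ (F a b) V := fun a b =>
    ((hm _ _ _ _).sub (hm _ _ _ _)).sub ((hm _ _ _ _).sub (hm _ _ _ _))
  have hF0 : ∀ a b, ∀ y ∈ V, r y = 0 → F a b y = 0 := by
    intro a b y hy hry
    set X : Fin n → Fin n → ℝ := fun a =>
      Pi.single a (partialDeriv o r y) - Pi.single o (partialDeriv a r y) with hX
    have hXt : ∀ a, ∑ k, X a k * partialDeriv k r y = 0 := by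
      intro a
      simp only [hX, Pi.sub_apply, sub_mul, Finset.sum_sub_distrib]
      simp [Pi.single_apply, mul_comm]
    have hbil : ∀ T : Fin n → Fin n → ℝ, ∑ i, ∑ j, T i j * X a i * X b j
        = (partialDeriv o r y * partialDeriv o r y * T a b
            - partialDeriv o r y * partialDeriv b r y * T a o)
          - (partialDeriv a r y * partialDeriv o r y * T o b
            - partialDeriv a r y * partialDeriv b r y * T o o) := by
      intro T
      simp only [hX, Pi.sub_apply, mul_sub, sub_mul, Finset.sum_sub_distrib]
      simp [Pi.single_apply]
      ring
    have e := humb y hy hry (X a) (X b) (hXt a) (hXt b)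
    rw [coordInner, hbil (fun i j => coordHess G r i j y), hbil (fun i j => G y i j)] at e
    simp only [hF, hK]
    linear_combination -e
  have hKab : ∀ a b, a ≠ o → b ≠ o → K a b x = 0 := by
    intro a b ha hb
    have e := hF0 a b x hxV hrx
    simp only [hF, hra a ha, hra b hb, mul_zero, zero_mul, sub_zero] at e
    exact (mul_eq_zero.1 e).resolve_left (mul_ne_zero hro hro)
  have hHess : ∀ i j, coordHess G r i j x = partialDeriv i (partialDeriv j r) x := by
    intro i j
    simp [coordHess, h.christoffel_eq_zero]
  have hrab : ∀ a b, a ≠ o → b ≠ o →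
      partialDeriv a (partialDeriv b r) x = if a = b then μ x else 0 := by
    intro a b ha hb
    have e := hKab a b ha hb
    simp only [hK, hHess, h.eq_one, Matrix.one_apply] at e
    split_ifs at e ⊢ <;> linarith
  refine ⟨hrab, ?_⟩
  have hsym : ∀ i j, partialDeriv i (partialDeriv j r) x = partialDeriv j (partialDeriv i r) x :=
    fun i j => partialDeriv_comm hU hr h.mem i j
  have hKao : ∀ a, a ≠ o → K a o x = partialDeriv a (partialDeriv o r) x := by
    intro a ha
    simp [hK, hHess, h.eq_one, ha]
  have hKoa : ∀ a, a ≠ o → K o a x = partialDeriv a (partialDeriv o r) x := by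
    intro a ha
    simp only [hK, hHess, h.eq_one, Matrix.one_apply_ne ha.symm, mul_zero, sub_zero, hsym o a]
  -- the fields `X_a` are tangent, so `F a b` has no derivative in the directions `∂_c`, `c ≠ o`
  have hdF : ∀ a b c, a ≠ o → b ≠ o → c ≠ o → s ^ 2 * partialDeriv c (K a b) x
      = s * ((if b = c then μ x else 0) * partialDeriv a (partialDeriv o r) x
        + (if a = c then μ x else 0) * partialDeriv b (partialDeriv o r) x) := by
    intro a b c ha hb hc
    have e1 : partialDeriv c (F a b) x = 0 := by
      have := wedge_eq_zero_of_vanishing hV (hFs a b) (hr.mono hVU) hxV hrx (hF0 a b)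
        (EuclideanSpace.single c 1) (EuclideanSpace.single o 1)
      change partialDeriv c (F a b) x * partialDeriv o r x
        = partialDeriv o (F a b) x * partialDeriv c r x at this
      rw [hra c hc, mul_zero] at this
      exact (mul_eq_zero.1 this).resolve_right hro
    simp only [hF] at e1
    rw [partialDeriv_sub hV ((hm _ _ _ _).sub (hm _ _ _ _)) ((hm _ _ _ _).sub (hm _ _ _ _)) hxV,
      partialDeriv_sub hV (hm _ _ _ _) (hm _ _ _ _) hxV,
      partialDeriv_sub hV (hm _ _ _ _) (hm _ _ _ _) hxV,
      partialDeriv_mul₃ hV (hdr _) (hdr _) (hKs _ _) hxV,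
      partialDeriv_mul₃ hV (hdr _) (hdr _) (hKs _ _) hxV,
      partialDeriv_mul₃ hV (hdr _) (hdr _) (hKs _ _) hxV,
      partialDeriv_mul₃ hV (hdr _) (hdr _) (hKs _ _) hxV,
      hKab a b ha hb, hKao a ha, hKoa b hb, hra a ha, hra b hb, hsym c b, hsym c a,
      hrab b c hb hc, hrab a c ha hc, ← hs] at e1
    linear_combination e1
  have hdK : ∀ a b c, b ≠ o → partialDeriv c (K a b) x
      = partialDeriv c (partialDeriv a (partialDeriv b r)) x
        - s * partialDeriv c (christoffelFirst G a b o) x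
        - (if a = b then partialDeriv c μ x else 0) := by
    intro a b c hb
    have hc := h.metric.smooth_christoffel
    have hdrU := contDiffOn_partialDeriv hU hr
    have e1 : partialDeriv c (coordHess G r a b) x
        = partialDeriv c (partialDeriv a (partialDeriv b r)) x
          - s * partialDeriv c (christoffelFirst G a b o) x := by
      unfold coordHess
      rw [partialDeriv_sub hU (contDiffOn_partialDeriv hU (hdrU b) a)
        (ContDiffOn.sum fun k _ => (hc k a b).mul (hdrU k)) h.mem,
        partialDeriv_sum _ hU (fun k => (hc k a b).mul (hdrU k)) h.mem, Finset.sum_eq_single o]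
      · rw [partialDeriv_mul hU (hc _ _ _) (hdrU _) h.mem, h.christoffel_eq_zero,
          (h.deriv_christoffel _ _ _).1]
        ring
      · intro k _ hk
        rw [partialDeriv_mul hU (hc _ _ _) (hdrU _) h.mem, h.christoffel_eq_zero, hra k hk]
        ring
      · simp
    simp only [hK]
    rw [partialDeriv_sub hV ((h.metric.smooth_hess hr a b).mono hVU)
      (hμ.mul ((h.metric.smooth a b).mono hVU)) hxV, e1,
      partialDeriv_mul hV hμ ((h.metric.smooth a b).mono hVU) hxV, h.deriv_eq_zero, h.eq_one,
      Matrix.one_apply]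
    split_ifs <;> ring
  intro a ha
  set θ : Fin n → ℝ := fun c =>
    s * partialDeriv c μ x - μ x * partialDeriv c (partialDeriv o r) x with hθ
  change _ = -((n : ℝ) - 2) * θ a
  -- the Codazzi equation: exchanging the derivative index with the first index and subtracting
  -- removes the third derivatives of `r`
  have hpair : ∀ b, b ≠ o → s ^ 2 * (partialDeriv a (christoffelFirst G b b o) x
      - partialDeriv b (christoffelFirst G a b o) x) = (if a = b then θ a else 0) - θ a := by
    intro b hb
    have e1 := hdF a b b ha hb hb
    have e2 := hdF b b a hb hb ha
    rw [hdK _ _ _ hb] at e1 e2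
    have e3 : partialDeriv b (partialDeriv a (partialDeriv b r)) x
        = partialDeriv a (partialDeriv b (partialDeriv b r)) x :=
      partialDeriv_comm hU (contDiffOn_partialDeriv hU hr b) h.mem b a
    rw [e3] at e1
    apply mul_left_cancel₀ hro
    simp only [hθ]
    by_cases hab : a = b
    · subst hab
      simp only [if_true] at *
      ring
    · have hba : ¬ b = a := fun hba => hab hba.symm
      simp only [hab, hba, if_false, if_true] at *
      linear_combination e1 - e2
  have hopair : partialDeriv a (christoffelFirst G o o o) x
      - partialDeriv o (christoffelFirst G a o o) x = 0 := by
    rw [h.metric.deriv_christoffelFirst h.mem, h.metric.deriv_christoffelFirst h.mem,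
      partialDeriv_comm hU (h.metric.smooth o o) h.mem a o]
    ring
  have hric : coordRicci G o a x = ∑ b, (partialDeriv a (christoffelFirst G b b o) x
      - partialDeriv b (christoffelFirst G a b o) x) := by
    rw [h.ricci_eq]
    refine Finset.sum_congr rfl fun b _ => ?_
    simp only [h.metric.deriv_christoffelFirst h.mem]
    rw [h.metric.deriv_deriv_symm h.mem b o a b, h.metric.deriv_deriv_symm h.mem b a o b,
      h.metric.deriv_deriv_symm h.mem b b o a, h.metric.deriv_deriv_symm h.mem a b o b,
      partialDeriv_comm hU (h.metric.smooth b o) h.mem a b]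
    ring
  rw [hric, Finset.mul_sum, ← Finset.add_sum_erase _ _ (Finset.mem_univ o), hopair, mul_zero,
    zero_add, Finset.sum_congr rfl fun b hb => hpair b (Finset.ne_of_mem_erase hb),
    Finset.sum_sub_distrib, Finset.sum_ite_eq, if_pos (Finset.mem_erase.2 ⟨ha, Finset.mem_univ a⟩),
    Finset.sum_const, Finset.card_erase_of_mem (Finset.mem_univ o), Finset.card_univ,
    Fintype.card_fin, nsmul_eq_mul, Nat.cast_pred (Nat.pos_of_ne_zero fun hn => by
      subst hn; exact o.elim0)]
  ring

/-- On the boundary of a static domain the function `u_ν / u` has no tangential derivative (stated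
in normal coordinates at `x` in which `dr` is a multiple of `dx_o`). The boundary condition gives
`s² Hess u(∂_o, ∂_a) = u θ_a`, the static equation turns the left side into `s² u Ric(∂_o, ∂_a)`, and
the Codazzi equation evaluates this as `-(n - 2) u θ_a`; hence `(n - 1) u θ_a = 0`. -/
lemma wedge_normalDeriv_div_eq_zero (hn : 2 ≤ n) (h : IsNormalAt G U x)
    (hr : ContDiffOn ℝ ∞ r U) (hf : ContDiffOn ℝ ∞ f U) (hV : IsOpen V) (hVU : V ⊆ U) (hxV : x ∈ V)
    (hrx : r x = 0) (hreg : ∀ y ∈ V, ∃ k, partialDeriv k r y ≠ 0) (hf0 : ∀ y ∈ V, f y ≠ 0)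
    {o : Fin n} (hro : 0 < partialDeriv o r x) (hra : ∀ a, a ≠ o → partialDeriv a r x = 0)
    (hstat : ∀ i j, -coordLaplacian G f x * G x i j + coordHess G f i j x
      - f x * coordRicci G i j x = 0)
    (hbd : ∀ y ∈ V, r y = 0 → ∀ X Y : Fin n → ℝ, ∑ k, X k * partialDeriv k r y = 0 →
      ∑ k, Y k * partialDeriv k r y = 0 →
      coordNormalDeriv G r f y * coordInner G y X Y = f y * coordSecondFF G r X Y y) (i j : Fin n) :
    partialDeriv i (fun y => coordNormalDeriv G r f y / f y) x * partialDeriv j r x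
      = partialDeriv j (fun y => coordNormalDeriv G r f y / f y) x * partialDeriv i r x := by
  have hU := h.metric.isOpen
  have hGV : IsMetricOn G V := ⟨hV, fun i j => (h.metric.smooth i j).mono hVU,
    fun y hy => h.metric.posDef y (hVU hy)⟩
  have hrV := hr.mono hVU
  have hfV := hf.mono hVU
  have hdrU := contDiffOn_partialDeriv hU hr
  have hdfU := contDiffOn_partialDeriv hU hf
  -- `u_ν / u = μ / |∇r|` with `μ = ⟨∇r, ∇u⟩ / u`, and `Hess r = μ g` along the level set
  set q := coordPairing G r f with hq
  set w : EuclideanSpace ℝ (Fin n) → ℝ := fun y => Real.sqrt (coordPairing G r r y) with hw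
  have hwpos : ∀ y ∈ V, 0 < w y := fun y hy =>
    Real.sqrt_pos.2 (hGV.pairing_self_pos hy (hreg y hy))
  have hws : ContDiffOn ℝ ∞ w V := smooth_sqrt_pairing hGV hrV hreg
  have hqs : ContDiffOn ℝ ∞ q V := hGV.smooth_pairing hrV hfV
  set μ : EuclideanSpace ℝ (Fin n) → ℝ := fun y => q y / f y with hμ
  have hμs : ContDiffOn ℝ ∞ μ V := hqs.div hfV hf0
  set l : EuclideanSpace ℝ (Fin n) → ℝ := fun y => coordNormalDeriv G r f y / f y with hl
  have hleq : Set.EqOn l (fun y => μ y / w y) V := fun y hy => by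
    simp only [hl, hμ, hw, hq, coordNormalDeriv_eq hGV hy]
    rw [div_right_comm]
  have hls : ContDiffOn ℝ ∞ l V := (hμs.div hws fun y hy => (hwpos y hy).ne').congr hleq
  have humb : ∀ y ∈ V, r y = 0 → ∀ X Y : Fin n → ℝ, ∑ k, X k * partialDeriv k r y = 0 →
      ∑ k, Y k * partialDeriv k r y = 0 →
      μ y * coordInner G y X Y = ∑ i, ∑ j, coordHess G r i j y * X i * Y j := by
    intro y hy hry X Y hX hY
    have e := hbd y hy hry X Y hX hY
    rw [coordSecondFF_of_tangent hGV hrV hreg hy X hY, coordNormalDeriv_eq hGV hy] at e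
    have h1 := (hwpos y hy).ne'
    have h2 := hf0 y hy
    simp only [hw] at h1
    simp only [hμ, hq]
    field_simp at e ⊢
    exact e
  obtain ⟨hrab, hric⟩ := codazzi_umbilic h hr hV hVU hxV hrx hro.ne' hra hμs humb
  set s := partialDeriv o r x with hs
  have hsym : ∀ i j, partialDeriv i (partialDeriv j r) x = partialDeriv j (partialDeriv i r) x :=
    fun i j => partialDeriv_comm hU hr h.mem i j
  -- the first derivatives of the pairings at the centre
  have hdpair : ∀ {b : EuclideanSpace ℝ (Fin n) → ℝ}, ContDiffOn ℝ ∞ b U → ∀ a,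
      partialDeriv a (coordPairing G r b) x
        = ∑ i, partialDeriv a (partialDeriv i r) x * partialDeriv i b x
          + s * partialDeriv a (partialDeriv o b) x := by
    intro b hb a
    have hdb := contDiffOn_partialDeriv hU hb
    have e1 : partialDeriv a (coordPairing G r b) x
        = ∑ i, partialDeriv a (fun y => partialDeriv i r y * partialDeriv i b y) x :=
      h.deriv_trace (T := fun i j y => partialDeriv i r y * partialDeriv j b y)
        (fun i j => (hdrU i).mul (hdb j)) a
    simp only [e1, partialDeriv_mul hU (hdrU _) (hdb _) h.mem, Finset.sum_add_distrib]
    congr 1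
    rw [Finset.sum_eq_single o]
    · intro k _ hk
      rw [hra k hk, zero_mul]
    · simp
  have hpair : ∀ b : EuclideanSpace ℝ (Fin n) → ℝ,
      coordPairing G r b x = s * partialDeriv o b x := by
    intro b
    have e1 : coordPairing G r b x = ∑ i, partialDeriv i r x * partialDeriv i b x :=
      h.trace_eq (fun i j => partialDeriv i r x * partialDeriv j b x)
    rw [e1, Finset.sum_eq_single o]
    · intro k _ hk
      rw [hra k hk, zero_mul]
    · simp
  have hwx : w x = s := by
    simp only [hw]
    rw [hpair, ← hs, Real.sqrt_mul_self hro.le]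
  have hfx := hf0 x hxV
  have hqμ : s * partialDeriv o f x = μ x * f x := by
    simp only [hμ, hq]
    rw [hpair, div_mul_cancel₀ _ hfx]
  have key : ∀ a, a ≠ o → partialDeriv a l x = 0 := by
    intro a ha
    have hsum : ∀ b : EuclideanSpace ℝ (Fin n) → ℝ,
        ∑ i, partialDeriv a (partialDeriv i r) x * partialDeriv i b x
          = partialDeriv a (partialDeriv o r) x * partialDeriv o b x
            + μ x * partialDeriv a b x := by
      intro b
      rw [← Finset.add_sum_erase _ _ (Finset.mem_univ o)]
      congr 1
      rw [Finset.sum_congr rfl fun i hi => by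
        rw [hrab a i ha (Finset.ne_of_mem_erase hi)]]
      simp [ha]
    have e1 : partialDeriv a q x = partialDeriv a μ x * f x + μ x * partialDeriv a f x := by
      rw [← partialDeriv_mul hV hμs hfV hxV]
      exact partialDeriv_congr hV (fun y hy => (div_mul_cancel₀ _ (hf0 y hy)).symm) a hxV
    rw [hq, hdpair hf, hsum] at e1
    have e2 : partialDeriv a (partialDeriv o f) x = f x * coordRicci G o a x := by
      have := hstat o a
      rw [h.eq_one, Matrix.one_apply_ne ha.symm, coordHess] at this
      simp only [h.christoffel_eq_zero] at this
      rw [partialDeriv_comm hU hf h.mem]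
      simp only [zero_mul, Finset.sum_const_zero, mul_zero] at this
      linarith
    have e3 := hric a ha
    set θ := s * partialDeriv a μ x - μ x * partialDeriv a (partialDeriv o r) x with hθ
    have e4 : ((n : ℝ) - 1) * (f x * θ) = 0 := by
      rw [hθ] at e3 ⊢
      linear_combination f x * e3 + partialDeriv a (partialDeriv o r) x * hqμ + s ^ 2 * e2
        - s * e1
    have hn1 : (n : ℝ) - 1 ≠ 0 := by
      have : (2 : ℝ) ≤ n := by exact_mod_cast hn
      linarith
    have e5 : θ = 0 := by
      rcases mul_eq_zero.1 e4 with h | h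
      · exact absurd h hn1
      · exact (mul_eq_zero.1 h).resolve_left hfx
    have e6 : partialDeriv a w x = partialDeriv a (partialDeriv o r) x := by
      have h1 : Set.EqOn (fun y => w y * w y) (coordPairing G r r) V := fun y hy =>
        Real.mul_self_sqrt (hGV.pairing_self_pos hy (hreg y hy)).le
      have h2 := partialDeriv_congr hV h1 a hxV
      rw [partialDeriv_mul hV hws hws hxV, hdpair hr, hsum, hra a ha, hwx] at h2
      apply mul_left_cancel₀ hro.ne'
      linarith
    have e7 : partialDeriv a μ x = partialDeriv a l x * s
        + l x * partialDeriv a (partialDeriv o r) x := by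
      rw [← e6, ← hwx, ← partialDeriv_mul hV hls hws hxV]
      refine partialDeriv_congr hV (fun y hy => ?_) a hxV
      rw [hleq hy, div_mul_cancel₀ _ (hwpos y hy).ne']
    have e8 : μ x = l x * s := by
      rw [hleq hxV, ← hwx]
      simp only
      rw [hwx, div_mul_cancel₀ _ hro.ne']
    have e9 : s ^ 2 * partialDeriv a l x = 0 := by
      rw [hθ, e7, e8] at e5
      linear_combination e5
    exact (mul_eq_zero.1 e9).resolve_left (pow_ne_zero 2 hro.ne')
  by_cases hi : i = o <;> by_cases hj : j = o
  · rw [hi, hj]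
  · rw [hra j hj, key j hj]; ring
  · rw [hra i hi, key i hi]; ring
  · rw [hra i hi, hra j hj]; ring

end Codazzi

/-! ### Change of coordinates -/

section Transition

variable {n : ℕ} {G G' : EuclideanSpace ℝ (Fin n) → Matrix (Fin n) (Fin n) ℝ}
  {τ : EuclideanSpace ℝ (Fin n) → EuclideanSpace ℝ (Fin n)}
  {U W : Set (EuclideanSpace ℝ (Fin n))} {y : EuclideanSpace ℝ (Fin n)}
  {f : EuclideanSpace ℝ (Fin n) → ℝ}

/-- The Jacobian matrix `t_ia = ∂_a τ^i`. -/
def jacobian (τ : EuclideanSpace ℝ (Fin n) → EuclideanSpace ℝ (Fin n))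
    (y : EuclideanSpace ℝ (Fin n)) : Matrix (Fin n) (Fin n) ℝ :=
  Matrix.of fun i a => partialDeriv a (fun z => τ z i) y

/-- `τ : W → U` is a smooth change of coordinates that pulls the metric `G` on `U` back to the
metric `G'` on `W`. -/
structure IsTransition (G G' : EuclideanSpace ℝ (Fin n) → Matrix (Fin n) (Fin n) ℝ)
    (τ : EuclideanSpace ℝ (Fin n) → EuclideanSpace ℝ (Fin n))
    (W U : Set (EuclideanSpace ℝ (Fin n))) : Prop where
  metric : IsMetricOn G U
  metric' : IsMetricOn G' W
  mapsTo : Set.MapsTo τ W U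
  smooth : ContDiffOn ℝ ∞ τ W
  pullback : ∀ y ∈ W, ∀ a b, G' y a b
    = ∑ i, ∑ j, jacobian τ y i a * jacobian τ y j b * G (τ y) i j

lemma smooth_comp_apply (hτ : ContDiffOn ℝ ∞ τ W) (i : Fin n) :
    ContDiffOn ℝ ∞ (fun z => τ z i) W := by
  have h : ContDiff ℝ ∞ (fun z : EuclideanSpace ℝ (Fin n) => z i) :=
    (EuclideanSpace.proj (𝕜 := ℝ) i).contDiff
  exact h.comp_contDiffOn hτ

lemma smooth_jacobian (hW : IsOpen W) (hτ : ContDiffOn ℝ ∞ τ W) (i a : Fin n) :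
    ContDiffOn ℝ ∞ (fun z => jacobian τ z i a) W :=
  contDiffOn_partialDeriv hW (smooth_comp_apply hτ i) a

lemma partialDeriv_comp (hU : IsOpen U) (hW : IsOpen W) (hτ : ContDiffOn ℝ ∞ τ W)
    (hm : Set.MapsTo τ W U) (hf : ContDiffOn ℝ ∞ f U) (hy : y ∈ W) (a : Fin n) :
    partialDeriv a (fun z => f (τ z)) y = ∑ i, jacobian τ y i a * partialDeriv i f (τ y) := by
  have h1 : DifferentiableAt ℝ τ y :=
    ((hτ y hy).contDiffAt (hW.mem_nhds hy)).differentiableAt (by simp)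
  have h2 := contDiffOn_diff hU hf (hm hy)
  have h3 : fderiv ℝ (fun z => f (τ z)) y = (fderiv ℝ f (τ y)).comp (fderiv ℝ τ y) :=
    fderiv_comp y h2 h1
  rw [partialDeriv, h3, ContinuousLinearMap.comp_apply, fderiv_apply_eq_sum]
  refine Finset.sum_congr rfl fun i _ => ?_
  congr 1
  simp only [jacobian, Matrix.of_apply, partialDeriv]
  have h4 : HasFDerivAt (fun z => τ z i)
      ((EuclideanSpace.proj (𝕜 := ℝ) i).comp (fderiv ℝ τ y)) y :=
    (EuclideanSpace.proj (𝕜 := ℝ) i).hasFDerivAt.comp y h1.hasFDerivAt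
  rw [h4.fderiv]
  rfl

namespace IsTransition

lemma pullback_matrix (h : IsTransition G G' τ W U) (hy : y ∈ W) :
    G' y = (jacobian τ y).transpose * G (τ y) * jacobian τ y := by
  ext a b
  rw [h.pullback y hy, Matrix.mul_apply]
  simp only [Matrix.mul_apply, Matrix.transpose_apply, Finset.sum_mul]
  rw [Finset.sum_comm]
  exact Finset.sum_congr rfl fun j _ => Finset.sum_congr rfl fun i _ => by ring

lemma inv_pushforward (h : IsTransition G G' τ W U) (hy : y ∈ W) :
    jacobian τ y * (G' y)⁻¹ * (jacobian τ y).transpose = (G (τ y))⁻¹ := by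
  have hd := h.metric'.isUnit_det hy
  have ht : IsUnit (jacobian τ y).det := by
    rw [h.pullback_matrix hy, Matrix.det_mul, Matrix.det_mul, Matrix.det_transpose] at hd
    exact (IsUnit.mul_iff.1 hd).2
  have htt : IsUnit (jacobian τ y).transpose.det := by rwa [Matrix.det_transpose]
  rw [h.pullback_matrix hy, Matrix.mul_inv_rev, Matrix.mul_inv_rev, ← mul_assoc,
    Matrix.mul_nonsing_inv _ ht, one_mul, mul_assoc, Matrix.nonsing_inv_mul _ htt, mul_one]

lemma inv_pushforward_apply (h : IsTransition G G' τ W U) (hy : y ∈ W) (i j : Fin n) :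
    ∑ a, ∑ b, jacobian τ y i a * (G' y)⁻¹ a b * jacobian τ y j b = (G (τ y))⁻¹ i j := by
  rw [← h.inv_pushforward hy, Matrix.mul_apply]
  simp only [Matrix.mul_apply, Matrix.transpose_apply, Finset.sum_mul]
  exact Finset.sum_comm

/-- The metric trace of a bilinear form does not depend on the coordinates. -/
lemma trace_pullback (h : IsTransition G G' τ W U) (hy : y ∈ W) (S : Fin n → Fin n → ℝ) :
    ∑ a, ∑ b, (G' y)⁻¹ a b * ∑ i, ∑ j, jacobian τ y i a * jacobian τ y j b * S i j
      = ∑ i, ∑ j, (G (τ y))⁻¹ i j * S i j := by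
  simp only [← h.inv_pushforward_apply hy, Finset.sum_mul, Finset.mul_sum]
  calc _ = ∑ a, ∑ i, ∑ b, ∑ j, (G' y)⁻¹ a b * (jacobian τ y i a * jacobian τ y j b * S i j) :=
        Finset.sum_congr rfl fun a _ => Finset.sum_comm
    _ = ∑ i, ∑ a, ∑ b, ∑ j, (G' y)⁻¹ a b * (jacobian τ y i a * jacobian τ y j b * S i j) :=
        Finset.sum_comm
    _ = ∑ i, ∑ a, ∑ j, ∑ b, (G' y)⁻¹ a b * (jacobian τ y i a * jacobian τ y j b * S i j) :=
        Finset.sum_congr rfl fun i _ => Finset.sum_congr rfl fun a _ => Finset.sum_comm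
    _ = ∑ i, ∑ j, ∑ a, ∑ b, (G' y)⁻¹ a b * (jacobian τ y i a * jacobian τ y j b * S i j) :=
        Finset.sum_congr rfl fun i _ => Finset.sum_comm
    _ = _ := Finset.sum_congr rfl fun i _ => Finset.sum_congr rfl fun j _ =>
        Finset.sum_congr rfl fun a _ => Finset.sum_congr rfl fun b _ => by ring

lemma pairing_comp (h : IsTransition G G' τ W U) (hy : y ∈ W)
    {p q : EuclideanSpace ℝ (Fin n) → ℝ} (hp : ContDiffOn ℝ ∞ p U) (hq : ContDiffOn ℝ ∞ q U) :
    coordPairing G' (fun z => p (τ z)) (fun z => q (τ z)) y = coordPairing G p q (τ y) := by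
  have hU := h.metric.isOpen
  have hW := h.metric'.isOpen
  unfold coordPairing
  rw [← h.trace_pullback hy]
  refine Finset.sum_congr rfl fun a _ => Finset.sum_congr rfl fun b _ => ?_
  rw [partialDeriv_comp hU hW h.smooth h.mapsTo hp hy,
    partialDeriv_comp hU hW h.smooth h.mapsTo hq hy, Finset.sum_mul_sum]
  congr 1
  exact Finset.sum_congr rfl fun i _ => Finset.sum_congr rfl fun j _ => by ring

/-- The transformation law of the Christoffel symbols of the first kind. -/
lemma christoffelFirst_eq (h : IsTransition G G' τ W U) (hy : y ∈ W) (a b c : Fin n) :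
    christoffelFirst G' a b c y
      = ∑ j, jacobian τ y j c * (∑ i, partialDeriv a (fun z => jacobian τ z i b) y * G (τ y) i j
        + ∑ i, ∑ l, jacobian τ y i a * jacobian τ y l b * christoffelFirst G i l j (τ y)) := by
  have hU := h.metric.isOpen
  have hW := h.metric'.isOpen
  set t := fun i a => jacobian τ y i a with ht
  -- `∂_c G'_ab = P c a b + P c b a + Q a b c`, where `P` collects the second derivatives of `τ`
  -- and `Q` the derivatives of `G`
  set P : Fin n → Fin n → Fin n → ℝ := fun a b c =>
    ∑ i, ∑ j, partialDeriv a (fun z => jacobian τ z i b) y * t j c * G (τ y) i j with hP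
  set Q : Fin n → Fin n → Fin n → ℝ := fun a b c =>
    ∑ i, ∑ j, ∑ k, t i a * t j b * t k c * partialDeriv k (fun z => G z i j) (τ y) with hQ
  have hjs := smooth_jacobian hW h.smooth
  have hGs : ∀ i j, ContDiffOn ℝ ∞ (fun z => G (τ z) i j) W := fun i j =>
    (h.metric.smooth i j).comp h.smooth h.mapsTo
  have hPs : ∀ a b c, P a b c = P b a c := by
    intro a b c
    refine Finset.sum_congr rfl fun i _ => Finset.sum_congr rfl fun j _ => ?_
    have : partialDeriv a (fun z => jacobian τ z i b) y
        = partialDeriv b (fun z => jacobian τ z i a) y :=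
      partialDeriv_comm hW (smooth_comp_apply h.smooth i) hy a b
    rw [this]
  have hD : ∀ a b c, partialDeriv c (fun z => G' z a b) y = P c a b + P c b a + Q a b c := by
    intro a b c
    have e1 : Set.EqOn (fun z => G' z a b)
        (fun z => ∑ i, ∑ j, jacobian τ z i a * jacobian τ z j b * G (τ z) i j) W :=
      fun z hz => h.pullback z hz a b
    have hs : ∀ i j, ContDiffOn ℝ ∞
        (fun z => jacobian τ z i a * jacobian τ z j b * G (τ z) i j) W := fun i j =>
      ((hjs i a).mul (hjs j b)).mul (hGs i j)
    have e3 : P c b a = ∑ i, ∑ j, t i a * partialDeriv c (fun z => jacobian τ z j b) y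
        * G (τ y) i j := by
      simp only [hP]
      rw [Finset.sum_comm]
      refine Finset.sum_congr rfl fun i _ => Finset.sum_congr rfl fun j _ => ?_
      rw [h.metric.symm (h.mapsTo hy) j i]; ring
    rw [partialDeriv_congr hW e1 c hy, partialDeriv_sum _ hW
      (fun i => ContDiffOn.sum fun j _ => hs i j) hy, e3]
    simp only [hP, hQ]
    rw [← Finset.sum_add_distrib, ← Finset.sum_add_distrib]
    refine Finset.sum_congr rfl fun i _ => ?_
    rw [partialDeriv_sum _ hW (hs i) hy, ← Finset.sum_add_distrib, ← Finset.sum_add_distrib]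
    refine Finset.sum_congr rfl fun j _ => ?_
    rw [partialDeriv_mul₃ hW (hjs _ _) (hjs _ _) (hGs _ _) hy,
      partialDeriv_comp hU hW h.smooth h.mapsTo (h.metric.smooth i j) hy, Finset.mul_sum]
    congr 1
    exact Finset.sum_congr rfl fun k _ => by ring
  have hC : christoffelFirst G' a b c y
      = P a b c + (1 / 2) * (Q b c a + Q a c b - Q a b c) := by
    rw [christoffelFirst, hD, hD, hD, hPs b a c, hPs c a b, hPs c b a]
    ring
  have hQ1 : Q b c a = ∑ j, ∑ i, ∑ l, t i a * t l b * t j c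
      * partialDeriv i (fun z => G z l j) (τ y) := by
    simp only [hQ]
    rw [Finset.sum_comm]
    refine Finset.sum_congr rfl fun j _ => ?_
    rw [Finset.sum_comm]
    exact Finset.sum_congr rfl fun i _ => Finset.sum_congr rfl fun l _ => by ring
  have hQ2 : Q a c b = ∑ j, ∑ i, ∑ l, t i a * t l b * t j c
      * partialDeriv l (fun z => G z i j) (τ y) := by
    simp only [hQ]
    rw [Finset.sum_comm]
    exact Finset.sum_congr rfl fun j _ => Finset.sum_congr rfl fun i _ =>
      Finset.sum_congr rfl fun l _ => by ring
  have hQ3 : Q a b c = ∑ j, ∑ i, ∑ l, t i a * t l b * t j c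
      * partialDeriv j (fun z => G z i l) (τ y) := by
    simp only [hQ]
    rw [Finset.sum_comm' (t' := Finset.univ) (s' := fun _ => Finset.univ) (by simp)]
    rw [Finset.sum_comm, Finset.sum_congr rfl fun i _ => Finset.sum_comm]
    rw [Finset.sum_comm]
  have hP1 : P a b c = ∑ j, t j c
      * ∑ i, partialDeriv a (fun z => jacobian τ z i b) y * G (τ y) i j := by
    simp only [hP, Finset.mul_sum]
    rw [Finset.sum_comm]
    exact Finset.sum_congr rfl fun j _ => Finset.sum_congr rfl fun i _ => by ring
  rw [hC, hQ1, hQ2, hQ3, hP1, ← Finset.sum_add_distrib, ← Finset.sum_sub_distrib,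
    Finset.mul_sum, ← Finset.sum_add_distrib]
  refine Finset.sum_congr rfl fun j _ => ?_
  rw [mul_add]
  congr 1
  rw [← Finset.sum_add_distrib, ← Finset.sum_sub_distrib, Finset.mul_sum, Finset.mul_sum]
  refine Finset.sum_congr rfl fun i _ => ?_
  rw [← Finset.sum_add_distrib, ← Finset.sum_sub_distrib, Finset.mul_sum, Finset.mul_sum]
  refine Finset.sum_congr rfl fun l _ => ?_
  simp only [christoffelFirst, ht]
  ring

/-- The transformation law of the Christoffel symbols. -/
lemma christoffel_eq (h : IsTransition G G' τ W U) (hy : y ∈ W) (a b k : Fin n) :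
    ∑ c, jacobian τ y k c * christoffel G' c a b y
      = partialDeriv a (fun z => jacobian τ z k b) y
        + ∑ i, ∑ l, jacobian τ y i a * jacobian τ y l b * christoffel G k i l (τ y) := by
  set Z : Fin n → ℝ := fun j =>
    ∑ i, partialDeriv a (fun z => jacobian τ z i b) y * G (τ y) i j
        + ∑ i, ∑ l, jacobian τ y i a * jacobian τ y l b * christoffelFirst G i l j (τ y) with hZ
  have e1 : ∑ c, jacobian τ y k c * christoffel G' c a b y = ∑ j, (G (τ y))⁻¹ k j * Z j := by
    simp only [christoffel_eq_sum, h.christoffelFirst_eq hy, ← h.inv_pushforward_apply hy,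
      Finset.sum_mul, Finset.mul_sum]
    rw [Finset.sum_comm' (t' := Finset.univ) (s' := fun _ => Finset.univ) (by simp)]
    symm
    calc _ = ∑ c, ∑ j, ∑ d, jacobian τ y k c * (G' y)⁻¹ c d * jacobian τ y j d * Z j :=
          Finset.sum_comm
      _ = ∑ c, ∑ d, ∑ j, jacobian τ y k c * (G' y)⁻¹ c d * jacobian τ y j d * Z j :=
          Finset.sum_congr rfl fun c _ => Finset.sum_comm
      _ = ∑ d, ∑ c, ∑ j, jacobian τ y k c * (G' y)⁻¹ c d * jacobian τ y j d * Z j :=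
          Finset.sum_comm
      _ = _ := Finset.sum_congr rfl fun d _ => Finset.sum_congr rfl fun c _ =>
          Finset.sum_congr rfl fun j _ => by ring
  rw [e1]
  simp only [hZ, mul_add, Finset.sum_add_distrib]
  congr 1
  · calc _ = ∑ j, ∑ i, partialDeriv a (fun z => jacobian τ z i b) y
          * (G (τ y) i j * (G (τ y))⁻¹ j k) := by
          refine Finset.sum_congr rfl fun j _ => ?_
          rw [Finset.mul_sum]
          refine Finset.sum_congr rfl fun i _ => ?_
          rw [h.metric.inv_symm (h.mapsTo hy) k j]; ring
      _ = _ := by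
          rw [Finset.sum_comm]
          simp only [← Finset.mul_sum, h.metric.sum_mul_inv (h.mapsTo hy)]
          simp
  · simp only [christoffel_eq_sum, Finset.mul_sum]
    rw [Finset.sum_comm]
    refine Finset.sum_congr rfl fun i _ => ?_
    rw [Finset.sum_comm]
    exact Finset.sum_congr rfl fun l _ => Finset.sum_congr rfl fun j _ => by ring

/-- The Hessian is a tensor. -/
lemma hess_comp (h : IsTransition G G' τ W U) (hy : y ∈ W) (hf : ContDiffOn ℝ ∞ f U)
    (a b : Fin n) :
    coordHess G' (fun z => f (τ z)) a b y
      = ∑ i, ∑ j, jacobian τ y i a * jacobian τ y j b * coordHess G f i j (τ y) := by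
  have hU := h.metric.isOpen
  have hW := h.metric'.isOpen
  have hdf := contDiffOn_partialDeriv hU hf
  have hjs := smooth_jacobian hW h.smooth
  have hcs : ∀ i, ContDiffOn ℝ ∞ (fun z => partialDeriv i f (τ z)) W := fun i =>
    (hdf i).comp h.smooth h.mapsTo
  have e1 : partialDeriv a (partialDeriv b (fun z => f (τ z))) y
      = ∑ k, partialDeriv a (fun z => jacobian τ z k b) y * partialDeriv k f (τ y)
        + ∑ i, ∑ j, jacobian τ y i a * jacobian τ y j b
          * partialDeriv i (partialDeriv j f) (τ y) := by
    have e2 : Set.EqOn (partialDeriv b (fun z => f (τ z)))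
        (fun z => ∑ k, jacobian τ z k b * partialDeriv k f (τ z)) W :=
      fun z hz => partialDeriv_comp hU hW h.smooth h.mapsTo hf hz b
    rw [partialDeriv_congr hW e2 a hy, partialDeriv_sum _ hW (fun k => (hjs k b).mul (hcs k)) hy]
    simp only [partialDeriv_mul hW (hjs _ _) (hcs _) hy, Finset.sum_add_distrib,
      partialDeriv_comp hU hW h.smooth h.mapsTo (hdf _) hy]
    congr 1
    rw [Finset.sum_comm]
    simp only [Finset.mul_sum]
    rw [Finset.sum_comm]
    rw [Finset.sum_comm]
    exact Finset.sum_congr rfl fun i _ => Finset.sum_congr rfl fun j _ => by ring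
  have e3 : ∑ c, christoffel G' c a b y * partialDeriv c (fun z => f (τ z)) y
      = ∑ k, partialDeriv a (fun z => jacobian τ z k b) y * partialDeriv k f (τ y)
        + ∑ i, ∑ j, jacobian τ y i a * jacobian τ y j b
          * ∑ k, christoffel G k i j (τ y) * partialDeriv k f (τ y) := by
    have e4 : ∑ c, christoffel G' c a b y * partialDeriv c (fun z => f (τ z)) y
        = ∑ k, (∑ c, jacobian τ y k c * christoffel G' c a b y) * partialDeriv k f (τ y) := by
      simp only [partialDeriv_comp hU hW h.smooth h.mapsTo hf hy, Finset.mul_sum, Finset.sum_mul]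
      rw [Finset.sum_comm]
      exact Finset.sum_congr rfl fun i _ => Finset.sum_congr rfl fun j _ => by ring
    rw [e4]
    simp only [h.christoffel_eq hy, add_mul, Finset.sum_add_distrib]
    congr 1
    simp only [Finset.mul_sum, Finset.sum_mul]
    rw [Finset.sum_comm]
    refine Finset.sum_congr rfl fun i _ => ?_
    rw [Finset.sum_comm]
    exact Finset.sum_congr rfl fun j _ => Finset.sum_congr rfl fun k _ => by ring
  rw [coordHess, e1, e3, add_sub_add_left_eq_sub, ← Finset.sum_sub_distrib]
  refine Finset.sum_congr rfl fun i _ => ?_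
  rw [← Finset.sum_sub_distrib]
  refine Finset.sum_congr rfl fun j _ => ?_
  rw [coordHess]; ring

lemma laplacian_comp (h : IsTransition G G' τ W U) (hy : y ∈ W) (hf : ContDiffOn ℝ ∞ f U) :
    coordLaplacian G' (fun z => f (τ z)) y = coordLaplacian G f (τ y) := by
  unfold coordLaplacian
  rw [← h.trace_pullback hy]
  simp only [h.hess_comp hy hf]

lemma normalDeriv_comp (h : IsTransition G G' τ W U) (hy : y ∈ W)
    {r : EuclideanSpace ℝ (Fin n) → ℝ} (hr : ContDiffOn ℝ ∞ r U) (hf : ContDiffOn ℝ ∞ f U) :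
    coordNormalDeriv G' (fun z => r (τ z)) (fun z => f (τ z)) y
      = coordNormalDeriv G r f (τ y) := by
  rw [coordNormalDeriv_eq h.metric' hy, coordNormalDeriv_eq h.metric (h.mapsTo hy),
    h.pairing_comp hy hr hf, h.pairing_comp hy hr hr]

end IsTransition

end Transition

/-! ### Normal coordinates -/

section NormalCoordinates

variable {n : ℕ} {G : EuclideanSpace ℝ (Fin n) → Matrix (Fin n) (Fin n) ℝ}
  {τ : EuclideanSpace ℝ (Fin n) → EuclideanSpace ℝ (Fin n)}
  {U S : Set (EuclideanSpace ℝ (Fin n))}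

lemma fderiv_apply_eq_jacobian {y : EuclideanSpace ℝ (Fin n)} (hτ : DifferentiableAt ℝ τ y)
    (v : EuclideanSpace ℝ (Fin n)) (i : Fin n) :
    fderiv ℝ τ y v i = ((jacobian τ y).mulVec v) i := by
  have h4 : HasFDerivAt (fun z => τ z i)
      ((EuclideanSpace.proj (𝕜 := ℝ) i).comp (fderiv ℝ τ y)) y :=
    (EuclideanSpace.proj (𝕜 := ℝ) i).hasFDerivAt.comp y hτ.hasFDerivAt
  have h5 := fderiv_apply_eq_sum (fun z => τ z i) y v
  rw [h4.fderiv] at h5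
  refine h5.trans ?_
  exact Finset.sum_congr rfl fun a _ => mul_comm _ _

lemma exists_hasFDerivAt_equiv {y : EuclideanSpace ℝ (Fin n)} (hτ : DifferentiableAt ℝ τ y)
    (hdet : (jacobian τ y).det ≠ 0) :
    ∃ e : EuclideanSpace ℝ (Fin n) ≃L[ℝ] EuclideanSpace ℝ (Fin n),
      HasFDerivAt τ (e : EuclideanSpace ℝ (Fin n) →L[ℝ] EuclideanSpace ℝ (Fin n)) y := by
  have hinj : Function.Injective (fderiv ℝ τ y :
      EuclideanSpace ℝ (Fin n) →ₗ[ℝ] EuclideanSpace ℝ (Fin n)) := by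
    rw [← LinearMap.ker_eq_bot, LinearMap.ker_eq_bot']
    intro v hv
    have h1 : (jacobian τ y).mulVec v = 0 := by
      funext i
      rw [← fderiv_apply_eq_jacobian hτ]
      exact congrArg (fun w : EuclideanSpace ℝ (Fin n) => w i) hv
    have h2 := Matrix.eq_zero_of_mulVec_eq_zero hdet h1
    ext i
    exact congrFun h2 i
  refine ⟨(LinearEquiv.ofInjectiveEndo _ hinj).toContinuousLinearEquiv, ?_⟩
  have : ((LinearEquiv.ofInjectiveEndo _ hinj).toContinuousLinearEquiv :
      EuclideanSpace ℝ (Fin n) →L[ℝ] EuclideanSpace ℝ (Fin n)) = fderiv ℝ τ y := by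
    ext v; rfl
  rw [this]
  exact hτ.hasFDerivAt

/-- The inverse function theorem, giving a smooth local coordinate change. -/
lemma exists_smooth_openPartialHomeomorph (hS : IsOpen S) (hτ : ContDiffOn ℝ ∞ τ S)
    {y₀ : EuclideanSpace ℝ (Fin n)} (hy : y₀ ∈ S) (hdet : (jacobian τ y₀).det ≠ 0) :
    ∃ Φ : OpenPartialHomeomorph (EuclideanSpace ℝ (Fin n)) (EuclideanSpace ℝ (Fin n)),
      y₀ ∈ Φ.source ∧ Φ.source ⊆ S ∧ (∀ y, Φ y = τ y) ∧ ContDiffOn ℝ ∞ Φ.symm Φ.target := by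
  have hat : ∀ y ∈ S, ContDiffAt ℝ ∞ τ y := fun y hy => (hτ y hy).contDiffAt (hS.mem_nhds hy)
  obtain ⟨e, he⟩ := exists_hasFDerivAt_equiv ((hat y₀ hy).differentiableAt (by simp)) hdet
  set Ψ := (hat y₀ hy).toOpenPartialHomeomorph τ he (by simp) with hΨ
  have hdc : ContinuousOn (fun y => (jacobian τ y).det) S :=
    (IsMetricOn.contDiffOn_det (smooth_jacobian hS hτ)).continuousOn
  have hS' : IsOpen (S ∩ (fun y => (jacobian τ y).det) ⁻¹' {0}ᶜ) :=
    hdc.isOpen_inter_preimage hS isOpen_compl_singleton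
  refine ⟨Ψ.restrOpen _ hS', ?_, ?_, fun y => rfl, ?_⟩
  · exact ⟨(hat y₀ hy).mem_toOpenPartialHomeomorph_source he (by simp), hy, hdet⟩
  · exact fun y hy => hy.2.1
  · intro z hz
    have hz' := (Ψ.restrOpen _ hS').map_target hz
    obtain ⟨_, h2, h3⟩ := hz'
    obtain ⟨e', he'⟩ := exists_hasFDerivAt_equiv ((hat _ h2).differentiableAt (by simp)) h3
    exact ((Ψ.restrOpen _ hS').contDiffAt_symm hz he' (hat _ h2)).contDiffWithinAt

open scoped MatrixOrder in
/-- An inner product has an orthonormal frame whose elements other than one, `B_o`, are annihilated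
by a given covector. -/
lemma exists_adapted_frame {A : Matrix (Fin n) (Fin n) ℝ} (hA : A.PosDef) {ξ : Fin n → ℝ}
    (hξ : ξ ≠ 0) (o : Fin n) :
    ∃ B : Matrix (Fin n) (Fin n) ℝ, B.transpose * A * B = 1 ∧
      ∃ s : ℝ, 0 < s ∧ ∀ a, ∑ i, ξ i * B i a = if a = o then s else 0 := by
  have hA0 : 0 ≤ A := Matrix.nonneg_iff_posSemidef.2 hA.posSemidef
  set C := CFC.sqrt A with hC
  have hCC : C * C = A := CFC.sqrt_mul_sqrt_self A hA0
  have hCs : C.transpose = C := by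
    have := (Matrix.nonneg_iff_posSemidef.1 (CFC.sqrt_nonneg A)).isHermitian
    ext i j
    simpa using this.apply i j
  have hCdet : IsUnit C.det := by
    have h := hA.det_pos.ne'.isUnit
    rw [← hCC, Matrix.det_mul] at h
    exact (IsUnit.mul_iff.1 h).1
  set η : EuclideanSpace ℝ (Fin n) := WithLp.toLp 2 (Matrix.vecMul ξ C⁻¹) with hη
  have hη0 : η ≠ 0 := by
    intro h0
    have h1 : Matrix.vecMul ξ C⁻¹ = 0 := by
      funext i
      exact congrArg (fun w : EuclideanSpace ℝ (Fin n) => w i) h0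
    apply hξ
    have h2 : Matrix.vecMul (Matrix.vecMul ξ C⁻¹) C = ξ := by
      rw [Matrix.vecMul_vecMul, Matrix.nonsing_inv_mul _ hCdet, Matrix.vecMul_one]
    rw [← h2, h1, Matrix.zero_vecMul]
  have hnη : 0 < ‖η‖ := norm_pos_iff.2 hη0
  have horth : Orthonormal ℝ (({o} : Set (Fin n)).domRestrict (fun _ : Fin n => ‖η‖⁻¹ • η)) := by
    constructor
    · intro i
      simp [Set.domRestrict, norm_smul, hnη.ne']
    · intro i j hij
      exact absurd (Subsingleton.elim i j) hij
  obtain ⟨b, hb⟩ := horth.exists_orthonormalBasis_extension_of_card_eq (by simp)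
  have hbo : b o = ‖η‖⁻¹ • η := hb o rfl
  set O : Matrix (Fin n) (Fin n) ℝ := Matrix.of fun i a => b a i with hO
  have hOO : O.transpose * O = 1 := by
    ext a c
    rw [Matrix.mul_apply, Matrix.one_apply, ← b.inner_eq_ite a c, PiLp.inner_apply]
    exact Finset.sum_congr rfl fun i _ => by simp [hO, mul_comm]
  refine ⟨C⁻¹ * O, ?_, ‖η‖, hnη, ?_⟩
  · have hCi : (C⁻¹).transpose = C⁻¹ := by rw [Matrix.transpose_nonsing_inv, hCs]
    rw [Matrix.transpose_mul, hCi, ← hCC]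
    calc O.transpose * C⁻¹ * (C * C) * (C⁻¹ * O)
        = O.transpose * (C⁻¹ * C) * (C * C⁻¹) * O := by simp only [mul_assoc]
      _ = 1 := by
        rw [Matrix.nonsing_inv_mul _ hCdet, Matrix.mul_nonsing_inv _ hCdet, mul_one, mul_one, hOO]
  · intro a
    have e1 : ∑ i, ξ i * (C⁻¹ * O) i a = inner ℝ (b a) η := by
      have : ∑ i, ξ i * (C⁻¹ * O) i a = Matrix.vecMul ξ (C⁻¹ * O) a := rfl
      rw [this, ← Matrix.vecMul_vecMul, PiLp.inner_apply]
      change ∑ i, Matrix.vecMul ξ C⁻¹ i * O i a = _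
      refine Finset.sum_congr rfl fun i _ => ?_
      simp [hη, hO]
    have e2 : η = ‖η‖ • b o := by
      rw [hbo, smul_smul, mul_inv_cancel₀ hnη.ne', one_smul]
    rw [e1, e2, inner_smul_right, b.inner_eq_ite, ← e2]
    split_ifs <;> simp

lemma partialDeriv_coord (a b : Fin n) (y : EuclideanSpace ℝ (Fin n)) :
    partialDeriv a (fun z => z b) y = if a = b then 1 else 0 := by
  have : HasFDerivAt (fun z : EuclideanSpace ℝ (Fin n) => z b)
      (EuclideanSpace.proj (𝕜 := ℝ) b) y := (EuclideanSpace.proj (𝕜 := ℝ) b).hasFDerivAt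
  rw [partialDeriv, this.fderiv]
  simp [eq_comm]

/-- A smooth map with prescribed value, Jacobian matrix and second derivatives at the origin. -/
lemma exists_quadratic_map (x₀ : EuclideanSpace ℝ (Fin n)) (B : Matrix (Fin n) (Fin n) ℝ)
    (q : Fin n → Fin n → Fin n → ℝ) (hq : ∀ k a b, q k a b = q k b a) :
    ∃ τ : EuclideanSpace ℝ (Fin n) → EuclideanSpace ℝ (Fin n), ContDiff ℝ ∞ τ ∧ τ 0 = x₀ ∧
      jacobian τ 0 = B ∧ ∀ k a b, partialDeriv a (fun z => jacobian τ z k b) 0 = q k a b := by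
  have hc : ∀ b, ContDiff ℝ ∞ (fun z : EuclideanSpace ℝ (Fin n) => z b) := fun b =>
    (EuclideanSpace.proj (𝕜 := ℝ) b).contDiff
  have hco : ∀ b, ContDiffOn ℝ ∞ (fun z : EuclideanSpace ℝ (Fin n) => z b) Set.univ := fun b =>
    (hc b).contDiffOn
  set τ : EuclideanSpace ℝ (Fin n) → EuclideanSpace ℝ (Fin n) := fun y => WithLp.toLp 2 fun k =>
    x₀ k + (∑ a, B k a * y a + ∑ a, ∑ b, (q k a b / 2) * (y a * y b)) with hτ
  have h1 : ∀ k, ContDiffOn ℝ ∞ (fun z : EuclideanSpace ℝ (Fin n) => ∑ a, B k a * z a) Set.univ :=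
    fun k => ContDiffOn.sum fun a _ => contDiffOn_const.mul (hco a)
  have h2 : ∀ k a b, ContDiffOn ℝ ∞
      (fun z : EuclideanSpace ℝ (Fin n) => (q k a b / 2) * (z a * z b)) Set.univ :=
    fun k a b => contDiffOn_const.mul ((hco a).mul (hco b))
  have h3 : ∀ k, ContDiffOn ℝ ∞ (fun z : EuclideanSpace ℝ (Fin n) =>
      ∑ a, ∑ b, (q k a b / 2) * (z a * z b)) Set.univ :=
    fun k => ContDiffOn.sum fun a _ => ContDiffOn.sum fun b _ => h2 k a b
  have hjac : ∀ y k c, jacobian τ y k c = B k c + ∑ b, q k c b * y b := by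
    intro y k c
    have e0 : jacobian τ y k c = partialDeriv c (fun z : EuclideanSpace ℝ (Fin n) =>
      x₀ k + (∑ a, B k a * z a + ∑ a, ∑ b, (q k a b / 2) * (z a * z b))) y := rfl
    rw [e0, partialDeriv_add isOpen_univ contDiffOn_const ((h1 k).add (h3 k)) (Set.mem_univ _),
      partialDeriv_const, partialDeriv_add isOpen_univ (h1 k) (h3 k) (Set.mem_univ _),
      partialDeriv_sum _ isOpen_univ (fun a => contDiffOn_const.mul (hco a)) (Set.mem_univ _),
      partialDeriv_sum _ isOpen_univ (fun a => ContDiffOn.sum fun b _ => h2 k a b) (Set.mem_univ _)]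
    simp only [partialDeriv_sum _ isOpen_univ (h2 k _) (Set.mem_univ _),
      partialDeriv_const_mul isOpen_univ (hco _) _ (Set.mem_univ _),
      partialDeriv_const_mul isOpen_univ ((hco _).mul (hco _)) _ (Set.mem_univ _),
      partialDeriv_mul isOpen_univ (hco _) (hco _) (Set.mem_univ _), partialDeriv_coord,
      mul_add, Finset.sum_add_distrib]
    have e1 : ∑ a, ∑ b, q k a b / 2 * ((if c = a then 1 else 0) * y b)
        = ∑ b, q k c b / 2 * y b := by
      rw [Finset.sum_comm]; simp
    have e2 : ∑ a, ∑ b, q k a b / 2 * (y a * if c = b then 1 else 0)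
        = ∑ b, q k c b / 2 * y b := by
      simp only [hq k _ c, mul_ite, mul_one, mul_zero, Finset.sum_ite_eq, Finset.mem_univ, if_true]
    rw [e1, e2, zero_add, ← Finset.sum_add_distrib]
    congr 1
    · simp
    · exact Finset.sum_congr rfl fun b _ => by ring
  refine ⟨τ, ?_, ?_, ?_, ?_⟩
  · rw [contDiff_euclidean]
    intro k
    exact contDiffOn_univ.1 (contDiffOn_const.add ((h1 k).add (h3 k)))
  · ext k
    simp [hτ]
  · ext k c
    rw [hjac]; simp
  · intro k a b
    have : (fun z => jacobian τ z k b) = fun z => B k b + ∑ c, q k b c * z c :=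
      funext fun z => hjac z k b
    rw [this, partialDeriv_add isOpen_univ contDiffOn_const
      (ContDiffOn.sum fun c _ => contDiffOn_const.mul (hco c)) (Set.mem_univ _),
      partialDeriv_const, partialDeriv_sum _ isOpen_univ
      (fun c => contDiffOn_const.mul (hco c)) (Set.mem_univ _)]
    simp only [partialDeriv_const_mul isOpen_univ (hco _) _ (Set.mem_univ _), partialDeriv_coord]
    simp [hq k b a]

/-- Around every point there is a coordinate change after which the metric is Euclidean to first
order at the origin, and a given nonzero covector `ξ` becomes a positive multiple of `dx_o`. -/
lemma exists_normal_coordinates (hG : IsMetricOn G U) {x₀ : EuclideanSpace ℝ (Fin n)} (hx : x₀ ∈ U)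
    {ξ : Fin n → ℝ} (hξ : ξ ≠ 0) (o : Fin n) :
    ∃ Φ : OpenPartialHomeomorph (EuclideanSpace ℝ (Fin n)) (EuclideanSpace ℝ (Fin n)),
      0 ∈ Φ.source ∧ Φ 0 = x₀ ∧ Φ.target ⊆ U ∧ ContDiffOn ℝ ∞ Φ Φ.source ∧
      ContDiffOn ℝ ∞ Φ.symm Φ.target ∧
      (∀ G', IsTransition G G' Φ Φ.source U → IsNormalAt G' Φ.source 0) ∧
      ∃ s : ℝ, 0 < s ∧ ∀ a, ∑ i, jacobian Φ 0 i a * ξ i = if a = o then s else 0 := by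
  obtain ⟨B, hB, s, hs, hBs⟩ := exists_adapted_frame (hG.posDef x₀ hx) hξ o
  -- these second derivatives cancel the Christoffel symbols at `x₀`
  set q : Fin n → Fin n → Fin n → ℝ := fun k a b =>
    -∑ i, ∑ l, B i a * B l b * christoffel G k i l x₀ with hq
  have hqs : ∀ k a b, q k a b = q k b a := by
    intro k a b
    simp only [hq]
    rw [Finset.sum_comm]
    congr 1
    refine Finset.sum_congr rfl fun i _ => Finset.sum_congr rfl fun l _ => ?_
    rw [christoffel_symm hG hx]; ring
  obtain ⟨τ, hτs, hτ0, hτ1, hτ2⟩ := exists_quadratic_map x₀ B q hqs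
  have hS : IsOpen (τ ⁻¹' U) := hG.isOpen.preimage hτs.continuous
  have hdet : (jacobian τ 0).det ≠ 0 := by
    rw [hτ1]
    intro h0
    have := congrArg Matrix.det hB
    rw [Matrix.det_mul, h0, mul_zero, Matrix.det_one] at this
    exact zero_ne_one this
  obtain ⟨Φ, h0, hsub, hΦ, hΦs⟩ := exists_smooth_openPartialHomeomorph hS hτs.contDiffOn
    (by rw [Set.mem_preimage, hτ0]; exact hx) hdet
  have hΦτ : (Φ : EuclideanSpace ℝ (Fin n) → EuclideanSpace ℝ (Fin n)) = τ := funext hΦ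
  refine ⟨Φ, h0, by rw [hΦ, hτ0], ?_, ?_, hΦs, ?_, s, hs, ?_⟩
  · intro z hz
    have := hsub (Φ.map_target hz)
    rw [Set.mem_preimage, ← hΦ, Φ.right_inv hz] at this
    exact this
  · rw [hΦτ]; exact hτs.contDiffOn
  · intro G' hG'
    rw [hΦτ] at hG'
    have hone : G' 0 = 1 := by
      rw [hG'.pullback_matrix h0, hτ1, hτ0, hB]
    have hC : ∀ a b c, christoffelFirst G' a b c 0 = 0 := by
      intro a b c
      rw [hG'.christoffelFirst_eq h0]
      refine Finset.sum_eq_zero fun j _ => ?_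
      rw [mul_eq_zero]; right
      simp only [hτ2, hτ1, hτ0, hq]
      have e1 : ∀ i l, christoffelFirst G i l j x₀
          = ∑ k, G x₀ k j * christoffel G k i l x₀ := by
        intro i l
        simp only [christoffel_eq_sum, Finset.mul_sum]
        rw [Finset.sum_comm]
        simp only [← mul_assoc, ← Finset.sum_mul, hG.symm hx _ j, hG.sum_mul_inv hx]
        simp
      simp only [e1, neg_mul, Finset.sum_neg_distrib, Finset.sum_mul, Finset.mul_sum]
      rw [neg_add_eq_zero, Finset.sum_comm]
      refine Finset.sum_congr rfl fun i _ => ?_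
      rw [Finset.sum_comm]
      exact Finset.sum_congr rfl fun l _ => Finset.sum_congr rfl fun k _ => by ring
    refine ⟨hG'.metric', h0, hone, fun k i j => ?_⟩
    have e1 := hC k i j
    have e2 := hC k j i
    simp only [christoffelFirst] at e1 e2
    have e3 : ∀ m i j, partialDeriv m (fun y => G' y i j) 0
        = partialDeriv m (fun y => G' y j i) 0 := fun m i j =>
      partialDeriv_congr hG'.metric'.isOpen (fun y hy => hG'.metric'.symm hy i j) m h0
    rw [e3 k j i] at e2
    linarith
  · intro a
    rw [hΦτ, hτ1, ← hBs a]
    exact Finset.sum_congr rfl fun i _ => mul_comm _ _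

end NormalCoordinates

/-! ### The metric in the charts of a manifold -/

section Charts

variable {n : ℕ} {M : Type*} [TopologicalSpace M]
  {e e' : OpenPartialHomeomorph M (EuclideanSpace ℝ (Fin n))}
  {τ : EuclideanSpace ℝ (Fin n) → EuclideanSpace ℝ (Fin n)} {W : Set (EuclideanSpace ℝ (Fin n))}

lemma mem_transition_source {p : M} (hp : p ∈ e.source) (hp' : p ∈ e'.source) :
    e' p ∈ e'.target ∩ e'.symm ⁻¹' e.source :=
  ⟨e'.map_source hp', by rwa [Set.mem_preimage, e'.left_inv hp']⟩

lemma comp_symm_eqOn (f : M → ℝ) :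
    Set.EqOn (f ∘ e'.symm) (fun z => (f ∘ e.symm) ((e ∘ e'.symm) z))
      (e'.target ∩ e'.symm ⁻¹' e.source) := by
  intro y hy
  simp only [Function.comp_apply]
  rw [e.left_inv hy.2]

lemma coordLaplacian_congr {G : EuclideanSpace ℝ (Fin n) → Matrix (Fin n) (Fin n) ℝ}
    {a b : EuclideanSpace ℝ (Fin n) → ℝ} (hW : IsOpen W) (h : Set.EqOn a b W) :
    Set.EqOn (coordLaplacian G a) (coordLaplacian G b) W := by
  intro y hy
  simp only [coordLaplacian, coordHess]
  have h1 := fun i => partialDeriv_congr hW h i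
  simp only [h1 _ hy, partialDeriv_congr hW (h1 _) _ hy]

lemma coordNormalDeriv_congr {G : EuclideanSpace ℝ (Fin n) → Matrix (Fin n) (Fin n) ℝ}
    {a b a' b' : EuclideanSpace ℝ (Fin n) → ℝ} (hW : IsOpen W) (h : Set.EqOn a b W)
    (h' : Set.EqOn a' b' W) :
    Set.EqOn (coordNormalDeriv G a a') (coordNormalDeriv G b b') W := by
  intro y hy
  have h1 := fun i => partialDeriv_congr hW h i
  have h2 := fun i => partialDeriv_congr hW h' i
  simp only [coordNormalDeriv, coordNormal, coordInner, coordGrad, h1 _ hy, h2 _ hy]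

variable [ChartedSpace (EuclideanSpace ℝ (Fin n)) M]

lemma mdifferentiable_of_mem_maximalAtlas (he : e ∈ IsManifold.maximalAtlas (𝓡 n) ∞ M) :
    e.MDifferentiable (𝓡 n) (𝓡 n) :=
  ⟨(contMDiffOn_of_mem_maximalAtlas he).mdifferentiableOn (by simp),
    (contMDiffOn_symm_of_mem_maximalAtlas he).mdifferentiableOn (by simp)⟩

lemma smooth_comp_symm (he : e ∈ IsManifold.maximalAtlas (𝓡 n) ∞ M) {f : M → ℝ}
    (hf : ContMDiff (𝓡 n) 𝓘(ℝ) ∞ f) : ContDiffOn ℝ ∞ (f ∘ e.symm) e.target := by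
  rw [← contMDiffOn_iff_contDiffOn]
  exact hf.comp_contMDiffOn (contMDiffOn_symm_of_mem_maximalAtlas he)

lemma smooth_transition (he : e ∈ IsManifold.maximalAtlas (𝓡 n) ∞ M)
    (he' : e' ∈ IsManifold.maximalAtlas (𝓡 n) ∞ M) :
    ContDiffOn ℝ ∞ (e ∘ e'.symm) (e'.target ∩ e'.symm ⁻¹' e.source) := by
  rw [← contMDiffOn_iff_contDiffOn]
  exact (contMDiffOn_of_mem_maximalAtlas he).comp
    ((contMDiffOn_symm_of_mem_maximalAtlas he').mono Set.inter_subset_left) fun y hy => hy.2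

variable [IsManifold (𝓡 n) ∞ M]

lemma smooth_metricInChart (g : SmoothMetric n M) (he : e ∈ IsManifold.maximalAtlas (𝓡 n) ∞ M)
    (i j : Fin n) : ContDiffOn ℝ ∞ (fun x => metricInChart g e x i j) e.target := by
  have hs := contMDiffOn_symm_of_mem_maximalAtlas he
  have hvec : ∀ i, ContMDiffOn (𝓡 n) (𝓡 n).tangent ∞
      (fun x => (⟨e.symm x, coordVec e i x⟩ : TangentBundle (𝓡 n) M)) e.target := by
    intro i
    have h1 : ContMDiffOn (𝓡 n).tangent (𝓡 n).tangent ∞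
        (tangentMapWithin (𝓡 n) (𝓡 n) e.symm e.target)
        (Bundle.TotalSpace.proj ⁻¹' e.target) :=
      hs.contMDiffOn_tangentMapWithin (by simp) e.open_target.uniqueMDiffOn
    have h2 : ContMDiff (𝓡 n) (𝓡 n).tangent ∞ (fun x : EuclideanSpace ℝ (Fin n) =>
        (⟨x, (EuclideanSpace.single i 1 : EuclideanSpace ℝ (Fin n))⟩ :
          TangentBundle (𝓡 n) (EuclideanSpace ℝ (Fin n)))) := by
      exact contMDiff_vectorSpace_iff_contDiff.2 contDiff_const
    refine (h1.comp h2.contMDiffOn (t := Bundle.TotalSpace.proj ⁻¹' e.target)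
      (s := e.target) fun x hx => hx).congr fun x hx => ?_
    simp only [Function.comp_apply, tangentMapWithin, coordVec]
    rw [mfderivWithin_of_isOpen e.open_target hx]
  rw [← contMDiffOn_iff_contDiffOn]
  intro x hx
  have : ContMDiffWithinAt (𝓡 n) ((𝓡 n).prod 𝓘(ℝ)) ∞
      (fun x => TotalSpace.mk' ℝ (E := Bundle.Trivial M ℝ) (e.symm x)
        (g.inner (e.symm x) (coordVec e i x) (coordVec e j x))) e.target x := by
    apply ContMDiffWithinAt.clm_bundle_apply₂ (F₁ := EuclideanSpace ℝ (Fin n))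
      (F₂ := EuclideanSpace ℝ (Fin n))
    · exact ContMDiffAt.comp_contMDiffWithinAt x g.contMDiff.contMDiffAt (hs x hx)
    · exact hvec i x hx
    · exact hvec j x hx
  simp only [contMDiffWithinAt_totalSpace] at this
  exact this.2

lemma inner_mfderiv_symm (g : SmoothMetric n M) (e : OpenPartialHomeomorph M _)
    (x v w : EuclideanSpace ℝ (Fin n)) :
    g.inner (e.symm x) (mfderiv (𝓡 n) (𝓡 n) e.symm x v) (mfderiv (𝓡 n) (𝓡 n) e.symm x w)
      = ∑ i, ∑ j, v i * w j * metricInChart g e x i j := by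
  have hsum : ∀ v : EuclideanSpace ℝ (Fin n),
      mfderiv (𝓡 n) (𝓡 n) e.symm x v = ∑ i, v i • coordVec e i x := by
    intro v
    have hv : v = ∑ i, v i • EuclideanSpace.single i (1 : ℝ) := by
      ext j; simp [Finset.sum_apply, Pi.single_apply]
    conv_lhs => rw [hv]
    simp only [coordVec]
    erw [map_sum]
    exact Finset.sum_congr rfl fun i _ => map_smul _ _ _
  rw [hsum, hsum]
  simp only [map_sum, map_smul, sum_apply, smul_apply,
    smul_eq_mul, Finset.mul_sum, metricInChart, Matrix.of_apply]
  rw [Finset.sum_comm]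
  exact Finset.sum_congr rfl fun i _ => Finset.sum_congr rfl fun j _ => by ring

lemma isMetricOn_metricInChart (g : SmoothMetric n M)
    (he : e ∈ IsManifold.maximalAtlas (𝓡 n) ∞ M) : IsMetricOn (metricInChart g e) e.target := by
  refine ⟨e.open_target, smooth_metricInChart g he, fun x hx => ?_⟩
  rw [Matrix.posDef_iff_dotProduct_mulVec]
  refine ⟨?_, fun {v} hv => ?_⟩
  · ext i j
    simp only [metricInChart, Matrix.conjTranspose_apply, Matrix.of_apply, star_trivial]
    exact g.symm _ _ _
  · set w : EuclideanSpace ℝ (Fin n) := WithLp.toLp 2 v with hw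
    have hw0 : w ≠ 0 := fun h0 => hv (by
      funext i
      exact congrArg (fun z : EuclideanSpace ℝ (Fin n) => z i) h0)
    have h1 : mfderiv (𝓡 n) (𝓡 n) e.symm x w ≠ 0 := by
      intro h0
      apply hw0
      have := (mdifferentiable_of_mem_maximalAtlas he).symm.mfderiv_injective (x := x) hx
      exact this (h0.trans (map_zero _).symm)
    have h2 := g.pos _ _ h1
    rw [inner_mfderiv_symm] at h2
    have e1 : v ⬝ᵥ (metricInChart g e x).mulVec v
        = ∑ i, ∑ j, w i * w j * metricInChart g e x i j := by
      simp only [dotProduct, Matrix.mulVec, Finset.mul_sum]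
      exact Finset.sum_congr rfl fun i _ => Finset.sum_congr rfl fun j _ => by
        simp only [hw]; ring
    rw [← e1] at h2
    exact h2

lemma metricInChart_pullback (g : SmoothMetric n M)
    (he : e ∈ IsManifold.maximalAtlas (𝓡 n) ∞ M) (hW : IsOpen W) (hτ : ContDiffOn ℝ ∞ τ W)
    (hm : Set.MapsTo τ W e.target) (heq : Set.EqOn e'.symm (e.symm ∘ τ) W)
    {y : EuclideanSpace ℝ (Fin n)} (hy : y ∈ W) (a b : Fin n) :
    metricInChart g e' y a b
      = ∑ i, ∑ j, jacobian τ y i a * jacobian τ y j b * metricInChart g e (τ y) i j := by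
  have hd : DifferentiableAt ℝ τ y :=
    ((hτ y hy).contDiffAt (hW.mem_nhds hy)).differentiableAt (by simp)
  have h1 : e'.symm =ᶠ[nhds y] (e.symm ∘ τ) := heq.eventuallyEq_of_mem (hW.mem_nhds hy)
  have hsd : MDifferentiableAt (𝓡 n) (𝓡 n) e.symm (τ y) :=
    (mdifferentiable_of_mem_maximalAtlas he).mdifferentiableAt_symm (hm hy)
  have h2 : HasMFDerivAt (𝓡 n) (𝓡 n) (e.symm ∘ τ) y
      ((mfderiv (𝓡 n) (𝓡 n) e.symm (τ y)).comp (fderiv ℝ τ y)) :=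
    hsd.hasMFDerivAt.comp y hd.hasFDerivAt.hasMFDerivAt
  have h3 : HasMFDerivAt (𝓡 n) (𝓡 n) e'.symm y
      ((mfderiv (𝓡 n) (𝓡 n) e.symm (τ y)).comp (fderiv ℝ τ y)) := h2.congr_of_eventuallyEq h1
  -- all tangent spaces are the model space, so that the base point of the metric can be rewritten
  have h4 : ∀ p q : M, p = q → ∀ v w : EuclideanSpace ℝ (Fin n),
      (g.inner p : EuclideanSpace ℝ (Fin n) →L[ℝ] EuclideanSpace ℝ (Fin n) →L[ℝ] ℝ) v w
        = (g.inner q : EuclideanSpace ℝ (Fin n) →L[ℝ] EuclideanSpace ℝ (Fin n) →L[ℝ] ℝ) v w := by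
    rintro p _ rfl v w; rfl
  have h5 : ∀ a, coordVec e' a y = mfderiv (𝓡 n) (𝓡 n) e.symm (τ y)
      (fderiv ℝ τ y (EuclideanSpace.single a 1)) := by
    intro a
    rw [coordVec, h3.mfderiv]; rfl
  have h6 : ∀ a i, fderiv ℝ τ y (EuclideanSpace.single a 1) i = jacobian τ y i a := by
    intro a i
    rw [fderiv_apply_eq_jacobian hd]
    simp
  have h7 := inner_mfderiv_symm g e (τ y) (fderiv ℝ τ y (EuclideanSpace.single a 1))
    (fderiv ℝ τ y (EuclideanSpace.single b 1))
  simp only [h6] at h7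
  rw [← h7]
  simp only [metricInChart, Matrix.of_apply]
  rw [h5, h5]
  exact h4 _ _ (heq hy) _ _

lemma isTransition_of_eqOn (g : SmoothMetric n M)
    (he : e ∈ IsManifold.maximalAtlas (𝓡 n) ∞ M) (he' : e' ∈ IsManifold.maximalAtlas (𝓡 n) ∞ M)
    (hW : IsOpen W) (hWt : W ⊆ e'.target) (hτ : ContDiffOn ℝ ∞ τ W)
    (hm : Set.MapsTo τ W e.target) (heq : Set.EqOn e'.symm (e.symm ∘ τ) W) :
    IsTransition (metricInChart g e) (metricInChart g e') τ W e.target := by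
  have h := isMetricOn_metricInChart g he'
  exact ⟨isMetricOn_metricInChart g he, ⟨hW, fun i j => (h.smooth i j).mono hWt,
    fun x hx => h.posDef x (hWt hx)⟩, hm, hτ,
    fun y hy a b => metricInChart_pullback g he hW hτ hm heq hy a b⟩

/-- The transition map between two charts is a change of coordinates. -/
lemma isTransition_charts (g : SmoothMetric n M)
    (he : e ∈ IsManifold.maximalAtlas (𝓡 n) ∞ M) (he' : e' ∈ IsManifold.maximalAtlas (𝓡 n) ∞ M) :
    IsTransition (metricInChart g e) (metricInChart g e') (e ∘ e'.symm)
      (e'.target ∩ e'.symm ⁻¹' e.source) e.target :=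
  isTransition_of_eqOn g he he' (e'.isOpen_inter_preimage_symm e.open_source)
    Set.inter_subset_left (smooth_transition he he') (fun _ hy => e.map_source hy.2)
    fun _ hy => (e.left_inv hy.2).symm

/-- The Laplacian of a function on `M` does not depend on the chart. -/
lemma coordLaplacian_chart_eq (g : SmoothMetric n M)
    (he : e ∈ IsManifold.maximalAtlas (𝓡 n) ∞ M) (he' : e' ∈ IsManifold.maximalAtlas (𝓡 n) ∞ M)
    {f : M → ℝ} (hf : ContMDiff (𝓡 n) 𝓘(ℝ) ∞ f) {p : M} (hp : p ∈ e.source)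
    (hp' : p ∈ e'.source) :
    coordLaplacian (metricInChart g e') (f ∘ e'.symm) (e' p)
      = coordLaplacian (metricInChart g e) (f ∘ e.symm) (e p) := by
  have h := isTransition_charts g he he'
  have hy := mem_transition_source hp hp'
  rw [coordLaplacian_congr h.metric'.isOpen (comp_symm_eqOn (e := e) f) hy,
    h.laplacian_comp hy (smooth_comp_symm he hf), Function.comp_apply, e'.left_inv hp']

/-- The normal derivative of a function on `M` does not depend on the chart. -/
lemma coordNormalDeriv_chart_eq (g : SmoothMetric n M)
    (he : e ∈ IsManifold.maximalAtlas (𝓡 n) ∞ M) (he' : e' ∈ IsManifold.maximalAtlas (𝓡 n) ∞ M)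
    {r f : M → ℝ} (hr : ContMDiff (𝓡 n) 𝓘(ℝ) ∞ r) (hf : ContMDiff (𝓡 n) 𝓘(ℝ) ∞ f) {p : M}
    (hp : p ∈ e.source) (hp' : p ∈ e'.source) :
    coordNormalDeriv (metricInChart g e') (r ∘ e'.symm) (f ∘ e'.symm) (e' p)
      = coordNormalDeriv (metricInChart g e) (r ∘ e.symm) (f ∘ e.symm) (e p) := by
  have h := isTransition_charts g he he'
  have hy := mem_transition_source hp hp'
  rw [coordNormalDeriv_congr h.metric'.isOpen (comp_symm_eqOn (e := e) r)
    (comp_symm_eqOn (e := e) f) hy, h.normalDeriv_comp hy (smooth_comp_symm he hr)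
    (smooth_comp_symm he hf), Function.comp_apply, e'.left_inv hp']

/-- A chart around `p` in which the metric is Euclidean to first order at `p` and the differential
of a function `r` that is regular at `p` is a positive multiple of `dx_o`. -/
lemma exists_normal_chart (g : SmoothMetric n M) (he : e ∈ IsManifold.maximalAtlas (𝓡 n) ∞ M)
    {p : M} (hp : p ∈ e.source) {ξ : Fin n → ℝ} (hξ : ξ ≠ 0) (o : Fin n) :
    ∃ e' ∈ IsManifold.maximalAtlas (𝓡 n) ∞ M, p ∈ e'.source ∧
      IsNormalAt (metricInChart g e') e'.target (e' p) ∧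
      ∃ s : ℝ, 0 < s ∧ ∀ f : M → ℝ, ContMDiff (𝓡 n) 𝓘(ℝ) ∞ f →
        (∀ i, partialDeriv i (f ∘ e.symm) (e p) = ξ i) →
        ∀ a, partialDeriv a (f ∘ e'.symm) (e' p) = if a = o then s else 0 := by
  obtain ⟨Φ, h0, hΦ0, hΦt, hΦs, hΦi, hnorm, s, hs, hsum⟩ :=
    exists_normal_coordinates (isMetricOn_metricInChart g he) (e.map_source hp) hξ o
  set e' := e.trans Φ.symm with he'_def
  have hp' : p ∈ e'.source := by
    rw [he'_def, OpenPartialHomeomorph.trans_source]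
    refine ⟨hp, ?_⟩
    rw [Set.mem_preimage, OpenPartialHomeomorph.symm_source, ← hΦ0]
    exact Φ.map_source h0
  have he'p : e' p = 0 := by
    change Φ.symm (e p) = 0
    rw [← hΦ0, Φ.left_inv h0]
  have htgt : e'.target = Φ.source := by
    rw [he'_def, OpenPartialHomeomorph.trans_target]
    change Φ.source ∩ Φ ⁻¹' e.target = Φ.source
    exact Set.inter_eq_left.2 fun y hy => hΦt (Φ.map_source hy)
  have hsymm : (e'.symm : EuclideanSpace ℝ (Fin n) → M) = e.symm ∘ Φ := rfl
  have he' : e' ∈ IsManifold.maximalAtlas (𝓡 n) ∞ M := by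
    apply e'.mem_maximalAtlas_of_contMDiffOn
    · refine (contMDiffOn_iff_contDiffOn.2 hΦi).comp
        ((contMDiffOn_of_mem_maximalAtlas he).mono ?_) ?_
      · exact fun q hq => hq.1
      · exact fun q hq => hq.2
    · rw [htgt, hsymm]
      exact (contMDiffOn_symm_of_mem_maximalAtlas he).comp (contMDiffOn_iff_contDiffOn.2 hΦs)
        fun y hy => hΦt (Φ.map_source hy)
  have htr : IsTransition (metricInChart g e) (metricInChart g e') Φ Φ.source e.target :=
    isTransition_of_eqOn g he he' Φ.open_source htgt.ge hΦs
      (fun y hy => hΦt (Φ.map_source hy)) fun y _ => rfl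
  refine ⟨e', he', hp', ?_, s, hs, fun f hf hfξ a => ?_⟩
  · rw [he'p, htgt]; exact hnorm _ htr
  · rw [he'p, hsymm, ← hsum a]
    have h1 := partialDeriv_comp e.open_target Φ.open_source hΦs htr.mapsTo
      (smooth_comp_symm he hf) h0 a
    rw [hΦ0] at h1
    simp only [hfξ] at h1
    exact h1

end Charts

/-! ### Unique continuation for static potentials -/

section Continuation

variable {n : ℕ} {G : EuclideanSpace ℝ (Fin n) → Matrix (Fin n) (Fin n) ℝ}
  {U : Set (EuclideanSpace ℝ (Fin n))} {f : EuclideanSpace ℝ (Fin n) → ℝ}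
  {x v : EuclideanSpace ℝ (Fin n)}

/-- The metric trace of the static equation `-(Δu) g + Hess u - u Ric = 0`. -/
lemma laplacian_of_static (hG : IsMetricOn G U) (hx : x ∈ U)
    (hstat : ∀ i j, -coordLaplacian G f x * G x i j + coordHess G f i j x
      - f x * coordRicci G i j x = 0) :
    ((n : ℝ) - 1) * coordLaplacian G f x = -(f x * coordScalar G x) := by
  have h1 : ∑ i, ∑ j, (G x)⁻¹ i j * (-coordLaplacian G f x * G x i j + coordHess G f i j x
      - f x * coordRicci G i j x) = 0 :=
    Finset.sum_eq_zero fun i _ => Finset.sum_eq_zero fun j _ => by rw [hstat, mul_zero]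
  have h2 : ∑ i, ∑ j, (G x)⁻¹ i j * G x i j = n := by
    have : ∀ i, ∑ j, (G x)⁻¹ i j * G x i j = 1 := fun i => by
      rw [← if_pos (c := i = i) rfl (α := ℝ) (t := 1) (e := 0), ← hG.sum_inv_mul hx i i]
      exact Finset.sum_congr rfl fun j _ => by rw [hG.symm hx i j]
    simp [this]
  have h3 : ∑ i, ∑ j, (G x)⁻¹ i j * (-coordLaplacian G f x * G x i j + coordHess G f i j x
      - f x * coordRicci G i j x) = -coordLaplacian G f x * (∑ i, ∑ j, (G x)⁻¹ i j * G x i j)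
        + coordLaplacian G f x - f x * coordScalar G x := by
    simp only [coordScalar]
    conv_rhs => rw [coordLaplacian]
    conv_rhs => enter [1, 1, 1]; rw [← coordLaplacian]
    simp only [Finset.mul_sum, ← Finset.sum_add_distrib, ← Finset.sum_sub_distrib]
    exact Finset.sum_congr rfl fun i _ => Finset.sum_congr rfl fun j _ => by ring
  rw [h1, h2] at h3
  linear_combination h3

/-- A static potential whose value and differential vanish at one end of a segment vanishes to first
order at the other end: on the segment they solve a linear system of ordinary differential
equations. -/
lemma jet_eq_zero_of_segment (hn : 2 ≤ n) (hG : IsMetricOn G U) (hf : ContDiffOn ℝ ∞ f U)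
    (hseg : ∀ t ∈ Set.Icc (0 : ℝ) 1, x + t • v ∈ U)
    (hstat : ∀ t ∈ Set.Icc (0 : ℝ) 1, ∀ i j,
      -coordLaplacian G f (x + t • v) * G (x + t • v) i j + coordHess G f i j (x + t • v)
        - f (x + t • v) * coordRicci G i j (x + t • v) = 0)
    (h0 : f x = 0) (h1 : ∀ k, partialDeriv k f x = 0) :
    f (x + v) = 0 ∧ ∀ k, partialDeriv k f (x + v) = 0 := by
  have hU := hG.isOpen
  have hdf := contDiffOn_partialDeriv hU hf
  have hn1 : (n : ℝ) - 1 ≠ 0 := by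
    have : (2 : ℝ) ≤ n := by exact_mod_cast hn
    linarith
  set γ : ℝ → EuclideanSpace ℝ (Fin n) := fun t => x + t • v with hγ
  have hγd : ∀ t, HasDerivAt γ v t := fun t =>
    (((hasDerivAt_id t).smul_const v).const_add x).congr_deriv (one_smul _ _)
  have hγc : Continuous γ := by fun_prop
  set T : Fin n → Fin n → EuclideanSpace ℝ (Fin n) → ℝ := fun i j y =>
    coordRicci G i j y - coordScalar G y / (n - 1) * G y i j with hT
  have hTs : ∀ i j, ContDiffOn ℝ ∞ (T i j) U := fun i j =>
    (hG.smooth_ricci i j).sub ((hG.smooth_scalar.div_const _).mul (hG.smooth i j))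
  have hcomp : ∀ {a : EuclideanSpace ℝ (Fin n) → ℝ}, ContDiffOn ℝ ∞ a U → ∀ t ∈ Set.Icc (0 : ℝ) 1,
      HasDerivAt (fun t => a (γ t)) (∑ i, v i * partialDeriv i a (γ t)) t := by
    intro a ha t ht
    rw [← fderiv_apply_eq_sum]
    exact (contDiffOn_diff hU ha (hseg t ht)).hasFDerivAt.comp_hasDerivAt t (hγd t)
  have hsecond : ∀ t ∈ Set.Icc (0 : ℝ) 1, ∀ i j, partialDeriv i (partialDeriv j f) (γ t)
      = f (γ t) * T i j (γ t) + ∑ k, christoffel G k i j (γ t) * partialDeriv k f (γ t) := by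
    intro t ht i j
    have e1 := hstat t ht i j
    have e2 := laplacian_of_static hG (hseg t ht) (hstat t ht)
    have e3 : coordLaplacian G f (γ t) = -(f (γ t) * coordScalar G (γ t)) / (n - 1) := by
      rw [eq_div_iff hn1, mul_comm]; exact e2
    change -coordLaplacian G f (γ t) * G (γ t) i j + coordHess G f i j (γ t)
      - f (γ t) * coordRicci G i j (γ t) = 0 at e1
    rw [e3, coordHess] at e1
    simp only [hT]
    linear_combination e1
  -- the squared length of the jet
  set E : ℝ → ℝ := fun t => f (γ t) ^ 2 + ∑ j, partialDeriv j f (γ t) ^ 2 with hE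
  set E' : ℝ → ℝ := fun t => 2 * (f (γ t) * ∑ i, v i * partialDeriv i f (γ t))
    + ∑ j, 2 * (partialDeriv j f (γ t) * ∑ i, v i * partialDeriv i (partialDeriv j f) (γ t)) with hE'
  have hEd : ∀ t ∈ Set.Icc (0 : ℝ) 1, HasDerivAt E (E' t) t := by
    intro t ht
    have e1 := (hcomp hf t ht).pow 2
    have e2 : HasDerivAt (fun t => ∑ j, partialDeriv j f (γ t) ^ 2)
        (∑ j, 2 * (partialDeriv j f (γ t)
          * ∑ i, v i * partialDeriv i (partialDeriv j f) (γ t))) t := by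
      refine HasDerivAt.fun_sum fun j _ => ?_
      have := (hcomp (hdf j) t ht).pow 2
      refine this.congr_deriv ?_
      simp only [Nat.cast_ofNat]; ring
    refine (e1.add e2).congr_deriv ?_
    simp only [hE', Nat.cast_ofNat]; ring
  -- the static equation expresses `∂_i ∂_j f` through the jet of `f`, so that `|E'| ≤ κ E`
  set κ : ℝ → ℝ := fun t => 2 * ∑ i, |v i| + ∑ j, 2 * ∑ i, |v i| * (|T i j (γ t)|
    + ∑ k, |christoffel G k i j (γ t)|) with hκ
  have hκc : ContinuousOn κ (Set.Icc 0 1) := by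
    have hc : ∀ {a : EuclideanSpace ℝ (Fin n) → ℝ}, ContDiffOn ℝ ∞ a U →
        ContinuousOn (fun t => |a (γ t)|) (Set.Icc 0 1) := fun ha =>
      (ha.continuousOn.comp hγc.continuousOn hseg).abs
    refine continuousOn_const.add (continuousOn_finsetSum _ fun j _ => continuousOn_const.mul
      (continuousOn_finsetSum _ fun i _ => continuousOn_const.mul ((hc (hTs i j)).add
        (continuousOn_finsetSum _ fun k _ => hc (hG.smooth_christoffel k i j)))))
  obtain ⟨K, hK⟩ := isCompact_Icc.bddAbove_image hκc
  have hKb : ∀ t ∈ Set.Icc (0 : ℝ) 1, κ t ≤ K := fun t ht => hK (Set.mem_image_of_mem κ ht)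
  have hE0 : ∀ t, 0 ≤ E t := fun t => by positivity
  have hbound : ∀ t ∈ Set.Icc (0 : ℝ) 1, |E' t| ≤ κ t * E t := by
    intro t ht
    have hfE : f (γ t) ^ 2 ≤ E t := by
      simp only [hE]
      have : 0 ≤ ∑ j, partialDeriv j f (γ t) ^ 2 := by positivity
      linarith
    have hdE : ∀ j, partialDeriv j f (γ t) ^ 2 ≤ E t := fun j => by
      have : partialDeriv j f (γ t) ^ 2 ≤ ∑ j, partialDeriv j f (γ t) ^ 2 :=
        Finset.single_le_sum (f := fun j => partialDeriv j f (γ t) ^ 2)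
          (fun _ _ => by positivity) (Finset.mem_univ j)
      simp only [hE]
      nlinarith [sq_nonneg (f (γ t))]
    have hprod : ∀ {a b : ℝ}, a ^ 2 ≤ E t → b ^ 2 ≤ E t → |a * b| ≤ E t := by
      intro a b ha hb
      rw [abs_le]
      constructor <;> nlinarith [sq_nonneg (a + b), sq_nonneg (a - b)]
    have b1 : |2 * (f (γ t) * ∑ i, v i * partialDeriv i f (γ t))| ≤ (2 * ∑ i, |v i|) * E t := by
      rw [abs_mul, abs_two, mul_assoc, Finset.mul_sum, Finset.sum_mul]
      refine mul_le_mul_of_nonneg_left ((Finset.abs_sum_le_sum_abs _ _).trans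
        (Finset.sum_le_sum fun i _ => ?_)) zero_le_two
      rw [mul_left_comm, abs_mul]
      exact mul_le_mul_of_nonneg_left (hprod hfE (hdE i)) (abs_nonneg _)
    have b2 : ∀ j, |2 * (partialDeriv j f (γ t)
        * ∑ i, v i * partialDeriv i (partialDeriv j f) (γ t))|
        ≤ (2 * ∑ i, |v i| * (|T i j (γ t)| + ∑ k, |christoffel G k i j (γ t)|)) * E t := by
      intro j
      rw [abs_mul, abs_two, mul_assoc, Finset.mul_sum, Finset.sum_mul]
      refine mul_le_mul_of_nonneg_left ((Finset.abs_sum_le_sum_abs _ _).trans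
        (Finset.sum_le_sum fun i _ => ?_)) zero_le_two
      rw [mul_left_comm, abs_mul, mul_assoc]
      refine mul_le_mul_of_nonneg_left ?_ (abs_nonneg _)
      rw [hsecond t ht i j, mul_add, add_mul, Finset.mul_sum, Finset.sum_mul]
      refine (abs_add_le _ _).trans (add_le_add ?_ ((Finset.abs_sum_le_sum_abs _ _).trans
        (Finset.sum_le_sum fun k _ => ?_)))
      · rw [← mul_assoc, abs_mul, mul_comm]
        exact mul_le_mul_of_nonneg_left (hprod (hdE j) hfE) (abs_nonneg _)
      · rw [mul_left_comm, abs_mul]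
        exact mul_le_mul_of_nonneg_left (hprod (hdE j) (hdE k)) (abs_nonneg _)
    calc |E' t| ≤ _ := abs_add_le _ _
      _ ≤ (2 * ∑ i, |v i|) * E t + ∑ j, (2 * ∑ i, |v i| * (|T i j (γ t)|
          + ∑ k, |christoffel G k i j (γ t)|)) * E t :=
        add_le_add b1 ((Finset.abs_sum_le_sum_abs _ _).trans (Finset.sum_le_sum fun j _ => b2 j))
      _ = κ t * E t := by rw [hκ, ← Finset.sum_mul, ← add_mul]
  have hγ0 : γ 0 = x := by simp [hγ]
  have hγ1 : γ 1 = x + v := by simp [hγ]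
  have hEzero : E 0 = 0 := by simp [hE, hγ0, h0, h1]
  have hE1 : f (γ 1) ^ 2 + ∑ j, partialDeriv j f (γ 1) ^ 2 = 0 :=
    eq_zero_of_abs_deriv_le_mul_abs_self_of_eq_zero_right (f := E) (f' := E') (K := K)
      (fun t ht => (hEd t ht).continuousAt.continuousWithinAt)
      (fun t ht => (hEd t ⟨ht.1, ht.2.le⟩).hasDerivWithinAt) hEzero
      (fun t ht => by
        have ht' : t ∈ Set.Icc (0 : ℝ) 1 := ⟨ht.1, ht.2.le⟩
        rw [Real.norm_eq_abs, Real.norm_eq_abs, abs_of_nonneg (hE0 t)]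
        exact (hbound t ht').trans (mul_le_mul_of_nonneg_right (hKb t ht') (hE0 t)))
      1 (by simp)
  have hs0 : 0 ≤ ∑ j, partialDeriv j f (γ 1) ^ 2 := by positivity
  rw [hγ1] at hE1 hs0
  constructor
  · have : f (x + v) ^ 2 = 0 := by nlinarith [sq_nonneg (f (x + v))]
    exact pow_eq_zero_iff two_ne_zero |>.1 this
  · intro k
    have : ∑ j, partialDeriv j f (x + v) ^ 2 = 0 := by nlinarith [sq_nonneg (f (x + v))]
    have := (Finset.sum_eq_zero_iff_of_nonneg fun j _ => by positivity).1 this k (Finset.mem_univ k)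
    exact pow_eq_zero_iff two_ne_zero |>.1 this

end Continuation

/-! ### Static potentials on a smooth domain -/

section Domain

variable {n : ℕ} {M : Type*} [TopologicalSpace M] [ChartedSpace (EuclideanSpace ℝ (Fin n)) M]
  {e e' : OpenPartialHomeomorph M (EuclideanSpace ℝ (Fin n))} {Ω : Set M} {ρ u : M → ℝ} {p : M}

namespace IsDefiningFunction

lemma isOpen (h : IsDefiningFunction n Ω ρ) : IsOpen Ω := by
  have : Ω = ρ ⁻¹' Set.Iio 0 := Set.ext fun p => h.mem_iff p
  rw [this]
  exact isOpen_Iio.preimage h.smooth.continuous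

lemma exists_partialDeriv_ne_zero (h : IsDefiningFunction n Ω ρ)
    (he : e ∈ IsManifold.maximalAtlas (𝓡 n) ∞ M) (hp : p ∈ frontier Ω) (hpe : p ∈ e.source) :
    ∃ k, partialDeriv k (ρ ∘ e.symm) (e p) ≠ 0 := by
  by_contra hcon
  push Not at hcon
  apply h.regular p hp
  have h1 : fderiv ℝ (ρ ∘ e.symm) (e p) = 0 := by
    ext v
    rw [fderiv_apply_eq_sum]
    simp [hcon]
  have hs := smooth_comp_symm he h.smooth
  have h2 : HasFDerivAt (ρ ∘ e.symm) (0 : EuclideanSpace ℝ (Fin n) →L[ℝ] ℝ) (e p) :=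
    h1 ▸ (contDiffOn_diff e.open_target hs (e.map_source hpe)).hasFDerivAt
  have h3 := ((mdifferentiable_of_mem_maximalAtlas he).mdifferentiableAt hpe).hasMFDerivAt
  have h4 := h2.hasMFDerivAt.comp p h3
  have h5 : ρ =ᶠ[nhds p] (ρ ∘ e.symm) ∘ e := by
    filter_upwards [e.open_source.mem_nhds hpe] with q hq
    simp [e.left_inv hq]
  rw [(h4.congr_of_eventuallyEq h5).mfderiv]
  exact ContinuousLinearMap.zero_comp _

end IsDefiningFunction

lemma continuousAt_comp_chart {X : Type*} [TopologicalSpace X]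
    {e : OpenPartialHomeomorph X (EuclideanSpace ℝ (Fin n))} {p : X}
    {F : EuclideanSpace ℝ (Fin n) → ℝ} (hF : ContDiffOn ℝ ∞ F e.target) (hp : p ∈ e.source) :
    ContinuousAt (fun q => F (e q)) p :=
  ContinuousAt.comp (f := e) (g := F)
    (hF.continuousOn.continuousAt (e.open_target.mem_nhds (e.map_source hp))) (e.continuousAt hp)

/-- Two functions that are continuous at a point of the closure of `A`, and agree on `A` near that
point, agree there. -/
lemma eq_of_mem_closure {X : Type*} [TopologicalSpace X] {A N : Set X} {a b : X → ℝ} {p : X}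
    (ha : ContinuousAt a p) (hb : ContinuousAt b p) (hp : p ∈ closure A) (hN : N ∈ nhds p)
    (h : ∀ q ∈ A, q ∈ N → a q = b q) : a p = b p :=
  tendsto_nhds_unique_of_frequently_eq ha hb
    (((mem_closure_iff_frequently.1 hp).and_eventually hN).mono fun q hq => h q hq.1 hq.2)

/-- A point of the boundary can be joined to the domain by a short segment in a chart, in every
direction in which the defining function decreases. -/
lemma eventually_mem_of_inward (h : IsDefiningFunction n Ω ρ)
    (he : e ∈ IsManifold.maximalAtlas (𝓡 n) ∞ M) (hp : p ∈ frontier Ω) (hpe : p ∈ e.source)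
    {v : EuclideanSpace ℝ (Fin n)} (hv : fderiv ℝ (ρ ∘ e.symm) (e p) v < 0) :
    ∀ᶠ t : ℝ in nhdsWithin 0 (Set.Ioi 0),
      e p + t • v ∈ e.target ∧ e.symm (e p + t • v) ∈ Ω := by
  have hs := smooth_comp_symm he h.smooth
  have hγc : Filter.Tendsto (fun t : ℝ => e p + t • v) (nhds 0) (nhds (e p)) := by
    have : Continuous (fun t : ℝ => e p + t • v) := by fun_prop
    simpa using this.tendsto 0
  have hd : HasDerivAt (fun t : ℝ => (ρ ∘ e.symm) (e p + t • v))
      (fderiv ℝ (ρ ∘ e.symm) (e p) v) 0 := by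
    have h1 : HasDerivAt (fun t : ℝ => e p + t • v) v 0 :=
      (((hasDerivAt_id (0 : ℝ)).smul_const v).const_add (e p)).congr_deriv (one_smul _ _)
    have h2 : HasFDerivAt (ρ ∘ e.symm) (fderiv ℝ (ρ ∘ e.symm) (e p)) (e p + (0 : ℝ) • v) := by
      rw [zero_smul, add_zero]
      exact (contDiffOn_diff e.open_target hs (e.map_source hpe)).hasFDerivAt
    exact h2.comp_hasDerivAt (0 : ℝ) h1
  have h3 := hd.hasDerivWithinAt (s := Set.Ioi 0)
  rw [hasDerivWithinAt_iff_tendsto_slope' (by simp)] at h3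
  have h0 : ρ p = 0 := (h.mem_frontier_iff p).1 hp
  filter_upwards [h3.eventually (gt_mem_nhds hv), self_mem_nhdsWithin,
    nhdsWithin_le_nhds (hγc (e.open_target.mem_nhds (e.map_source hpe)))] with t h4 h5 h6
  refine ⟨h6, (h.mem_iff _).2 ?_⟩
  rw [slope_def_field] at h4
  simp only [zero_smul, add_zero, Function.comp_apply, e.left_inv hpe, h0, sub_zero] at h4
  have h5' : (0 : ℝ) < t := h5
  exact (div_neg_iff.1 h4).resolve_left (fun h => absurd h.2 (not_lt.2 h5'.le)) |>.1

variable [IsManifold (𝓡 n) ∞ M] {g : SmoothMetric n M}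

namespace IsStaticPotential

/-- The static equation holds up to the boundary. -/
lemma static_eq (hu : IsStaticPotential g Ω ρ u) (he : e ∈ IsManifold.maximalAtlas (𝓡 n) ∞ M)
    (hp : p ∈ closure Ω) (hpe : p ∈ e.source) (i j : Fin n) :
    -coordLaplacian (metricInChart g e) (u ∘ e.symm) (e p) * metricInChart g e (e p) i j
      + coordHess (metricInChart g e) (u ∘ e.symm) i j (e p)
      - (u ∘ e.symm) (e p) * coordRicci (metricInChart g e) i j (e p) = 0 := by
  have hG := isMetricOn_metricInChart g he
  have hs := smooth_comp_symm he hu.smooth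
  have hF : ContDiffOn ℝ ∞ (fun y => -coordLaplacian (metricInChart g e) (u ∘ e.symm) y
      * metricInChart g e y i j + coordHess (metricInChart g e) (u ∘ e.symm) i j y
      - (u ∘ e.symm) y * coordRicci (metricInChart g e) i j y) e.target :=
    (((hG.smooth_laplacian hs).neg.mul (hG.smooth i j)).add (hG.smooth_hess hs i j)).sub
      (hs.mul (hG.smooth_ricci i j))
  refine eq_of_mem_closure (continuousAt_comp_chart hF hpe) (continuousAt_const (y := (0 : ℝ))) hp
    (e.open_source.mem_nhds hpe) fun q hq hqe => ?_
  have := hu.interior_eq e he q hq hqe i j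
  simp only [Function.comp_apply, e.left_inv hqe]
  exact this

lemma laplacian_eq (hu : IsStaticPotential g Ω ρ u) (he : e ∈ IsManifold.maximalAtlas (𝓡 n) ∞ M)
    (hp : p ∈ closure Ω) (hpe : p ∈ e.source) :
    ((n : ℝ) - 1) * coordLaplacian (metricInChart g e) (u ∘ e.symm) (e p)
      = -(u p * coordScalar (metricInChart g e) (e p)) := by
  have := laplacian_of_static (isMetricOn_metricInChart g he) (e.map_source hpe)
    (hu.static_eq he hp hpe)
  rwa [Function.comp_apply, e.left_inv hpe] at this

variable (hn : 2 ≤ n) (hu : IsStaticPotential g Ω ρ u) (hΩ : IsDefiningFunction n Ω ρ)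

include hn hu in
lemma eventually_zero_of_jet_zero (ho : IsOpen Ω) (he : e ∈ IsManifold.maximalAtlas (𝓡 n) ∞ M)
    (hp : p ∈ Ω) (hpe : p ∈ e.source) (h0 : u p = 0)
    (h1 : ∀ k, partialDeriv k (u ∘ e.symm) (e p) = 0) : ∀ᶠ q in nhds p, u q = 0 := by
  have hopen : IsOpen (e.target ∩ e.symm ⁻¹' Ω) := e.isOpen_inter_preimage_symm ho
  have hmem : e p ∈ e.target ∩ e.symm ⁻¹' Ω :=
    ⟨e.map_source hpe, by rwa [Set.mem_preimage, e.left_inv hpe]⟩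
  obtain ⟨ε, hε, hball⟩ := Metric.isOpen_iff.1 hopen _ hmem
  filter_upwards [e.open_source.mem_nhds hpe, (e.continuousAt hpe) (Metric.ball_mem_nhds _ hε)]
    with q hq hqb
  have hseg : ∀ t ∈ Set.Icc (0 : ℝ) 1, e p + t • (e q - e p) ∈ e.target ∩ e.symm ⁻¹' Ω :=
    fun t ht => hball ((convex_ball (e p) ε).add_smul_sub_mem (Metric.mem_ball_self hε) hqb ht)
  have := (jet_eq_zero_of_segment hn (isMetricOn_metricInChart g he)
    (smooth_comp_symm he hu.smooth) (fun t ht => (hseg t ht).1) (fun t ht i j => by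
      have h2 := hu.static_eq he (subset_closure (hseg t ht).2) (e.map_target (hseg t ht).1) i j
      rwa [e.right_inv (hseg t ht).1] at h2) (by rw [Function.comp_apply, e.left_inv hpe, h0]) h1).1
  rwa [add_sub_cancel, Function.comp_apply, e.left_inv hq] at this

include hn hu hΩ in
/-- A static potential does not vanish to first order anywhere in the closed domain. -/
lemma not_jet_zero (hconn : IsConnected Ω) (he : e ∈ IsManifold.maximalAtlas (𝓡 n) ∞ M)
    (hp : p ∈ closure Ω) (hpe : p ∈ e.source) (h0 : u p = 0)
    (h1 : ∀ k, partialDeriv k (u ∘ e.symm) (e p) = 0) : False := by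
  have ho := hΩ.isOpen
  have hint : ∀ {e : OpenPartialHomeomorph M (EuclideanSpace ℝ (Fin n))} {p : M},
      e ∈ IsManifold.maximalAtlas (𝓡 n) ∞ M → p ∈ Ω → p ∈ e.source → u p = 0 →
      (∀ k, partialDeriv k (u ∘ e.symm) (e p) = 0) → False := by
    intro e p he hp hpe h0 h1
    have hZ : Ω ⊆ interior {q | u q = 0} := by
      refine hconn.isPreconnected.subset_of_closure_inter_subset isOpen_interior
        ⟨p, hp, mem_interior_iff_mem_nhds.2 (eventually_zero_of_jet_zero hn hu ho he hp hpe h0 h1)⟩ ?_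
      rintro q ⟨hqc, hq⟩
      have hc := IsManifold.chart_mem_maximalAtlas (n := ∞) (I := 𝓡 n) q
      have hqe := mem_chart_source (EuclideanSpace ℝ (Fin n)) q
      set c := chartAt (EuclideanSpace ℝ (Fin n)) q
      have hs := smooth_comp_symm hc hu.smooth
      rw [mem_interior_iff_mem_nhds]
      refine eventually_zero_of_jet_zero hn hu ho hc hq hqe ?_ fun k => ?_
      · exact eq_of_mem_closure hu.smooth.continuous.continuousAt (continuousAt_const (y := (0 : ℝ)))
          hqc Filter.univ_mem fun z hz _ => interior_subset (s := {q | u q = 0}) hz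
      · refine eq_of_mem_closure (continuousAt_comp_chart
          (contDiffOn_partialDeriv c.open_target hs k) hqe) (continuousAt_const (y := (0 : ℝ))) hqc
          (c.open_source.mem_nhds hqe) fun z hz hzc => ?_
        have hoz : IsOpen (c.target ∩ c.symm ⁻¹' interior {q | u q = 0}) :=
          c.isOpen_inter_preimage_symm isOpen_interior
        have := partialDeriv_congr hoz (f := u ∘ c.symm) (g := fun _ => 0)
          (fun y hy => interior_subset (s := {q | u q = 0}) hy.2) k
          (x := c z) ⟨c.map_source hzc, by rwa [Set.mem_preimage, c.left_inv hzc]⟩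
        rw [this, partialDeriv_const]
    obtain ⟨q, hq, hq0⟩ := hu.nontrivial
    exact hq0 (interior_subset (s := {q | u q = 0}) (hZ hq))
  rcases (closure_eq_self_union_frontier Ω).subset hp with hp | hp'
  · exact hint he hp hpe h0 h1
  · obtain ⟨k, hk⟩ := hΩ.exists_partialDeriv_ne_zero he hp' hpe
    -- a direction in which the defining function decreases
    set v : EuclideanSpace ℝ (Fin n) :=
      (-partialDeriv k (ρ ∘ e.symm) (e p)) • EuclideanSpace.single k (1 : ℝ) with hv
    have hdv : fderiv ℝ (ρ ∘ e.symm) (e p) v < 0 := by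
      rw [hv, map_smul, smul_eq_mul]
      change -partialDeriv k (ρ ∘ e.symm) (e p) * partialDeriv k (ρ ∘ e.symm) (e p) < 0
      nlinarith [sq_pos_of_ne_zero hk]
    have hev := eventually_mem_of_inward hΩ he hp' hpe hdv
    rw [Filter.Eventually, mem_nhdsGT_iff_exists_Ioc_subset] at hev
    obtain ⟨ε, hε, hsub⟩ := hev
    have hε' : (0 : ℝ) < ε := hε
    have hseg : ∀ t ∈ Set.Icc (0 : ℝ) 1, e p + t • (ε • v) ∈ e.target ∧
        e.symm (e p + t • (ε • v)) ∈ closure Ω := by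
      intro t ht
      rcases ht.1.eq_or_lt with h | h
      · rw [← h, zero_smul, add_zero, e.left_inv hpe]
        exact ⟨e.map_source hpe, hp⟩
      · rw [smul_smul]
        have := hsub (show t * ε ∈ Set.Ioc 0 ε from ⟨mul_pos h hε', by nlinarith [ht.2]⟩)
        exact ⟨this.1, subset_closure this.2⟩
    have hend := hsub (show ε ∈ Set.Ioc 0 ε from ⟨hε', le_rfl⟩)
    obtain ⟨j0, j1⟩ := jet_eq_zero_of_segment hn (isMetricOn_metricInChart g he)
      (smooth_comp_symm he hu.smooth) (fun t ht => (hseg t ht).1) (fun t ht i j => by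
        have h2 := hu.static_eq he (hseg t ht).2 (e.map_target (hseg t ht).1) i j
        rwa [e.right_inv (hseg t ht).1] at h2) (by rw [Function.comp_apply, e.left_inv hpe, h0]) h1
    refine hint he hend.2 (e.map_target hend.1) j0 fun k => ?_
    rw [e.right_inv hend.1]
    exact j1 k

include hn hu hΩ in
/-- The set where a static potential does not vanish is dense. -/
lemma closure_subset_closure_ne_zero (hconn : IsConnected Ω) :
    closure Ω ⊆ closure (Ω ∩ {q | u q ≠ 0}) := by
  refine closure_minimal (fun p hp => ?_) isClosed_closure
  rw [mem_closure_iff_nhds]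
  by_contra hcon
  push Not at hcon
  obtain ⟨N, hN, hemp⟩ := hcon
  have hz : ∀ᶠ q in nhds p, u q = 0 := by
    filter_upwards [hN, hΩ.isOpen.mem_nhds hp] with q hq hqΩ
    by_contra h
    exact Set.eq_empty_iff_forall_notMem.1 hemp q ⟨hq, hqΩ, h⟩
  have hc := IsManifold.chart_mem_maximalAtlas (n := ∞) (I := 𝓡 n) p
  have hpe := mem_chart_source (EuclideanSpace ℝ (Fin n)) p
  set c := chartAt (EuclideanSpace ℝ (Fin n)) p
  refine not_jet_zero hn hu hΩ hconn hc (subset_closure hp) hpe hz.self_of_nhds fun k => ?_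
  have h1 : u ∘ c.symm =ᶠ[nhds (c p)] fun _ => 0 := by
    have : Filter.Tendsto c.symm (nhds (c p)) (nhds p) := by
      have := c.continuousAt_symm (c.map_source hpe)
      rwa [ContinuousAt, c.left_inv hpe] at this
    exact this.eventually hz
  rw [partialDeriv, h1.fderiv_eq]
  simp

end IsStaticPotential

end Domain

/-! ### The scalar curvature of a non-generic domain is constant -/

/-- A function that is locally constant along a preconnected set is constant on it. -/
lemma eq_of_isPreconnected {X Y : Type*} [TopologicalSpace X] {S : Set X} (hS : IsPreconnected S)
    {f : X → Y} (h : ∀ p ∈ S, ∀ᶠ q in nhds p, q ∈ S → f q = f p) {p q : X} (hp : p ∈ S)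
    (hq : q ∈ S) : f p = f q := by
  have : PreconnectedSpace S := Subtype.preconnectedSpace hS
  have hl : IsLocallyConstant (fun x : S => f x) := by
    rw [IsLocallyConstant.iff_eventually_eq]
    intro x
    filter_upwards [continuous_subtype_val.continuousAt.eventually (h x x.2)] with y hy
    exact hy y.2
  exact hl.apply_eq_of_preconnectedSpace ⟨p, hp⟩ ⟨q, hq⟩

section Constancy

variable {n : ℕ} {M : Type*} [TopologicalSpace M] [ChartedSpace (EuclideanSpace ℝ (Fin n)) M]
  [IsManifold (𝓡 n) ∞ M]
  {e e' : OpenPartialHomeomorph M (EuclideanSpace ℝ (Fin n))} {Ω : Set M} {ρ u : M → ℝ} {p : M}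
  {g : SmoothMetric n M}

namespace IsStaticPotential

section

variable (hn : 2 ≤ n) (hu : IsStaticPotential g Ω ρ u) (hΩ : IsDefiningFunction n Ω ρ)
  (hconn : IsConnected Ω) (he : e ∈ IsManifold.maximalAtlas (𝓡 n) ∞ M)

include hn hu hΩ hconn he

lemma scalar_chart_eq (he' : e' ∈ IsManifold.maximalAtlas (𝓡 n) ∞ M) (hp : p ∈ closure Ω)
    (hpe : p ∈ e.source) (hpe' : p ∈ e'.source) :
    coordScalar (metricInChart g e) (e p) = coordScalar (metricInChart g e') (e' p) := by
  refine eq_of_mem_closure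
    (continuousAt_comp_chart (isMetricOn_metricInChart g he).smooth_scalar hpe)
    (continuousAt_comp_chart (isMetricOn_metricInChart g he').smooth_scalar hpe')
    (hu.closure_subset_closure_ne_zero hn hΩ hconn hp)
    (Filter.inter_mem (e.open_source.mem_nhds hpe) (e'.open_source.mem_nhds hpe'))
    fun q hq hqe => ?_
  have h1 := hu.laplacian_eq he (subset_closure hq.1) hqe.1
  have h2 := hu.laplacian_eq he' (subset_closure hq.1) hqe.2
  rw [coordLaplacian_chart_eq g he he' hu.smooth hqe.1 hqe.2, h1] at h2
  exact mul_left_cancel₀ hq.2 (neg_inj.1 h2)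

lemma deriv_scalar_eq_zero (hp : p ∈ Ω) (hpe : p ∈ e.source) (i : Fin n) :
    partialDeriv i (coordScalar (metricInChart g e)) (e p) = 0 := by
  refine eq_of_mem_closure (continuousAt_comp_chart (contDiffOn_partialDeriv e.open_target
    (isMetricOn_metricInChart g he).smooth_scalar i) hpe) (continuousAt_const (y := (0 : ℝ)))
    (hu.closure_subset_closure_ne_zero hn hΩ hconn (subset_closure hp))
    (e.open_source.mem_nhds hpe) fun q hq hqe => ?_
  have o : Fin n := ⟨0, by omega⟩
  obtain ⟨e', he', hqe', hnorm, -⟩ := exists_normal_chart g he hqe (ξ := fun _ => 1)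
    (fun h => one_ne_zero (congrFun h o)) o
  have ho := hΩ.isOpen
  have hzero : ∀ a, partialDeriv a (coordScalar (metricInChart g e')) (e' q) = 0 := fun a => by
    have h1 := hnorm.mul_deriv_scalar_eq_zero (smooth_comp_symm he' hu.smooth)
      (e'.isOpen_inter_preimage_symm ho)
      (⟨e'.map_source hqe', by rw [Set.mem_preimage, e'.left_inv hqe']; exact hq.1⟩ :
        e' q ∈ e'.target ∩ e'.symm ⁻¹' Ω) (fun y hy k l => by
          have h2 := hu.static_eq he' (subset_closure hy.2) (e'.map_target hy.1) k l
          rwa [e'.right_inv hy.1] at h2) a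
    rw [Function.comp_apply, e'.left_inv hqe'] at h1
    exact (mul_eq_zero.1 h1).resolve_left hq.2
  have hW : IsOpen (e.target ∩ e.symm ⁻¹' (e'.source ∩ Ω)) :=
    e.isOpen_inter_preimage_symm (e'.open_source.inter ho)
  have hqW : e q ∈ e.target ∩ e.symm ⁻¹' (e'.source ∩ Ω) :=
    ⟨e.map_source hqe, by rw [Set.mem_preimage, e.left_inv hqe]; exact ⟨hqe', hq.1⟩⟩
  have hcongr : Set.EqOn (coordScalar (metricInChart g e))
      (fun z => coordScalar (metricInChart g e') ((e' ∘ e.symm) z))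
      (e.target ∩ e.symm ⁻¹' (e'.source ∩ Ω)) := fun y hy => by
    have := scalar_chart_eq hn hu hΩ hconn he he' (subset_closure hy.2.2) (e.map_target hy.1) hy.2.1
    rwa [e.right_inv hy.1] at this
  rw [partialDeriv_congr hW hcongr i hqW, partialDeriv_comp e'.open_target hW
    ((smooth_transition he' he).mono fun y hy => ⟨hy.1, hy.2.1⟩)
    (fun y hy => e'.map_source hy.2.1) (isMetricOn_metricInChart g he').smooth_scalar hqW]
  simp [e.left_inv hqe, hzero]

end

section

variable (hn : 2 ≤ n) (hu : IsStaticPotential g Ω ρ u) (hΩ : IsDefiningFunction n Ω ρ)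
  (hconn : IsConnected Ω)

include hn hu hΩ hconn

lemma scalarCurvature_eq (he : e ∈ IsManifold.maximalAtlas (𝓡 n) ∞ M) (hp : p ∈ closure Ω)
    (hpe : p ∈ e.source) : scalarCurvature g p = coordScalar (metricInChart g e) (e p) :=
  scalar_chart_eq hn hu hΩ hconn (IsManifold.chart_mem_maximalAtlas p) he hp
    (mem_chart_source _ p) hpe

lemma scalarCurvature_const {q : M} (hp : p ∈ Ω) (hq : q ∈ Ω) :
    scalarCurvature g p = scalarCurvature g q := by
  refine eq_of_isPreconnected hconn.isPreconnected (fun x hx => ?_) hp hq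
  have hc := IsManifold.chart_mem_maximalAtlas (n := ∞) (I := 𝓡 n) x
  have hxe := mem_chart_source (EuclideanSpace ℝ (Fin n)) x
  set c := chartAt (EuclideanSpace ℝ (Fin n)) x
  obtain ⟨ε, hε, hball⟩ := Metric.isOpen_iff.1 (c.isOpen_inter_preimage_symm hΩ.isOpen) (c x)
    ⟨c.map_source hxe, by rwa [Set.mem_preimage, c.left_inv hxe]⟩
  have hS := (isMetricOn_metricInChart g hc).smooth_scalar
  filter_upwards [c.open_source.mem_nhds hxe, (c.continuousAt hxe) (Metric.ball_mem_nhds _ hε)]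
    with y hy hyb hyΩ
  rw [scalarCurvature_eq hn hu hΩ hconn hc (subset_closure hyΩ) hy,
    scalarCurvature_eq hn hu hΩ hconn hc (subset_closure hx) hxe]
  refine Metric.isOpen_ball.is_const_of_fderiv_eq_zero (convex_ball (c x) ε).isPreconnected
    (fun z hz => (contDiffOn_diff c.open_target hS (hball hz).1).differentiableWithinAt)
    (fun z hz => ?_) hyb (Metric.mem_ball_self hε)
  ext v
  rw [fderiv_apply_eq_sum]
  have hz' := hball hz
  have := deriv_scalar_eq_zero hn hu hΩ hconn hc hz'.2 (c.map_target hz'.1)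
  rw [c.right_inv hz'.1] at this
  simp [this]

end

end IsStaticPotential

/-! ### The mean curvature is locally constant along the boundary -/

/-- Near a point where `∂_k r ≠ 0`, the function `r` can replace the `k`-th coordinate. -/
lemma exists_straightening {U : Set (EuclideanSpace ℝ (Fin n))}
    {r : EuclideanSpace ℝ (Fin n) → ℝ} {x₀ : EuclideanSpace ℝ (Fin n)} (hU : IsOpen U)
    (hr : ContDiffOn ℝ ∞ r U) (hx₀ : x₀ ∈ U) {k : Fin n} (hk : partialDeriv k r x₀ ≠ 0) :
    ∃ Φ : OpenPartialHomeomorph (EuclideanSpace ℝ (Fin n)) (EuclideanSpace ℝ (Fin n)),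
      x₀ ∈ Φ.source ∧ Φ.source ⊆ U ∧ (∀ y, Φ y k = r y) ∧ ContDiffOn ℝ ∞ Φ.symm Φ.target := by
  let τ : EuclideanSpace ℝ (Fin n) → EuclideanSpace ℝ (Fin n) :=
    fun x => x + (r x - x k) • EuclideanSpace.single k (1 : ℝ)
  have hτk : ∀ x, τ x k = r x := fun x => by simp [τ]
  have hτi : ∀ x i, i ≠ k → τ x i = x i := fun x i hi => by simp [τ, hi]
  have hpr : ContDiff ℝ ∞ (fun z : EuclideanSpace ℝ (Fin n) => z k) :=
    (EuclideanSpace.proj (𝕜 := ℝ) k).contDiff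
  have hτ : ContDiffOn ℝ ∞ τ U :=
    contDiffOn_id.add ((hr.sub hpr.contDiffOn).smul contDiffOn_const)
  clear_value τ
  have hdet : (jacobian τ x₀).det ≠ 0 := by
    intro h0
    obtain ⟨v, hv0, hv⟩ := Matrix.exists_mulVec_eq_zero_iff.2 h0
    have hvi : ∀ i, i ≠ k → v i = 0 := fun i hi => by
      have h1 := congrFun hv i
      have h2 : ∀ a, jacobian τ x₀ i a = if a = i then 1 else 0 := fun a => by
        rw [← partialDeriv_coord a i x₀]
        simp only [jacobian, Matrix.of_apply]
        congr 1
        funext z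
        exact hτi z i hi
      simpa [Matrix.mulVec, dotProduct, h2] using h1
    have hvk : partialDeriv k r x₀ * v k = 0 := by
      have h1 := congrFun hv k
      have h2 : ∀ a, jacobian τ x₀ k a = partialDeriv a r x₀ := fun a => by
        simp only [jacobian, Matrix.of_apply, hτk]
      rw [Matrix.mulVec, dotProduct, Finset.sum_eq_single k
        (fun b _ hb => by rw [hvi b hb, mul_zero]) (by simp), h2] at h1
      exact h1
    apply hv0
    funext i
    by_cases hi : i = k
    · subst hi; exact (mul_eq_zero.1 hvk).resolve_left hk
    · exact hvi i hi
  obtain ⟨Φ, hx₀Φ, hΦS, hΦτ, hΦi⟩ := exists_smooth_openPartialHomeomorph hU hτ hx₀ hdet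
  exact ⟨Φ, hx₀Φ, hΦS, fun y => by rw [hΦτ, hτk], hΦi⟩

/-- A function whose differential is a multiple of that of `r` along a regular level set of `r` is
locally constant along that level set: in coordinates that have `r` as a coordinate function, the
level set is a hyperplane. -/
lemma eventually_eq_on_level {U : Set (EuclideanSpace ℝ (Fin n))}
    {F r : EuclideanSpace ℝ (Fin n) → ℝ} {x₀ : EuclideanSpace ℝ (Fin n)} (hU : IsOpen U)
    (hF : ContDiffOn ℝ ∞ F U) (hr : ContDiffOn ℝ ∞ r U) (hx₀ : x₀ ∈ U)
    {k : Fin n} (hk : ∀ x ∈ U, partialDeriv k r x ≠ 0)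
    (hw : ∀ x ∈ U, r x = r x₀ → ∀ i,
      partialDeriv i F x * partialDeriv k r x = partialDeriv k F x * partialDeriv i r x) :
    ∀ᶠ x in nhds x₀, r x = r x₀ → F x = F x₀ := by
  obtain ⟨Φ, hx₀Φ, hΦU, hΦk, hΦi⟩ := exists_straightening hU hr hx₀ (hk x₀ hx₀)
  obtain ⟨ε, hε, hball⟩ := Metric.isOpen_iff.1 Φ.open_target _ (Φ.map_source hx₀Φ)
  filter_upwards [Φ.open_source.mem_nhds hx₀Φ,
    (Φ.continuousAt hx₀Φ).eventually_mem (Metric.ball_mem_nhds (Φ x₀) hε)]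
  intro x hxs hxb hrx
  have hseg : ∀ t ∈ Set.Icc (0 : ℝ) 1, Φ x₀ + t • (Φ x - Φ x₀) ∈ Φ.target :=
    fun t ht => hball ((convex_ball (Φ x₀) ε).add_smul_sub_mem (Metric.mem_ball_self hε) hxb ht)
  have hvk : (Φ x - Φ x₀) k = 0 := by rw [PiLp.sub_apply, hΦk, hΦk, hrx, sub_self]
  have hend : Φ.symm (Φ x₀ + (1 : ℝ) • (Φ x - Φ x₀)) = x := by
    rw [one_smul, add_sub_cancel, Φ.left_inv hxs]
  have hbeg : Φ.symm (Φ x₀ + (0 : ℝ) • (Φ x - Φ x₀)) = x₀ := by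
    rw [zero_smul, add_zero, Φ.left_inv hx₀Φ]
  obtain ⟨v, hv⟩ : ∃ v, v = Φ x - Φ x₀ := ⟨_, rfl⟩
  rw [← hv] at hseg hvk hend hbeg
  have hd : ∀ t ∈ Set.Icc (0 : ℝ) 1, HasDerivAt (fun t => F (Φ.symm (Φ x₀ + t • v))) 0 t := by
    intro t ht
    have hyU : Φ.symm (Φ x₀ + t • v) ∈ U := hΦU (Φ.map_target (hseg t ht))
    have hγ : HasDerivAt (fun t : ℝ => Φ x₀ + t • v) v t :=
      (((hasDerivAt_id t).smul_const v).const_add (Φ x₀)).congr_deriv (one_smul _ _)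
    have hi : HasFDerivAt Φ.symm (fderiv ℝ Φ.symm (Φ x₀ + t • v)) (Φ x₀ + t • v) :=
      (((hΦi _ (hseg t ht)).contDiffAt (Φ.open_target.mem_nhds (hseg t ht))).differentiableAt
        (by simp)).hasFDerivAt
    have hc : HasDerivAt (fun t => Φ.symm (Φ x₀ + t • v))
      (fderiv ℝ Φ.symm (Φ x₀ + t • v) v) t := hi.comp_hasDerivAt t hγ
    have hrk : ∀ᶠ s in nhds t, r (Φ.symm (Φ x₀ + s • v)) = r x₀ := by
      filter_upwards [hγ.continuousAt (Φ.open_target.mem_nhds (hseg t ht))] with s hs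
      rw [← hΦk, Φ.right_inv hs, PiLp.add_apply, PiLp.smul_apply, hvk, smul_zero, add_zero, hΦk]
    have hry := hrk.self_of_nhds
    have hdF := (contDiffOn_diff hU hF hyU).hasFDerivAt.comp_hasDerivAt t hc
    have hdr := (contDiffOn_diff hU hr hyU).hasFDerivAt.comp_hasDerivAt t hc
    have hrw := hdr.unique ((hasDerivAt_const t (r x₀)).congr_of_eventuallyEq hrk)
    generalize fderiv ℝ Φ.symm (Φ x₀ + t • v) v = w at *
    have h1 : fderiv ℝ F (Φ.symm (Φ x₀ + t • v)) w * partialDeriv k r (Φ.symm (Φ x₀ + t • v))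
        = partialDeriv k F (Φ.symm (Φ x₀ + t • v)) * fderiv ℝ r (Φ.symm (Φ x₀ + t • v)) w := by
      rw [fderiv_apply_eq_sum, fderiv_apply_eq_sum, Finset.sum_mul, Finset.mul_sum]
      refine Finset.sum_congr rfl fun i _ => ?_
      linear_combination w i * hw _ hyU hry i
    rw [hrw, mul_zero] at h1
    exact hdF.congr_deriv ((mul_eq_zero.1 h1).resolve_right (hk _ hyU))
  have := constant_of_has_deriv_right_zero (fun t ht => (hd t ht).continuousAt.continuousWithinAt)
    (fun t ht => (hd t (Set.Ico_subset_Icc_self ht)).hasDerivWithinAt) 1 (by simp)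
  rwa [hend, hbeg] at this

end Constancy

lemma IsMetricOn.mono {n : ℕ} {G : EuclideanSpace ℝ (Fin n) → Matrix (Fin n) (Fin n) ℝ}
    {U V : Set (EuclideanSpace ℝ (Fin n))} (hG : IsMetricOn G U) (hV : IsOpen V) (hVU : V ⊆ U) :
    IsMetricOn G V :=
  ⟨hV, fun i j => (hG.smooth i j).mono hVU, fun y hy => hG.posDef y (hVU hy)⟩

section MeanCurvature

variable {n : ℕ} {M : Type*} [TopologicalSpace M]
  {e e' : OpenPartialHomeomorph M (EuclideanSpace ℝ (Fin n))} {Ω : Set M} {ρ u : M → ℝ} {p : M}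

/-- The part of a chart in which `∂_k ρ` does not vanish. -/
def regularPart (e : OpenPartialHomeomorph M (EuclideanSpace ℝ (Fin n))) (ρ : M → ℝ) (k : Fin n) :
    Set (EuclideanSpace ℝ (Fin n)) :=
  e.target ∩ partialDeriv k (ρ ∘ e.symm) ⁻¹' {0}ᶜ

lemma isOpen_regularPart {k : Fin n} (hr : ContDiffOn ℝ ∞ (ρ ∘ e.symm) e.target) :
    IsOpen (regularPart e ρ k) :=
  (contDiffOn_partialDeriv e.open_target hr k).continuousOn.isOpen_inter_preimage e.open_target
    isOpen_compl_singleton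

lemma regularPart_subset {k : Fin n} : regularPart e ρ k ⊆ e.target := Set.inter_subset_left

lemma exists_partialDeriv_ne_zero_of_mem {k : Fin n} :
    ∀ y ∈ regularPart e ρ k, ∃ k, partialDeriv k (ρ ∘ e.symm) y ≠ 0 := fun _ hy => ⟨k, hy.2⟩

lemma continuousAt_of_contDiffOn_regularPart {F : EuclideanSpace ℝ (Fin n) → ℝ} {k : Fin n}
    (hr : ContDiffOn ℝ ∞ (ρ ∘ e.symm) e.target) (hF : ContDiffOn ℝ ∞ F (regularPart e ρ k))
    (hp : p ∈ e.source) (hpk : e p ∈ regularPart e ρ k) : ContinuousAt (fun q => F (e q)) p :=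
  ContinuousAt.comp (f := e) (g := F)
    (hF.continuousOn.continuousAt ((isOpen_regularPart hr).mem_nhds hpk)) (e.continuousAt hp)

variable [ChartedSpace (EuclideanSpace ℝ (Fin n)) M]

lemma IsDefiningFunction.exists_mem_regularPart (h : IsDefiningFunction n Ω ρ)
    (he : e ∈ IsManifold.maximalAtlas (𝓡 n) ∞ M) (hp : p ∈ frontier Ω) (hpe : p ∈ e.source) :
    ∃ k, e p ∈ regularPart e ρ k := by
  obtain ⟨k, hk⟩ := h.exists_partialDeriv_ne_zero he hp hpe
  exact ⟨k, e.map_source hpe, hk⟩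

variable [IsManifold (𝓡 n) ∞ M] {g : SmoothMetric n M}

lemma smooth_meanCurv_chart (he : e ∈ IsManifold.maximalAtlas (𝓡 n) ∞ M)
    (hr : ContDiffOn ℝ ∞ (ρ ∘ e.symm) e.target) (k : Fin n) :
    ContDiffOn ℝ ∞ (coordMeanCurv (metricInChart g e) (ρ ∘ e.symm)) (regularPart e ρ k) :=
  smooth_meanCurv ((isMetricOn_metricInChart g he).mono (isOpen_regularPart hr) regularPart_subset)
    (hr.mono regularPart_subset) exists_partialDeriv_ne_zero_of_mem

lemma smooth_normalDeriv {G : EuclideanSpace ℝ (Fin n) → Matrix (Fin n) (Fin n) ℝ}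
    {U : Set (EuclideanSpace ℝ (Fin n))} {r f : EuclideanSpace ℝ (Fin n) → ℝ}
    (hG : IsMetricOn G U) (hr : ContDiffOn ℝ ∞ r U) (hf : ContDiffOn ℝ ∞ f U)
    (hreg : ∀ y ∈ U, ∃ k, partialDeriv k r y ≠ 0) :
    ContDiffOn ℝ ∞ (coordNormalDeriv G r f) U := by
  unfold coordNormalDeriv
  exact ContDiffOn.sum fun k _ => (smooth_normal hG hr hreg k).mul
    (contDiffOn_partialDeriv hG.isOpen hf k)

namespace IsStaticPotential

section

variable (hu : IsStaticPotential g Ω ρ u) (hΩ : IsDefiningFunction n Ω ρ)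

include hu hΩ in
/-- The trace of the boundary equation: `u H = (n - 1) u_ν`. -/
lemma mul_meanCurv_chart (he : e ∈ IsManifold.maximalAtlas (𝓡 n) ∞ M) (hp : p ∈ frontier Ω)
    (hpe : p ∈ e.source) :
    u p * coordMeanCurv (metricInChart g e) (ρ ∘ e.symm) (e p) = ((n : ℝ) - 1)
      * coordNormalDeriv (metricInChart g e) (ρ ∘ e.symm) (u ∘ e.symm) (e p) := by
  obtain ⟨k, hk⟩ := hΩ.exists_mem_regularPart he hp hpe
  have hr := smooth_comp_symm he hΩ.smooth
  exact mul_meanCurv_eq ((isMetricOn_metricInChart g he).mono (isOpen_regularPart hr)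
    regularPart_subset) (hr.mono regularPart_subset) exists_partialDeriv_ne_zero_of_mem hk
    (hu.boundary_eq e he p hp hpe)

variable (hn : 2 ≤ n)

include hn hu hΩ

/-- Where `u ≠ 0`, the differential of `u_ν / u` is a multiple of the one of `ρ` along the
boundary. The Codazzi computation takes place in a normal chart, and the result is transported to
the given chart. -/
lemma wedge_normalDeriv_div (he : e ∈ IsManifold.maximalAtlas (𝓡 n) ∞ M) (hp : p ∈ frontier Ω)
    (hpe : p ∈ e.source) (hup : u p ≠ 0) (i j : Fin n) :
    partialDeriv i (fun y => coordNormalDeriv (metricInChart g e) (ρ ∘ e.symm) (u ∘ e.symm) y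
        / (u ∘ e.symm) y) (e p) * partialDeriv j (ρ ∘ e.symm) (e p)
      = partialDeriv j (fun y => coordNormalDeriv (metricInChart g e) (ρ ∘ e.symm) (u ∘ e.symm) y
        / (u ∘ e.symm) y) (e p) * partialDeriv i (ρ ∘ e.symm) (e p) := by
  have o : Fin n := ⟨0, by omega⟩
  obtain ⟨k, hk⟩ := hΩ.exists_partialDeriv_ne_zero he hp hpe
  obtain ⟨e', he', hpe', hnorm, s, hs, hsum⟩ := exists_normal_chart g he hpe
    (ξ := fun i => partialDeriv i (ρ ∘ e.symm) (e p)) (fun h => hk (congrFun h k)) o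
  have hdρ := hsum ρ hΩ.smooth fun _ => rfl
  have hr' := smooth_comp_symm he' hΩ.smooth
  have hf' := smooth_comp_symm he' hu.smooth
  set V := regularPart e' ρ o ∩ (u ∘ e'.symm) ⁻¹' {0}ᶜ with hV
  have hVo : IsOpen V :=
    (hf'.continuousOn.mono regularPart_subset).isOpen_inter_preimage (isOpen_regularPart hr')
      isOpen_compl_singleton
  have hVt : V ⊆ e'.target := Set.inter_subset_left.trans regularPart_subset
  have hpV : e' p ∈ V := by
    refine ⟨⟨e'.map_source hpe', ?_⟩, ?_⟩
    · have := hdρ o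
      rw [if_pos rfl] at this
      rw [Set.mem_preimage, this]; exact hs.ne'
    · simpa [e'.left_inv hpe'] using hup
  have hreg : ∀ y ∈ V, ∃ k, partialDeriv k (ρ ∘ e'.symm) y ≠ 0 :=
    fun y hy => exists_partialDeriv_ne_zero_of_mem y hy.1
  have hwedge := wedge_normalDeriv_div_eq_zero hn hnorm hr' hf' hVo hVt hpV
    (by rw [Function.comp_apply, e'.left_inv hpe']; exact (hΩ.mem_frontier_iff p).1 hp)
    hreg (fun y hy => hy.2)
    (o := o) (by rw [hdρ, if_pos rfl]; exact hs) (fun a ha => by rw [hdρ, if_neg ha])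
    (hu.static_eq he' (frontier_subset_closure hp) hpe')
    (fun y hy hry X Y hX hY => by
      have h1 := hu.boundary_eq e' he' (e'.symm y) ((hΩ.mem_frontier_iff _).2 hry)
        (e'.map_target (hVt hy)) X Y
      rw [e'.right_inv (hVt hy)] at h1
      exact h1 hX hY)
  -- the same quotient in the two charts
  set W := e.target ∩ e.symm ⁻¹' (e'.source ∩ e' ⁻¹' V) with hW
  have hWo : IsOpen W :=
    e.isOpen_inter_preimage_symm (e'.isOpen_inter_preimage hVo)
  have hpW : e p ∈ W :=
    ⟨e.map_source hpe, by rw [Set.mem_preimage, e.left_inv hpe]; exact ⟨hpe', hpV⟩⟩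
  have hτ : ContDiffOn ℝ ∞ (e' ∘ e.symm) W :=
    (smooth_transition he' he).mono fun y hy => ⟨hy.1, hy.2.1⟩
  have hτm : Set.MapsTo (e' ∘ e.symm) W V := fun y hy => hy.2.2
  have hsm : ContDiffOn ℝ ∞ (fun y => coordNormalDeriv (metricInChart g e') (ρ ∘ e'.symm)
      (u ∘ e'.symm) y / (u ∘ e'.symm) y) V :=
    (smooth_normalDeriv ((isMetricOn_metricInChart g he').mono hVo hVt) (hr'.mono hVt)
      (hf'.mono hVt) hreg).div (hf'.mono hVt) fun y hy => hy.2
  have hc1 : Set.EqOn (fun y => coordNormalDeriv (metricInChart g e) (ρ ∘ e.symm) (u ∘ e.symm) y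
        / (u ∘ e.symm) y) (fun z => (fun y => coordNormalDeriv (metricInChart g e') (ρ ∘ e'.symm)
      (u ∘ e'.symm) y / (u ∘ e'.symm) y) ((e' ∘ e.symm) z)) W := fun y hy => by
    have h1 := coordNormalDeriv_chart_eq g he he' hΩ.smooth hu.smooth (e.map_target hy.1) hy.2.1
    rw [e.right_inv hy.1] at h1
    simp only [Function.comp_apply, e'.left_inv hy.2.1]
    exact congrArg (· / u (e.symm y)) h1.symm
  have hc2 : Set.EqOn (ρ ∘ e.symm) (fun z => (ρ ∘ e'.symm) ((e' ∘ e.symm) z)) W := fun y hy => by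
    simp only [Function.comp_apply, e'.left_inv hy.2.1]
  have hep : (e' ∘ e.symm) (e p) = e' p := by rw [Function.comp_apply, e.left_inv hpe]
  have d1 : ∀ a, _ := fun a => (partialDeriv_congr hWo hc1 a hpW).trans
    (partialDeriv_comp hVo hWo hτ hτm hsm hpW a)
  have d2 : ∀ a, _ := fun a => (partialDeriv_congr hWo hc2 a hpW).trans
    (partialDeriv_comp hVo hWo hτ hτm (hr'.mono hVt) hpW a)
  rw [d1, d1, d2, d2, hep, Finset.sum_mul_sum, Finset.sum_mul_sum, Finset.sum_comm]
  refine Finset.sum_congr rfl fun a _ => Finset.sum_congr rfl fun b _ => ?_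
  linear_combination jacobian (e' ∘ e.symm) (e p) b i * jacobian (e' ∘ e.symm) (e p) a j
    * hwedge b a

variable (hconn : IsConnected Ω)

include hconn

/-- A static potential does not vanish on any open piece of the boundary: there the boundary
condition would give `u_ν = 0`, so that `u` would vanish to first order. -/
lemma frontier_subset_closure_ne_zero : frontier Ω ⊆ closure (frontier Ω ∩ {q | u q ≠ 0}) := by
  intro p hp
  rw [mem_closure_iff_nhds]
  by_contra hcon
  push Not at hcon
  obtain ⟨N, hN, hemp⟩ := hcon
  have hz : ∀ q ∈ interior N, q ∈ frontier Ω → u q = 0 := fun q hq hqΩ => by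
    by_contra h
    exact Set.eq_empty_iff_forall_notMem.1 hemp q ⟨interior_subset hq, hqΩ, h⟩
  have hc := IsManifold.chart_mem_maximalAtlas (n := ∞) (I := 𝓡 n) p
  have hpe := mem_chart_source (EuclideanSpace ℝ (Fin n)) p
  set c := chartAt (EuclideanSpace ℝ (Fin n)) p
  have hpN : p ∈ interior N := mem_interior_iff_mem_nhds.2 hN
  have hu0 : u p = 0 := hz p hpN hp
  have hr := smooth_comp_symm hc hΩ.smooth
  have hf := smooth_comp_symm hc hu.smooth
  have hG := isMetricOn_metricInChart g hc
  have hw : ∀ i j, partialDeriv i (u ∘ c.symm) (c p) * partialDeriv j (ρ ∘ c.symm) (c p)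
      = partialDeriv j (u ∘ c.symm) (c p) * partialDeriv i (ρ ∘ c.symm) (c p) := fun i j => by
    have hsub : c.target ∩ c.symm ⁻¹' interior N ⊆ c.target := Set.inter_subset_left
    refine wedge_eq_zero_of_vanishing (c.isOpen_inter_preimage_symm isOpen_interior)
      (hf.mono hsub) (hr.mono hsub) ⟨c.map_source hpe, ?_⟩ ?_ (fun y hy hry => ?_) _ _
    · rwa [Set.mem_preimage, c.left_inv hpe]
    · rw [Function.comp_apply, c.left_inv hpe]; exact (hΩ.mem_frontier_iff p).1 hp
    · exact hz _ hy.2 ((hΩ.mem_frontier_iff _).2 hry)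
  obtain ⟨k, hk⟩ := hΩ.exists_partialDeriv_ne_zero hc hp hpe
  have hpos := hG.pairing_self_pos (c.map_source hpe) ⟨k, hk⟩
  have hν : coordNormalDeriv (metricInChart g c) (ρ ∘ c.symm) (u ∘ c.symm) (c p) = 0 := by
    have h1 := hu.mul_meanCurv_chart hΩ hc hp hpe
    rw [hu0, zero_mul, eq_comm] at h1
    have : (2 : ℝ) ≤ n := by exact_mod_cast hn
    exact (mul_eq_zero.1 h1).resolve_left (by linarith)
  rw [coordNormalDeriv_eq hG (c.map_source hpe), div_eq_zero_iff] at hν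
  have hpair := hν.resolve_right (Real.sqrt_pos.2 hpos).ne'
  have hk0 : partialDeriv k (u ∘ c.symm) (c p)
      * coordPairing (metricInChart g c) (ρ ∘ c.symm) (ρ ∘ c.symm) (c p) = 0 := by
    rw [← mul_zero (partialDeriv k (ρ ∘ c.symm) (c p)), ← hpair]
    simp only [coordPairing, Finset.mul_sum]
    refine Finset.sum_congr rfl fun i _ => Finset.sum_congr rfl fun j _ => ?_
    linear_combination (metricInChart g c (c p))⁻¹ i j * partialDeriv i (ρ ∘ c.symm) (c p) * hw k j
  have hk0' := (mul_eq_zero.1 hk0).resolve_right hpos.ne'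
  refine hu.not_jet_zero hn hΩ hconn hc (frontier_subset_closure hp) hpe hu0 fun i => ?_
  have := hw i k
  rw [hk0', zero_mul] at this
  exact (mul_eq_zero.1 this).resolve_right hk

lemma meanCurv_chart_eq (he : e ∈ IsManifold.maximalAtlas (𝓡 n) ∞ M)
    (he' : e' ∈ IsManifold.maximalAtlas (𝓡 n) ∞ M) (hp : p ∈ frontier Ω) (hpe : p ∈ e.source)
    (hpe' : p ∈ e'.source) :
    coordMeanCurv (metricInChart g e) (ρ ∘ e.symm) (e p)
      = coordMeanCurv (metricInChart g e') (ρ ∘ e'.symm) (e' p) := by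
  obtain ⟨k, hk⟩ := hΩ.exists_mem_regularPart he hp hpe
  obtain ⟨k', hk'⟩ := hΩ.exists_mem_regularPart he' hp hpe'
  have hr := smooth_comp_symm he hΩ.smooth
  have hr' := smooth_comp_symm he' hΩ.smooth
  refine eq_of_mem_closure
    (continuousAt_of_contDiffOn_regularPart hr (smooth_meanCurv_chart he hr k) hpe hk)
    (continuousAt_of_contDiffOn_regularPart hr' (smooth_meanCurv_chart he' hr' k') hpe' hk')
    (hu.frontier_subset_closure_ne_zero hΩ hn hconn hp)
    (Filter.inter_mem (e.open_source.mem_nhds hpe) (e'.open_source.mem_nhds hpe'))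
    fun q hq hqe => ?_
  have h1 := hu.mul_meanCurv_chart hΩ he hq.1 hqe.1
  have h2 := hu.mul_meanCurv_chart hΩ he' hq.1 hqe.2
  rw [coordNormalDeriv_chart_eq g he he' hΩ.smooth hu.smooth hqe.1 hqe.2, ← h1] at h2
  exact mul_left_cancel₀ hq.2 h2.symm

lemma meanCurvature_eq (he : e ∈ IsManifold.maximalAtlas (𝓡 n) ∞ M) (hp : p ∈ frontier Ω)
    (hpe : p ∈ e.source) :
    meanCurvature g ρ p = coordMeanCurv (metricInChart g e) (ρ ∘ e.symm) (e p) :=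
  hu.meanCurv_chart_eq hΩ hn hconn (IsManifold.chart_mem_maximalAtlas p) he hp
    (mem_chart_source _ p) hpe

/-- Along the boundary, the differential of the mean curvature is a multiple of the one of the
defining function. -/
lemma wedge_meanCurv (he : e ∈ IsManifold.maximalAtlas (𝓡 n) ∞ M) (hp : p ∈ frontier Ω)
    (hpe : p ∈ e.source) (i j : Fin n) :
    partialDeriv i (coordMeanCurv (metricInChart g e) (ρ ∘ e.symm)) (e p)
        * partialDeriv j (ρ ∘ e.symm) (e p)
      = partialDeriv j (coordMeanCurv (metricInChart g e) (ρ ∘ e.symm)) (e p)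
        * partialDeriv i (ρ ∘ e.symm) (e p) := by
  obtain ⟨k, hk⟩ := hΩ.exists_mem_regularPart he hp hpe
  have hr := smooth_comp_symm he hΩ.smooth
  have hf := smooth_comp_symm he hu.smooth
  have hRo := isOpen_regularPart (k := k) hr
  have hH := smooth_meanCurv_chart (g := g) he hr k
  have hcH : ∀ a, ContinuousAt (fun q => partialDeriv a
      (coordMeanCurv (metricInChart g e) (ρ ∘ e.symm)) (e q)) p := fun a =>
    continuousAt_of_contDiffOn_regularPart hr (contDiffOn_partialDeriv hRo hH a) hpe hk
  have hcr : ∀ a, ContinuousAt (fun q => partialDeriv a (ρ ∘ e.symm) (e q)) p := fun a =>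
    continuousAt_comp_chart (contDiffOn_partialDeriv e.open_target hr a) hpe
  have hN : {q | q ∈ e.source ∧ e q ∈ regularPart e ρ k} ∈ nhds p :=
    Filter.inter_mem (e.open_source.mem_nhds hpe) ((e.continuousAt hpe) (hRo.mem_nhds hk))
  refine eq_of_mem_closure ((hcH i).mul (hcr j)) ((hcH j).mul (hcr i))
    (hu.frontier_subset_closure_ne_zero hΩ hn hconn hp) hN fun q hq hqe => ?_
  set V := regularPart e ρ k ∩ (u ∘ e.symm) ⁻¹' {0}ᶜ with hV
  have hVo : IsOpen V :=
    (hf.continuousOn.mono regularPart_subset).isOpen_inter_preimage hRo isOpen_compl_singleton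
  have hVt : V ⊆ e.target := Set.inter_subset_left.trans regularPart_subset
  have hqV : e q ∈ V := ⟨hqe.2, by
    rw [Set.mem_preimage, Function.comp_apply, e.left_inv hqe.1]; exact hq.2⟩
  set L : EuclideanSpace ℝ (Fin n) → ℝ := fun y =>
    coordNormalDeriv (metricInChart g e) (ρ ∘ e.symm) (u ∘ e.symm) y / (u ∘ e.symm) y with hL
  have hLs : ContDiffOn ℝ ∞ L V :=
    (smooth_normalDeriv ((isMetricOn_metricInChart g he).mono hVo hVt) (hr.mono hVt)
      (hf.mono hVt) fun y hy => exists_partialDeriv_ne_zero_of_mem y hy.1).div (hf.mono hVt)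
      fun y hy => hy.2
  have hw1 := hu.wedge_normalDeriv_div hΩ hn he hq.1 hqe.1 hq.2 i j
  have hcL : ContDiffOn ℝ ∞ (fun y => ((n : ℝ) - 1) * L y) V := contDiffOn_const.mul hLs
  have hHV := hH.mono (Set.inter_subset_left : V ⊆ _)
  have hw2 : partialDeriv i (fun y => coordMeanCurv (metricInChart g e) (ρ ∘ e.symm) y
        - (n - 1) * L y) (e q) * partialDeriv j (ρ ∘ e.symm) (e q)
      = partialDeriv j (fun y => coordMeanCurv (metricInChart g e) (ρ ∘ e.symm) y
        - (n - 1) * L y) (e q) * partialDeriv i (ρ ∘ e.symm) (e q) := by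
    refine wedge_eq_zero_of_vanishing hVo (hHV.sub hcL) (hr.mono hVt) hqV ?_
      (fun y hy hry => ?_) _ _
    · rw [Function.comp_apply, e.left_inv hqe.1]; exact (hΩ.mem_frontier_iff q).1 hq.1
    · have h1 := hu.mul_meanCurv_chart hΩ he ((hΩ.mem_frontier_iff (e.symm y)).2 hry)
        (e.map_target (hVt hy))
      rw [e.right_inv (hVt hy)] at h1
      have h2 : u (e.symm y) ≠ 0 := hy.2
      simp only [hL, Function.comp_apply]
      rw [sub_eq_zero, ← mul_div_assoc, eq_div_iff h2, mul_comm]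
      exact h1
  rw [partialDeriv_sub hVo hHV hcL hqV, partialDeriv_sub hVo hHV hcL hqV,
    partialDeriv_const_mul hVo hLs _ hqV, partialDeriv_const_mul hVo hLs _ hqV] at hw2
  rw [← hL] at hw1
  simp only [Pi.mul_apply]
  linear_combination hw2 + ((n : ℝ) - 1) * hw1

/-- The mean curvature is locally constant along the boundary. -/
lemma eventually_meanCurvature_eq (hp : p ∈ frontier Ω) :
    ∀ᶠ q in nhds p, q ∈ frontier Ω → meanCurvature g ρ q = meanCurvature g ρ p := by
  have hc := IsManifold.chart_mem_maximalAtlas (n := ∞) (I := 𝓡 n) p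
  have hpe := mem_chart_source (EuclideanSpace ℝ (Fin n)) p
  set c := chartAt (EuclideanSpace ℝ (Fin n)) p
  obtain ⟨k, hk⟩ := hΩ.exists_mem_regularPart hc hp hpe
  have hr := smooth_comp_symm hc hΩ.smooth
  have hρp : (ρ ∘ c.symm) (c p) = 0 := by
    rw [Function.comp_apply, c.left_inv hpe]; exact (hΩ.mem_frontier_iff p).1 hp
  have hev := eventually_eq_on_level (isOpen_regularPart hr) (smooth_meanCurv_chart (g := g) hc hr k)
    (hr.mono regularPart_subset) hk (fun x hx => hx.2) fun x hx hrx i => by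
      rw [hρp] at hrx
      have h1 := hu.wedge_meanCurv hΩ hn hconn hc ((hΩ.mem_frontier_iff (c.symm x)).2 hrx)
        (c.map_target hx.1) i k
      rwa [c.right_inv hx.1] at h1
  filter_upwards [c.open_source.mem_nhds hpe, (c.continuousAt hpe).eventually hev]
    with q hq hqc hqΩ
  rw [hu.meanCurvature_eq hΩ hn hconn hc hqΩ hq, hu.meanCurvature_eq hΩ hn hconn hc hp hpe]
  refine hqc ?_
  rw [hρp, Function.comp_apply, c.left_inv hq]
  exact (hΩ.mem_frontier_iff q).1 hqΩ

/-- The trace of the boundary equation: `u H = (n - 1) u_ν`. -/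
lemma mul_meanCurvature (he : e ∈ IsManifold.maximalAtlas (𝓡 n) ∞ M) (hp : p ∈ frontier Ω)
    (hpe : p ∈ e.source) :
    u p * meanCurvature g ρ p = ((n : ℝ) - 1)
      * coordNormalDeriv (metricInChart g e) (ρ ∘ e.symm) (u ∘ e.symm) (e p) := by
  rw [hu.meanCurvature_eq hΩ hn hconn he hp hpe, hu.mul_meanCurv_chart hΩ he hp hpe]

end

end IsStaticPotential

end MeanCurvature

/-! ### The maximum principle in coordinates -/

section MaximumPrinciple

variable {n : ℕ} {G : EuclideanSpace ℝ (Fin n) → Matrix (Fin n) (Fin n) ℝ}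
  {U : Set (EuclideanSpace ℝ (Fin n))} {f h : EuclideanSpace ℝ (Fin n) → ℝ}
  {x v : EuclideanSpace ℝ (Fin n)}

lemma fderiv_nonpos_of_eventually_le (hf : DifferentiableAt ℝ f x)
    (hmax : ∀ᶠ t : ℝ in nhdsWithin 0 (Set.Ioi 0), f (x + t • v) ≤ f x) : fderiv ℝ f x v ≤ 0 := by
  have hγ : HasDerivAt (fun t : ℝ => x + t • v) v 0 :=
    (((hasDerivAt_id (0 : ℝ)).smul_const v).const_add x).congr_deriv (one_smul _ _)
  have hf0 : HasFDerivAt f (fderiv ℝ f x) (x + (0 : ℝ) • v) := by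
    rw [zero_smul, add_zero]; exact hf.hasFDerivAt
  have hd := (hf0.comp_hasDerivAt (0 : ℝ) hγ).hasDerivWithinAt (s := Set.Ioi 0)
  rw [hasDerivWithinAt_iff_tendsto_slope' (by simp)] at hd
  refine le_of_tendsto hd ?_
  filter_upwards [hmax, self_mem_nhdsWithin] with t h1 h2
  have h2' : (0 : ℝ) < t := h2
  rw [slope_def_field]
  simp only [Function.comp_apply, zero_smul, add_zero, sub_zero]
  exact div_nonpos_of_nonpos_of_nonneg (by linarith) h2'.le

/-- The Hessian form of a function is nonpositive in a direction in which the function has a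
critical one-sided maximum. -/
lemma secondDeriv_nonpos_of_eventually_le (hU : IsOpen U) (hf : ContDiffOn ℝ ∞ f U) (hx : x ∈ U)
    (h0 : fderiv ℝ f x v = 0)
    (hmax : ∀ᶠ t : ℝ in nhdsWithin 0 (Set.Ioi 0), f (x + t • v) ≤ f x) :
    ∑ i, ∑ j, v i * v j * partialDeriv i (partialDeriv j f) x ≤ 0 := by
  set γ : ℝ → EuclideanSpace ℝ (Fin n) := fun t => x + t • v with hγ
  have hγd : ∀ t, HasDerivAt γ v t := fun t =>
    (((hasDerivAt_id t).smul_const v).const_add x).congr_deriv (one_smul _ _)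
  have hγ0 : γ 0 = x := by simp [hγ]
  have hγU : ∀ᶠ t in nhds (0 : ℝ), γ t ∈ U :=
    (hγd 0).continuousAt (hU.mem_nhds (by rw [hγ0]; exact hx))
  have hd1 : ∀ {F : EuclideanSpace ℝ (Fin n) → ℝ}, ContDiffOn ℝ ∞ F U → ∀ t, γ t ∈ U →
      HasDerivAt (fun t => F (γ t)) (∑ j, v j * partialDeriv j F (γ t)) t := fun hF t ht => by
    rw [← fderiv_apply_eq_sum]
    exact (contDiffOn_diff hU hF ht).hasFDerivAt.comp_hasDerivAt t (hγd t)
  set D := ∑ i, ∑ j, v i * v j * partialDeriv i (partialDeriv j f) x with hD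
  by_contra hpos
  push Not at hpos
  -- subtracting a small multiple of `t²` keeps the second derivative positive
  set φ : ℝ → ℝ := fun t => f (γ t) - D / 4 * t ^ 2 with hφ
  have hφ1 : deriv φ =ᶠ[nhds 0] fun t => (∑ j, v j * partialDeriv j f (γ t)) - D / 2 * t := by
    filter_upwards [hγU] with t ht
    refine (((hd1 hf t ht).sub ((hasDerivAt_pow 2 t).const_mul (D / 4))).congr_deriv ?_).deriv
    push_cast; ring
  have hφ2 : HasDerivAt (fun t => (∑ j, v j * partialDeriv j f (γ t)) - D / 2 * t) (D / 2) 0 := by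
    have h1 : HasDerivAt (fun t => ∑ j, v j * partialDeriv j f (γ t))
        (∑ j, v j * ∑ i, v i * partialDeriv i (partialDeriv j f) (γ 0)) 0 :=
      HasDerivAt.fun_sum fun j _ => (hd1 (contDiffOn_partialDeriv hU hf j) 0
        hγU.self_of_nhds).const_mul (v j)
    refine (h1.sub ((hasDerivAt_id (0 : ℝ)).const_mul (D / 2))).congr_deriv ?_
    have h2 : ∑ j, v j * ∑ i, v i * partialDeriv i (partialDeriv j f) (γ 0) = D := by
      rw [hγ0, hD, Finset.sum_comm]
      refine Finset.sum_congr rfl fun j _ => ?_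
      rw [Finset.mul_sum]
      exact Finset.sum_congr rfl fun i _ => by ring
    rw [h2]; ring
  have hmin : IsLocalMin φ 0 := by
    refine isLocalMin_of_deriv_deriv_pos ?_ ?_ ?_
    · rw [hφ1.deriv_eq, hφ2.deriv]; linarith
    · rw [hφ1.self_of_nhds]
      beta_reduce
      rw [hγ0, ← fderiv_apply_eq_sum, h0]; simp
    · exact ((hd1 hf 0 hγU.self_of_nhds).sub
        ((hasDerivAt_pow 2 (0 : ℝ)).const_mul (D / 4))).continuousAt
  obtain ⟨t, ⟨h1, h2⟩, h3⟩ :=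
    (((hmin.filter_mono nhdsWithin_le_nhds).and hmax).and self_mem_nhdsWithin).exists
  have h3' : (0 : ℝ) < t := h3
  have h4 : f x ≤ f (γ t) - D / 4 * t ^ 2 := by simpa [hφ, hγ0] using h1
  have h5 : f (γ t) ≤ f x := h2
  nlinarith [mul_pos hpos (pow_pos h3' 2)]

open scoped MatrixOrder in
lemma sum_mul_nonpos_of_posDef {A : Matrix (Fin n) (Fin n) ℝ} (hA : A.PosDef)
    {H : Fin n → Fin n → ℝ}
    (hH : ∀ v : EuclideanSpace ℝ (Fin n), ∑ i, ∑ j, v i * v j * H i j ≤ 0) :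
    ∑ i, ∑ j, A i j * H i j ≤ 0 := by
  have hA0 : 0 ≤ A := Matrix.nonneg_iff_posSemidef.2 hA.posSemidef
  set C := CFC.sqrt A with hC
  have hCC : C * C = A := CFC.sqrt_mul_sqrt_self A hA0
  have hCs : ∀ i j, C i j = C j i := fun i j => by
    have : C.PosSemidef := Matrix.nonneg_iff_posSemidef.1 (CFC.sqrt_nonneg A)
    simpa using this.isHermitian.apply j i
  calc ∑ i, ∑ j, A i j * H i j
      = ∑ k, ∑ i, ∑ j, C k i * C k j * H i j := by
        symm
        rw [Finset.sum_comm]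
        refine Finset.sum_congr rfl fun i _ => ?_
        rw [Finset.sum_comm]
        refine Finset.sum_congr rfl fun j _ => ?_
        rw [← hCC, Matrix.mul_apply, Finset.sum_mul]
        exact Finset.sum_congr rfl fun k _ => by rw [hCs k i]
    _ ≤ 0 := Finset.sum_nonpos fun k _ => hH (WithLp.toLp 2 (C k))

lemma laplacian_nonpos (hG : IsMetricOn G U) (hx : x ∈ U)
    (h0 : ∀ k, partialDeriv k f x = 0)
    (h2 : ∀ v : EuclideanSpace ℝ (Fin n),
      ∑ i, ∑ j, v i * v j * partialDeriv i (partialDeriv j f) x ≤ 0) :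
    coordLaplacian G f x ≤ 0 := by
  simp only [coordLaplacian, coordHess, h0, mul_zero, Finset.sum_const_zero, sub_zero]
  exact sum_mul_nonpos_of_posDef (hG.posDef x hx).inv h2

lemma laplacian_nonpos_of_isLocalMax (hG : IsMetricOn G U) (hf : ContDiffOn ℝ ∞ f U) (hx : x ∈ U)
    (hmax : IsLocalMax f x) : coordLaplacian G f x ≤ 0 := by
  have h0 : fderiv ℝ f x = 0 := hmax.fderiv_eq_zero
  refine laplacian_nonpos hG hx (fun k => by rw [partialDeriv, h0]; rfl) fun v => ?_
  refine secondDeriv_nonpos_of_eventually_le hG.isOpen hf hx (by rw [h0]; rfl) ?_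
  have : Filter.Tendsto (fun t : ℝ => x + t • v) (nhds 0) (nhds x) := by
    have : Continuous (fun t : ℝ => x + t • v) := by fun_prop
    simpa using this.tendsto 0
  exact (this.eventually hmax).filter_mono nhdsWithin_le_nhds

lemma coordLaplacian_add_const_mul (hG : IsMetricOn G U) (hf : ContDiffOn ℝ ∞ f U)
    (hh : ContDiffOn ℝ ∞ h U) (c : ℝ) (hx : x ∈ U) :
    coordLaplacian G (fun z => f z + c * h z) x
      = coordLaplacian G f x + c * coordLaplacian G h x := by
  have hU := hG.isOpen
  have hch : ContDiffOn ℝ ∞ (fun z => c * h z) U := contDiffOn_const.mul hh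
  have h1 : ∀ j, Set.EqOn (partialDeriv j (fun z => f z + c * h z))
      (fun z => partialDeriv j f z + c * partialDeriv j h z) U := fun j z hz => by
    rw [partialDeriv_add hU hf hch hz, partialDeriv_const_mul hU hh c hz]
  have h2 : ∀ i j, partialDeriv i (partialDeriv j (fun z => f z + c * h z)) x
      = partialDeriv i (partialDeriv j f) x + c * partialDeriv i (partialDeriv j h) x :=
    fun i j => by
      rw [partialDeriv_congr hU (h1 j) i hx, partialDeriv_add hU (contDiffOn_partialDeriv hU hf j)
        (contDiffOn_const.mul (contDiffOn_partialDeriv hU hh j)) hx,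
        partialDeriv_const_mul hU (contDiffOn_partialDeriv hU hh j) c hx]
  simp only [coordLaplacian, coordHess, h2, fun k => h1 k hx, Finset.mul_sum,
    ← Finset.sum_add_distrib]
  refine Finset.sum_congr rfl fun i _ => Finset.sum_congr rfl fun j _ => ?_
  have : ∑ k, christoffel G k i j x * (partialDeriv k f x + c * partialDeriv k h x)
      = (∑ k, christoffel G k i j x * partialDeriv k f x)
        + c * ∑ k, christoffel G k i j x * partialDeriv k h x := by
    rw [Finset.mul_sum, ← Finset.sum_add_distrib]
    exact Finset.sum_congr rfl fun k _ => by ring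
  rw [this]; ring

lemma coordLaplacian_mul_self (hG : IsMetricOn G U) (hf : ContDiffOn ℝ ∞ f U) (hx : x ∈ U)
    (h0 : f x = 0) :
    coordLaplacian G (fun z => f z * f z) x = 2 * coordPairing G f f x := by
  have hU := hG.isOpen
  simp only [coordLaplacian, coordHess, coordPairing, partialDeriv_partialDeriv_mul hU hf hf hx,
    partialDeriv_mul hU hf hf hx, h0, zero_mul, mul_zero, add_zero, zero_add,
    Finset.sum_const_zero, sub_zero, Finset.mul_sum]
  exact Finset.sum_congr rfl fun i _ => Finset.sum_congr rfl fun j _ => by ring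

/-- Hopf's argument: a harmonic function cannot have its maximum `m` at a boundary point `y` of a
ball on which it is smaller than `m` elsewhere. If `ψ` is the defining function of the ball, then
`φ = ψ + α ψ²` is strictly subharmonic near `y` for large `α`, and adding a small multiple of `φ`
creates an interior maximum near `y`. -/
lemma false_of_touching_ball (hG : IsMetricOn G U) (hf : ContDiffOn ℝ ∞ f U)
    (hΔ : ∀ z ∈ U, coordLaplacian G f z = 0) {m : ℝ} (hle : ∀ z ∈ U, f z ≤ m)
    {y b : EuclideanSpace ℝ (Fin n)} (hy : y ∈ U) (hym : f y = m) (hb : b ≠ 0)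
    (hlt : ∀ᶠ z in nhds y, ‖z - (y - b)‖ ≤ ‖b‖ → z ≠ y → f z < m) : False := by
  have hU := hG.isOpen
  set ψ : EuclideanSpace ℝ (Fin n) → ℝ := fun z => ‖b‖ ^ 2 - ‖z - (y - b)‖ ^ 2 with hψ
  have hψc : ContDiff ℝ ∞ ψ :=
    contDiff_const.sub ((contDiff_id.sub contDiff_const).norm_sq ℝ)
  have hψs : ContDiffOn ℝ ∞ ψ U := hψc.contDiffOn
  have hψy : ψ y = 0 := by simp [hψ]
  have hreg : ∃ k, partialDeriv k ψ y ≠ 0 := by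
    by_contra hcon
    push Not at hcon
    have h1 : fderiv ℝ ψ y b = 0 := by rw [fderiv_apply_eq_sum]; simp [hcon]
    have h2 : HasFDerivAt ψ (-(2 • (innerSL ℝ b))) y := by
      have h3 := (hasStrictFDerivAt_norm_sq (y - (y - b))).hasFDerivAt.comp y
        ((hasFDerivAt_id (𝕜 := ℝ) y).sub_const (y - b))
      rw [sub_sub_cancel] at h3
      exact h3.const_sub (‖b‖ ^ 2)
    rw [h2.fderiv] at h1
    simp at h1
    exact hb h1
  have hP := hG.pairing_self_pos hy hreg
  set α : ℝ := |coordLaplacian G ψ y| / coordPairing G ψ ψ y + 1 with hα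
  set φ : EuclideanSpace ℝ (Fin n) → ℝ := fun z => ψ z + α * (ψ z * ψ z) with hφ
  have hφc : ContDiff ℝ ∞ φ := hψc.add (contDiff_const.mul (hψc.mul hψc))
  have hφs : ContDiffOn ℝ ∞ φ U := hφc.contDiffOn
  have hφy : 0 < coordLaplacian G φ y := by
    rw [hφ, coordLaplacian_add_const_mul hG hψs (hψs.mul hψs) α hy,
      coordLaplacian_mul_self hG hψs hy hψy]
    have h1 : α * (2 * coordPairing G ψ ψ y)
        = 2 * |coordLaplacian G ψ y| + 2 * coordPairing G ψ ψ y := by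
      rw [hα]; field_simp
    rw [h1]
    have := neg_abs_le (coordLaplacian G ψ y)
    have := abs_nonneg (coordLaplacian G ψ y)
    linarith
  have hev : ∀ᶠ z in nhds y, (z ∈ U ∧ 0 < coordLaplacian G φ z) ∧
      (‖z - (y - b)‖ ≤ ‖b‖ → z ≠ y → f z < m) ∧ 0 < 1 + α * ψ z := by
    refine (Filter.Eventually.and (hU.mem_nhds hy) ?_).and (hlt.and ?_)
    · exact ((hG.smooth_laplacian hφs).continuousOn.continuousAt (hU.mem_nhds hy)).eventually
        (lt_mem_nhds hφy)
    · have : ContinuousAt (fun z => 1 + α * ψ z) y := by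
        have := hψc.continuous
        fun_prop
      exact this.eventually (lt_mem_nhds (by simp [hψy]))
  obtain ⟨η, hη, hball⟩ := Metric.nhds_basis_closedBall.eventually_iff.1 hev
  have hK : IsCompact (Metric.sphere y η ∩ {z | 0 ≤ ψ z}) :=
    (isCompact_sphere y η).inter_right (isClosed_le continuous_const hψc.continuous)
  have hεev : ∀ᶠ ε : ℝ in nhds 0, ∀ z ∈ Metric.sphere y η ∩ {z | 0 ≤ ψ z},
      f z + ε * φ z < m := by
    refine hK.eventually_forall_of_forall_eventually fun z hz => ?_
    have hzb := hball (Metric.sphere_subset_closedBall hz.1)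
    have hfz : ContinuousAt f z := hf.continuousOn.continuousAt (hU.mem_nhds hzb.1.1)
    have hc : ContinuousAt (fun w : ℝ × EuclideanSpace ℝ (Fin n) => f w.2 + w.1 * φ w.2) (0, z) :=
      (ContinuousAt.comp (f := Prod.snd) (x := ((0 : ℝ), z)) hfz continuousAt_snd).add
        (continuousAt_fst.mul
          (ContinuousAt.comp (f := Prod.snd) (x := ((0 : ℝ), z)) hφc.continuous.continuousAt
            continuousAt_snd))
    refine hc.eventually (gt_mem_nhds ?_)
    have hzy : z ≠ y := fun h => by
      have := hz.1
      rw [h, Metric.mem_sphere, dist_self] at this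
      exact hη.ne this
    have hzψ : ‖z - (y - b)‖ ≤ ‖b‖ :=
      le_of_sq_le_sq (by have h : 0 ≤ ψ z := hz.2; simp only [hψ] at h; linarith) (norm_nonneg _)
    simpa using hzb.2.1 hzψ hzy
  obtain ⟨ε, hε, hε0⟩ := ((hεev.filter_mono nhdsWithin_le_nhds).and
    (self_mem_nhdsWithin (s := Set.Ioi (0 : ℝ)))).exists
  have hε0' : 0 < ε := hε0
  have hws : ContDiffOn ℝ ∞ (fun z => f z + ε * φ z) U := hf.add (contDiffOn_const.mul hφs)
  have hcU : Metric.closedBall y η ⊆ U := fun z hz => (hball hz).1.1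
  obtain ⟨z, hz, hzmax⟩ := (isCompact_closedBall y η).exists_isMaxOn
    ⟨y, Metric.mem_closedBall_self hη.le⟩ (hws.continuousOn.mono hcU)
  have hzm : m ≤ f z + ε * φ z := by
    have := hzmax (Metric.mem_closedBall_self hη.le)
    simpa [hφ, hψy, hym] using this
  have hzs : z ∉ Metric.sphere y η := by
    intro hzs
    rcases le_or_gt 0 (ψ z) with h | h
    · exact absurd (hε z ⟨hzs, h⟩) (not_lt.2 hzm)
    · have h1 : φ z < 0 := by
        have : φ z = ψ z * (1 + α * ψ z) := by simp only [hφ]; ring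
        rw [this]
        exact mul_neg_of_neg_of_pos h (hball hz).2.2
      have := hle z (hcU hz)
      nlinarith
  have hzb : z ∈ Metric.ball y η :=
    lt_of_le_of_ne (Metric.mem_closedBall.1 hz) fun h => hzs h
  have h1 := laplacian_nonpos_of_isLocalMax hG hws (hcU hz)
    (hzmax.isLocalMax (Filter.mem_of_superset (Metric.isOpen_ball.mem_nhds hzb)
      Metric.ball_subset_closedBall))
  rw [coordLaplacian_add_const_mul hG hf hφs ε (hcU hz), hΔ z (hcU hz), zero_add] at h1
  exact absurd h1 (not_le.2 (mul_pos hε0' (hball hz).1.2))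

/-- The strong maximum principle: the set where a harmonic function attains its maximum is open. -/
lemma eventually_eq_of_isMaxOn (hG : IsMetricOn G U) (hf : ContDiffOn ℝ ∞ f U)
    (hΔ : ∀ z ∈ U, coordLaplacian G f z = 0) {m : ℝ} (hle : ∀ z ∈ U, f z ≤ m) (hx : x ∈ U)
    (hxm : f x = m) : ∀ᶠ z in nhds x, f z = m := by
  obtain ⟨δ, hδ, hball⟩ := Metric.nhds_basis_closedBall.mem_iff.1 (hG.isOpen.mem_nhds hx)
  filter_upwards [Metric.ball_mem_nhds x (half_pos hδ)] with x₀ hx₀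
  by_contra hne
  set C := Metric.closedBall x δ ∩ f ⁻¹' {m} with hC
  have hCc : IsCompact C := (isCompact_closedBall x δ).of_isClosed_subset
    ((hf.continuousOn.mono hball).preimage_isClosed_of_isClosed Metric.isClosed_closedBall
      isClosed_singleton) Set.inter_subset_left
  have hxC : x ∈ C := ⟨Metric.mem_closedBall_self hδ.le, hxm⟩
  obtain ⟨y, hyC, hyd⟩ := hCc.exists_infDist_eq_dist ⟨x, hxC⟩ x₀
  have hmin : ∀ z ∈ C, dist x₀ y ≤ dist x₀ z := fun z hz => hyd ▸ Metric.infDist_le_dist_of_mem hz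
  have hx₀d : dist x₀ x < δ / 2 := hx₀
  have hyb : y ∈ Metric.ball x δ := by
    have h1 := hmin x hxC
    have h2 := dist_triangle_left y x x₀
    rw [Metric.mem_ball]
    linarith
  have hyx₀ : y ≠ x₀ := fun h => hne (h ▸ hyC.2)
  set b := (1 / 2 : ℝ) • (y - x₀) with hb
  have hyb2 : y - x₀ = (2 : ℝ) • b := by rw [hb, smul_smul]; norm_num
  refine false_of_touching_ball hG hf hΔ hle (hball hyC.1) hyC.2 (b := b)
    (smul_ne_zero (by norm_num) (sub_ne_zero.2 hyx₀)) ?_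
  filter_upwards [Metric.isOpen_ball.mem_nhds hyb] with z hz hzb hzy
  refine lt_of_le_of_ne (hle z (hball (Metric.ball_subset_closedBall hz))) fun hzm => ?_
  -- the ball with diameter `[x₀, y]` meets the sphere around `x₀` through `y` only in `y`
  have h1 := hmin z ⟨Metric.ball_subset_closedBall hz, hzm⟩
  rw [dist_comm x₀ y, dist_comm x₀ z, dist_eq_norm, dist_eq_norm, hyb2, norm_smul] at h1
  have h2 : z - x₀ = (z - (y - b)) + b := by
    have : x₀ = y - (2 : ℝ) • b := by rw [← hyb2]; abel
    rw [this, two_smul]; abel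
  have h3 := parallelogram_law_with_norm ℝ (z - (y - b)) b
  rw [← h2] at h3
  have h4 : z - (y - b) - b = z - y := by abel
  rw [h4] at h3
  have h5 : 0 < ‖z - y‖ := norm_pos_iff.2 (sub_ne_zero.2 hzy)
  norm_num at h1
  nlinarith [norm_nonneg (z - (y - b)), norm_nonneg b, norm_nonneg (z - x₀)]

end MaximumPrinciple

/-! ### Maxima of a static potential -/

section Maxima

section Neg

variable {n : ℕ} {G : EuclideanSpace ℝ (Fin n) → Matrix (Fin n) (Fin n) ℝ}
  {r f : EuclideanSpace ℝ (Fin n) → ℝ} {x : EuclideanSpace ℝ (Fin n)}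

lemma coordHess_neg (i j : Fin n) :
    coordHess G (fun y => -f y) i j x = -coordHess G f i j x := by
  have h : partialDeriv j (fun y => -f y) = fun y => -partialDeriv j f y :=
    funext fun y => partialDeriv_neg j
  simp only [coordHess, h, partialDeriv_neg, mul_neg, Finset.sum_neg_distrib]
  ring

lemma coordLaplacian_neg : coordLaplacian G (fun y => -f y) x = -coordLaplacian G f x := by
  simp only [coordLaplacian, coordHess_neg, mul_neg, Finset.sum_neg_distrib]

lemma coordNormalDeriv_neg :
    coordNormalDeriv G r (fun y => -f y) x = -coordNormalDeriv G r f x := by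
  simp only [coordNormalDeriv, partialDeriv_neg, mul_neg, Finset.sum_neg_distrib]

end Neg

variable {n : ℕ} {M : Type*} [TopologicalSpace M] [ChartedSpace (EuclideanSpace ℝ (Fin n)) M]
  [IsManifold (𝓡 n) ∞ M]
  {e : OpenPartialHomeomorph M (EuclideanSpace ℝ (Fin n))} {Ω : Set M} {ρ u : M → ℝ} {p : M}
  {g : SmoothMetric n M}

/-- At a boundary maximum the outward normal derivative is nonnegative; if it vanishes, then all
first derivatives vanish, and the second derivatives in the inward directions, hence by continuity
in the tangential ones and by symmetry in all directions, are nonpositive. -/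
lemma normalDeriv_nonneg_and_laplacian_nonpos (hΩ : IsDefiningFunction n Ω ρ)
    (hu : ContMDiff (𝓡 n) 𝓘(ℝ) ∞ u) (he : e ∈ IsManifold.maximalAtlas (𝓡 n) ∞ M)
    (hp : p ∈ frontier Ω) (hpe : p ∈ e.source) (hmax : ∀ q ∈ Ω, u q ≤ u p) :
    0 ≤ coordNormalDeriv (metricInChart g e) (ρ ∘ e.symm) (u ∘ e.symm) (e p) ∧
      (coordNormalDeriv (metricInChart g e) (ρ ∘ e.symm) (u ∘ e.symm) (e p) = 0 →
        coordLaplacian (metricInChart g e) (u ∘ e.symm) (e p) ≤ 0) := by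
  have hG := isMetricOn_metricInChart g he
  have hf := smooth_comp_symm he hu
  have hpt := e.map_source hpe
  have hev : ∀ v, fderiv ℝ (ρ ∘ e.symm) (e p) v < 0 →
      ∀ᶠ t : ℝ in nhdsWithin 0 (Set.Ioi 0), (u ∘ e.symm) (e p + t • v) ≤ (u ∘ e.symm) (e p) :=
    fun v hv => (eventually_mem_of_inward hΩ he hp hpe hv).mono fun t ht => by
      rw [Function.comp_apply, Function.comp_apply, e.left_inv hpe]
      exact hmax _ ht.2
  have hd : ∀ v, fderiv ℝ (ρ ∘ e.symm) (e p) v < 0 → fderiv ℝ (u ∘ e.symm) (e p) v ≤ 0 :=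
    fun v hv => fderiv_nonpos_of_eventually_le (contDiffOn_diff e.open_target hf hpt) (hev v hv)
  set ν : EuclideanSpace ℝ (Fin n) :=
    WithLp.toLp 2 (coordNormal (metricInChart g e) (ρ ∘ e.symm) (e p)) with hν
  have huν : fderiv ℝ (u ∘ e.symm) (e p) ν
      = coordNormalDeriv (metricInChart g e) (ρ ∘ e.symm) (u ∘ e.symm) (e p) :=
    fderiv_apply_eq_sum _ _ _
  have hρν : 0 < fderiv ℝ (ρ ∘ e.symm) (e p) ν := by
    rw [fderiv_apply_eq_sum, hν, sum_normal_mul_deriv hG hpt]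
    exact Real.sqrt_pos.2 (hG.pairing_self_pos hpt (hΩ.exists_partialDeriv_ne_zero he hp hpe))
  have hnonneg : 0 ≤ fderiv ℝ (u ∘ e.symm) (e p) ν := by
    have := hd (-ν) (by rw [map_neg]; linarith)
    rw [map_neg] at this
    linarith
  rw [← huν]
  refine ⟨hnonneg, fun h0 => ?_⟩
  have hle : ∀ v, fderiv ℝ (u ∘ e.symm) (e p) v ≤ 0 := fun v => by
    -- subtracting a large multiple of the normal makes `v` point inward
    have h1 := hd (v - ((|fderiv ℝ (ρ ∘ e.symm) (e p) v| + 1)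
      / fderiv ℝ (ρ ∘ e.symm) (e p) ν) • ν) (by
        rw [map_sub, map_smul, smul_eq_mul, div_mul_cancel₀ _ hρν.ne']
        linarith [le_abs_self (fderiv ℝ (ρ ∘ e.symm) (e p) v)])
    rwa [map_sub, map_smul, h0, smul_zero, sub_zero] at h1
  have hzero : fderiv ℝ (u ∘ e.symm) (e p) = 0 := by
    ext v
    refine le_antisymm (hle v) ?_
    have := hle (-v)
    rw [map_neg] at this
    simpa using this
  set Q : EuclideanSpace ℝ (Fin n) → ℝ := fun v =>
    ∑ i, ∑ j, v i * v j * partialDeriv i (partialDeriv j (u ∘ e.symm)) (e p) with hQ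
  have hQc : Continuous Q := by fun_prop
  have hQneg : ∀ v, Q (-v) = Q v := fun v => by simp [hQ]
  have hQ1 : ∀ v, fderiv ℝ (ρ ∘ e.symm) (e p) v ≤ 0 → Q v ≤ 0 := fun v hv => by
    have ht : Filter.Tendsto (fun s : ℝ => Q (v - s • ν)) (nhdsWithin 0 (Set.Ioi 0))
        (nhds (Q v)) := by
      have : Continuous fun s : ℝ => Q (v - s • ν) := by fun_prop
      have h1 := this.tendsto 0
      rw [zero_smul, sub_zero] at h1
      exact h1.mono_left nhdsWithin_le_nhds
    refine le_of_tendsto ht ?_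
    filter_upwards [self_mem_nhdsWithin] with s hs
    have hs' : (0 : ℝ) < s := hs
    refine secondDeriv_nonpos_of_eventually_le e.open_target hf hpt (by rw [hzero]; rfl)
      (hev _ ?_)
    rw [map_sub, map_smul, smul_eq_mul]
    nlinarith [mul_pos hs' hρν]
  refine laplacian_nonpos hG hpt (fun k => by rw [partialDeriv, hzero]; rfl) fun v => ?_
  rcases le_total (fderiv ℝ (ρ ∘ e.symm) (e p) v) 0 with h | h
  · exact hQ1 v h
  · have := hQ1 (-v) (by rw [map_neg]; linarith)
    rwa [hQneg] at this

namespace IsStaticPotential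

lemma neg (hu : IsStaticPotential g Ω ρ u) : IsStaticPotential g Ω ρ (fun q => -u q) where
  smooth := hu.smooth.neg
  nontrivial := by
    obtain ⟨p, hp, h⟩ := hu.nontrivial
    exact ⟨p, hp, neg_ne_zero.2 h⟩
  interior_eq e he p hp hpe i j := by
    have h := hu.interior_eq e he p hp hpe i j
    have h1 := coordLaplacian_neg (G := metricInChart g e) (f := u ∘ e.symm) (x := e p)
    have h2 := coordHess_neg (G := metricInChart g e) (f := u ∘ e.symm) (x := e p) i j
    have h3 : (fun q => -u q) ∘ e.symm = fun y => -(u ∘ e.symm) y := rfl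
    rw [h3, h1, h2]
    linear_combination -h
  boundary_eq e he p hp hpe X Y hX hY := by
    have h := hu.boundary_eq e he p hp hpe X Y hX hY
    have h1 := coordNormalDeriv_neg (G := metricInChart g e) (r := ρ ∘ e.symm) (f := u ∘ e.symm)
      (x := e p)
    have h3 : (fun q => -u q) ∘ e.symm = fun y => -(u ∘ e.symm) y := rfl
    rw [h3, h1]
    linear_combination -h

/-- After a change of sign, a static potential on a relatively compact domain has a positive
maximum. -/
lemma exists_pos_max (hu : IsStaticPotential g Ω ρ u) (hc : IsCompact (closure Ω)) :
    ∃ v, IsStaticPotential g Ω ρ v ∧ ∃ q ∈ closure Ω, 0 < v q ∧ ∀ z ∈ closure Ω, v z ≤ v q := by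
  obtain ⟨p, hp, hp0⟩ := hu.nontrivial
  obtain ⟨q, hq, hmax⟩ := hc.exists_isMaxOn ⟨p, subset_closure hp⟩
    hu.smooth.continuous.abs.continuousOn
  have hq0 : 0 < |u q| := (abs_pos.2 hp0).trans_le (hmax (subset_closure hp))
  rcases lt_or_gt_of_ne (abs_pos.1 hq0) with h | h
  · refine ⟨_, hu.neg, q, hq, neg_pos.2 h, fun z hz => ?_⟩
    rw [← abs_of_neg h]
    exact (neg_le_abs _).trans (hmax hz)
  · refine ⟨u, hu, q, hq, h, fun z hz => ?_⟩
    rw [← abs_of_pos h]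
    exact (le_abs_self _).trans (hmax hz)

section

variable (hu : IsStaticPotential g Ω ρ u) (hΩ : IsDefiningFunction n Ω ρ) (hn : 2 ≤ n)
  (hconn : IsConnected Ω)

include hu hΩ hn hconn

/-- `(n - 1) Δu = -c u` in the closed domain, where `c` is the constant value of the scalar
curvature. -/
lemma laplacian_eq_mul (he : e ∈ IsManifold.maximalAtlas (𝓡 n) ∞ M) {p₀ : M} (hp₀ : p₀ ∈ Ω)
    (hp : p ∈ closure Ω) (hpe : p ∈ e.source) :
    ((n : ℝ) - 1) * coordLaplacian (metricInChart g e) (u ∘ e.symm) (e p)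
      = -(u p * scalarCurvature g p₀) := by
  rw [hu.laplacian_eq he hp hpe]
  have : coordScalar (metricInChart g e) (e p) = scalarCurvature g p₀ := by
    refine eq_of_mem_closure
      (continuousAt_comp_chart (isMetricOn_metricInChart g he).smooth_scalar hpe)
      (continuousAt_const (y := scalarCurvature g p₀)) hp (e.open_source.mem_nhds hpe)
      fun q hq hqe => ?_
    rw [← scalarCurvature_eq hn hu hΩ hconn he (subset_closure hq) hqe]
    exact scalarCurvature_const hn hu hΩ hconn hq hp₀
  rw [this]

/-- Where the scalar curvature is negative, a positive maximum is attained on the boundary, with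
positive normal derivative, so that the mean curvature is positive there. -/
lemma meanCurvature_pos_of_max {p₀ : M} (hp₀ : p₀ ∈ Ω) (hR : scalarCurvature g p₀ < 0)
    (hp : p ∈ closure Ω) (hpos : 0 < u p) (hmax : ∀ z ∈ closure Ω, u z ≤ u p) :
    p ∈ frontier Ω ∧ 0 < meanCurvature g ρ p := by
  have hn' : (0 : ℝ) < (n : ℝ) - 1 := by
    have : (2 : ℝ) ≤ n := by exact_mod_cast hn
    linarith
  have hc := IsManifold.chart_mem_maximalAtlas (n := ∞) (I := 𝓡 n) p
  have hpe := mem_chart_source (EuclideanSpace ℝ (Fin n)) p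
  set c := chartAt (EuclideanSpace ℝ (Fin n)) p
  have hL := hu.laplacian_eq_mul hΩ hn hconn hc hp₀ hp hpe
  have hLpos : 0 < coordLaplacian (metricInChart g c) (u ∘ c.symm) (c p) := by
    refine (mul_pos_iff_of_pos_left hn').1 ?_
    rw [hL]
    nlinarith
  rcases (closure_eq_self_union_frontier Ω).subset hp with h | h
  · exfalso
    have hloc : IsLocalMax (u ∘ c.symm) (c p) := by
      have : Filter.Tendsto c.symm (nhds (c p)) (nhds p) := by
        have := c.continuousAt_symm (c.map_source hpe)
        rwa [ContinuousAt, c.left_inv hpe] at this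
      filter_upwards [this.eventually (hΩ.isOpen.mem_nhds h)] with y hy
      rw [Function.comp_apply, Function.comp_apply, c.left_inv hpe]
      exact hmax _ (subset_closure hy)
    exact absurd (laplacian_nonpos_of_isLocalMax (isMetricOn_metricInChart g hc)
      (smooth_comp_symm hc hu.smooth) (c.map_source hpe) hloc) (not_le.2 hLpos)
  · refine ⟨h, ?_⟩
    obtain ⟨h1, h2⟩ := normalDeriv_nonneg_and_laplacian_nonpos (g := g) hΩ hu.smooth hc h hpe
      fun q hq => hmax q (subset_closure hq)
    have h3 := lt_of_le_of_ne h1 fun h0 => absurd (h2 h0.symm) (not_le.2 hLpos)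
    refine (mul_pos_iff_of_pos_left hpos).1 ?_
    rw [hu.mul_meanCurvature hΩ hn hconn hc h hpe]
    exact mul_pos hn' h3

lemma meanCurvature_nonneg_of_max (hp : p ∈ frontier Ω) (hpos : 0 < u p)
    (hmax : ∀ z ∈ Ω, u z ≤ u p) : 0 ≤ meanCurvature g ρ p := by
  have hn' : (0 : ℝ) < (n : ℝ) - 1 := by
    have : (2 : ℝ) ≤ n := by exact_mod_cast hn
    linarith
  have hc := IsManifold.chart_mem_maximalAtlas (n := ∞) (I := 𝓡 n) p
  have hpe := mem_chart_source (EuclideanSpace ℝ (Fin n)) p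
  have h1 := (normalDeriv_nonneg_and_laplacian_nonpos (g := g) hΩ hu.smooth hc hp hpe hmax).1
  refine (mul_nonneg_iff_of_pos_left hpos).1 ?_
  rw [hu.mul_meanCurvature hΩ hn hconn hc hp hpe]
  exact mul_nonneg hn'.le h1

/-- In the scalar-flat case a static potential is harmonic, so that it is constant if it has an
interior maximum. -/
lemma eq_of_interior_max {p₀ : M} (hp₀ : p₀ ∈ Ω) (hR : scalarCurvature g p₀ = 0)
    (hmax : ∀ z ∈ Ω, u z ≤ u p₀) {q : M} (hq : q ∈ closure Ω) : u q = u p₀ := by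
  have hn' : ((n : ℝ) - 1) ≠ 0 := by
    have : (2 : ℝ) ≤ n := by exact_mod_cast hn
    exact (by linarith : (0 : ℝ) < (n : ℝ) - 1).ne'
  have hZ : IsClosed {q | u q = u p₀} := isClosed_eq hu.smooth.continuous continuous_const
  have hloc : ∀ x ∈ Ω, u x = u p₀ → x ∈ interior {q | u q = u p₀} := by
    intro x hx hxm
    have hc := IsManifold.chart_mem_maximalAtlas (n := ∞) (I := 𝓡 n) x
    have hxe := mem_chart_source (EuclideanSpace ℝ (Fin n)) x
    set c := chartAt (EuclideanSpace ℝ (Fin n)) x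
    have hV : IsOpen (c.target ∩ c.symm ⁻¹' Ω) := c.isOpen_inter_preimage_symm hΩ.isOpen
    have hev := eventually_eq_of_isMaxOn
      ((isMetricOn_metricInChart g hc).mono hV Set.inter_subset_left)
      ((smooth_comp_symm hc hu.smooth).mono Set.inter_subset_left) (fun z hz => by
        have h1 := hu.laplacian_eq_mul hΩ hn hconn hc hp₀ (subset_closure hz.2) (c.map_target hz.1)
        rw [c.right_inv hz.1, hR, mul_zero, neg_zero] at h1
        exact (mul_eq_zero.1 h1).resolve_left hn') (m := u p₀) (fun z hz => hmax _ hz.2)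
      (⟨c.map_source hxe, by rwa [Set.mem_preimage, c.left_inv hxe]⟩ :
        c x ∈ c.target ∩ c.symm ⁻¹' Ω) (by rw [Function.comp_apply, c.left_inv hxe, hxm])
    rw [mem_interior_iff_mem_nhds]
    filter_upwards [c.open_source.mem_nhds hxe, (c.continuousAt hxe).eventually hev] with y hy hy'
    rwa [Function.comp_apply, c.left_inv hy] at hy'
  have hsub : Ω ⊆ interior {q | u q = u p₀} :=
    hconn.isPreconnected.subset_of_closure_inter_subset isOpen_interior
      ⟨p₀, hp₀, hloc p₀ hp₀ rfl⟩ fun x hx =>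
        hloc x hx.2 (closure_minimal interior_subset hZ hx.1)
  exact closure_minimal (hsub.trans interior_subset) hZ hq

end

end IsStaticPotential

end Maxima

end

end StaticBoundary

theorem mainTheorem7 (n : ℕ) (hn : 2 ≤ n) (M : Type*) [TopologicalSpace M] [T2Space M]
    [SecondCountableTopology M] [ChartedSpace (EuclideanSpace ℝ (Fin n)) M]
    [IsManifold (𝓡 n) ∞ M] (g : StaticBoundary.SmoothMetric n M) (Ω : Set M) (ρ : M → ℝ)
    (hΩ : StaticBoundary.IsNonGenericDomain g Ω ρ) (hcpt : IsCompact (closure Ω)) :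
    ((∀ p ∈ Ω, StaticBoundary.scalarCurvature g p < 0) →
      (∃ p ∈ frontier Ω, ∀ q ∈ connectedComponentIn (frontier Ω) p,
        0 < StaticBoundary.meanCurvature g ρ q) ∧
      (IsConnected (frontier Ω) ∨ (∀ p ∈ frontier Ω, ∀ q ∈ frontier Ω,
          StaticBoundary.meanCurvature g ρ p = StaticBoundary.meanCurvature g ρ q) →
        ∀ q ∈ frontier Ω, 0 < StaticBoundary.meanCurvature g ρ q)) ∧
    ((frontier Ω).Nonempty → (∀ q ∈ frontier Ω, StaticBoundary.meanCurvature g ρ q < 0) →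
      ∀ p ∈ Ω, 0 < StaticBoundary.scalarCurvature g p) := by
  obtain ⟨hdef, hconn, u₀, hu₀⟩ := hΩ
  obtain ⟨u, hu, q, hq, hpos, hmax⟩ := hu₀.exists_pos_max hcpt
  have hloc : ∀ x ∈ frontier Ω, ∀ᶠ y in nhds x, y ∈ frontier Ω →
      StaticBoundary.meanCurvature g ρ y = StaticBoundary.meanCurvature g ρ x :=
    fun x hx => hu.eventually_meanCurvature_eq hdef hn hconn hx
  refine ⟨fun hR => ?_, fun ⟨s, hs⟩ hH p hp => ?_⟩
  · obtain ⟨p₀, hp₀⟩ := hconn.nonempty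
    obtain ⟨hqf, hHq⟩ :=
      hu.meanCurvature_pos_of_max hdef hn hconn hp₀ (hR p₀ hp₀) hq hpos hmax
    refine ⟨⟨q, hqf, fun z hz => ?_⟩, ?_⟩
    · have hsub := connectedComponentIn_subset (frontier Ω) q
      rw [StaticBoundary.eq_of_isPreconnected isPreconnected_connectedComponentIn
        (fun x hx => (hloc x (hsub hx)).mono fun y hy hyc => hy (hsub hyc)) hz
        (mem_connectedComponentIn hqf)]
      exact hHq
    · rintro (hc | hc) z hz
      · rw [StaticBoundary.eq_of_isPreconnected hc.isPreconnected hloc hz hqf]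
        exact hHq
      · rw [hc z hz q hqf]
        exact hHq
  · by_contra hneg
    have hfalse : ∀ x ∈ frontier Ω, 0 < u x → (∀ z ∈ Ω, u z ≤ u x) → False :=
      fun x hx hux hmx =>
        absurd (hu.meanCurvature_nonneg_of_max hdef hn hconn hx hux hmx) (not_le.2 (hH x hx))
    have hmax' : ∀ z ∈ Ω, u z ≤ u q := fun z hz => hmax z (subset_closure hz)
    rcases (closure_eq_self_union_frontier Ω).subset hq with hqΩ | hqf
    · rcases (not_lt.1 hneg).lt_or_eq with hR | hR
      · have hqf := (hu.meanCurvature_pos_of_max hdef hn hconn hp hR hq hpos hmax).1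
        exact hfalse q hqf hpos hmax'
      · rw [StaticBoundary.IsStaticPotential.scalarCurvature_const hn hu hdef hconn hp hqΩ] at hR
        have hus := hu.eq_of_interior_max hdef hn hconn hqΩ hR hmax' (frontier_subset_closure hs)
        exact hfalse s hs (hus ▸ hpos) fun z hz => hus ▸ hmax' z hz
    · exact hfalse q hqf hpos hmax'
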